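/- Let $k$ be a field and let $H=(H,\Delta,\varepsilon,\Phi,S,\alpha,\beta)$ be a quasi-Hopf algebra over $k$, with bijective antipode $S$ and normalized by $\varepsilon(\alpha)=\varepsilon(\beta)=1$. Here $(\mathrm{id}\otimes\Delta)\Delta(h)=\Phi\,(\Delta\otimes \mathrm{id})\Delta(h)\,\Phi^{-1}$. Let $\mathbb A=(\mathbb A,\lambda,\rho,\Phi_\lambda,\Phi_\rho,\Phi_{\lambda,\rho})$ be an $H$-bicomodule algebra in the sense of Hausser and Nill: a left $H$-comodule algebra $(\mathbb A,\lambda,\Phi_\lambda)$ and a right $H$-comodule algebra $(\mathbb A,\rho,\Phi_\rho)$ with $$(\mathrm{id}\otimes\lambda)(\lambda(u))\,\Phi_\lambda=\Phi_\lambda\,(\Delta\otimes \mathrm{id})(\lambda(u)),\qquad \Phi_\rho\,(\rho\otimes \mathrm{id})(\rho(u))=(\mathrm{id}\otimes\Delta)(\rho(u))\,\Phi_\rho ,$$ $$\Phi_{\lambda,\rho}\,(\lambda\otimes \mathrm{id})(\rho(u))=(\mathrm{id}\otimes\rho)(\lambda(u))\,\Phi_{\lambda,\rho},$$ together with the usual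 counit and cocycle conditions for $\Phi_\lambda\in H\otimes H\otimes\mathbb A$, $\Phi_\rho\in\mathbb A\otimes H\otimes H$, $\Phi_{\lambda,\rho}\in H\otimes\mathbb A\otimes H$ (all invertible). Let $C$ be an $H$-bimodule coalgebra, that is, a coalgebra $(C,\underline\Delta,\underline\varepsilon)$ in the monoidal category of $(H,H)$-bimodules with associativity constraint $\Phi\cdot(-)\cdot\Phi^{-1}$. Write (summations understood) $\Delta(h)=h_1\otimes h_2$, $\underline\Delta(c)=c_{\underline 1}\otimes c_{\underline 2}$, $\lambda(u)=u_{[-1]}\otimes u_{[0]}$, $\rho(u)=u_{\langle0\rangle}\otimes u_{\langle1\rangle}$, $\Phi=X^1\otimes X^2\otimes X^3$, $\Phi^{-1}=x^1\otimes x^2\otimes x^3$, $\Phi_\lambda=\tilde X^1_\lambda\otimes\tilde X^2_\lambda\otimes\tilde X^3_\lambda$, $\Phi_\lambda^{-1}=\tilde x^1_\lambda\otimes\tilde x^2_\lambda\otimes\tilde x^3_\lambda$, $\Phi_\rho^{-1}=\tilde x^1_\rho\otimes\tilde x^2_\rho\otimes\tilde x^3_\rho$, $\Phi_{\lambda,\rho}^{-1}=\theta^1\otimes\theta^2\otimes\theta^3$.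 Let $g^1\otimes g^2=f^{-1}$ be the inverse of the Drinfeld twist of $H$, that is, $$g^1\otimes g^2=\Delta(S(x^1)\alpha x^2)\;\delta\;(S\otimes S)(\Delta^{\rm cop}(x^3)),\qquad \delta=B^1\beta S(B^4)\otimes B^2\beta S(B^3),$$ where $B^1\otimes B^2\otimes B^3\otimes B^4=(\Delta\otimes \mathrm{id}\otimes \mathrm{id})(\Phi)(\Phi^{-1}\otimes 1)$. Let ${}_{\mathbb A}\mathcal{YD}(H)^C$ be the category of left-right $(H,\mathbb A,C)$-Yetter-Drinfeld modules. Its objects are left $\mathbb A$-modules $M$ with a $k$-linear map $M\to M\otimes C$, $m\mapsto m_{(0)}\otimes m_{(1)}$, such that $\underline\varepsilon(m_{(1)})m_{(0)}=m$ and, for all $m\in M$ and $u\in\mathbb A$, $$(\theta^2\cdot m_{(0)})_{(0)}\otimes(\theta^2\cdot m_{(0)})_{(1)}\cdot\theta^1\otimes\theta^3\cdot m_{(1)} =\tilde x^1_\rho\cdot(\tilde x^3_\lambda\cdot m)_{(0)}\otimes\tilde x^2_\rho\cdot(\tilde x^3_\lambda\cdot m)_{(1)_{\underline 1}}\cdot\tilde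 x^1_\lambda\otimes\tilde x^3_\rho\cdot(\tilde x^3_\lambda\cdot m)_{(1)_{\underline 2}}\cdot\tilde x^2_\lambda,$$ $$u_{\langle0\rangle}\cdot m_{(0)}\otimes u_{\langle1\rangle}\cdot m_{(1)}=(u_{[0]}\cdot m)_{(0)}\otimes(u_{[0]}\cdot m)_{(1)}\cdot u_{[-1]}.$$ Its morphisms are the $\mathbb A$-linear maps that are compatible with the coactions. Then $\mathfrak C'=C\otimes\mathbb A$ is an $\mathbb A$-coring with $\mathbb A$-bimodule structure $$u\cdot(c\otimes u')\cdot u''=u_{[0]_{\langle1\rangle}}\cdot c\cdot S^{-1}(u_{[-1]})\otimes u_{[0]_{\langle0\rangle}}u'u'',$$ comultiplication $$\Delta_{\mathfrak C'}(c\otimes u)=\left(\theta^3\tilde x^3_\rho(\tilde X^3_\lambda)_{\langle1\rangle_2}\cdot c_{\underline 2}\cdot S^{-1}(\tilde X^1_\lambda g^1)\otimes 1_{\mathbb A}\right)\otimes_{\mathbb A}\left(\theta^2_{\langle1\rangle}\tilde x^2_\rho(\tilde X^3_\lambda)_{\langle1\rangle_1}\cdot c_{\underline 1}\cdot S^{-1}(\theta^1\tilde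 X^2_\lambda g^2)\otimes\theta^2_{\langle0\rangle}\tilde x^1_\rho(\tilde X^3_\lambda)_{\langle0\rangle}u\right)$$ and counit $\varepsilon_{\mathfrak C'}(c\otimes u)=\underline\varepsilon(c)u$, for $u,u',u''\in\mathbb A$ and $c\in C$. Moreover, the category ${}_{\mathbb A}\mathcal{YD}(H)^C$ is isomorphic to the category of left comodules over the coring $\mathfrak C'$, by an isomorphism of categories that is the identity on underlying left $\mathbb A$-modules and on morphisms. -/

import Mathlib

open scoped TensorProduct
open CategoryTheory MulOpposite

universe w

set_option linter.unusedSectionVars false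
set_option maxSynthPendingDepth 8

namespace QuasiHopf

section Tensor

variable (k : Type*) [Field k]

/-- The left action of `R` on `M` as a bilinear map, `r ⊗ m ↦ r · m`. -/
def lact (R M : Type*) [Ring R] [Algebra k R] [AddCommGroup M] [Module k M] [Module R M]
    [IsScalarTower k R M] : R →ₗ[k] M →ₗ[k] M :=
  (Algebra.lsmul k k M : R →ₐ[k] Module.End k M).toLinearMap

/-- The right action of `R` on `M` as a bilinear map, `r ⊗ m ↦ m · r`. -/
def ract (R M : Type*) [Ring R] [Algebra k R] [AddCommGroup M] [Module k M] [Module Rᵐᵒᵖ M]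
    [IsScalarTower k Rᵐᵒᵖ M] : R →ₗ[k] M →ₗ[k] M :=
  (Algebra.lsmul k k M : Rᵐᵒᵖ →ₐ[k] Module.End k M).toLinearMap ∘ₗ
    (opLinearEquiv k : R ≃ₗ[k] Rᵐᵒᵖ).toLinearMap

@[simp] theorem lact_apply {R M : Type*} [Ring R] [Algebra k R] [AddCommGroup M] [Module k M]
    [Module R M] [IsScalarTower k R M] (r : R) (m : M) : lact k R M r m = r • m := rfl

@[simp] theorem ract_apply {R M : Type*} [Ring R] [Algebra k R] [AddCommGroup M] [Module k M]
    [Module Rᵐᵒᵖ M] [IsScalarTower k Rᵐᵒᵖ M] (r : R) (m : M) :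
    ract k R M r m = op r • m := rfl

variable {k}

/-- The bilinear map `(a, b) ↦ f(a) c g(b)`. -/
def sandwich₂ {H : Type*} [Ring H] [Algebra k H] (f g : H →ₗ[k] H) (c : H) :
    H →ₗ[k] H →ₗ[k] H :=
  LinearMap.mk₂ k (fun a b => f a * c * g b)
    (by intros; simp [add_mul]) (by intros; simp) (by intros; simp [mul_add]) (by intros; simp)

/-- The linear map `a ⊗ b ↦ f(a) c g(b)`. -/
def sandwich {H : Type*} [Ring H] [Algebra k H] (f g : H →ₗ[k] H) (c : H) :
    H ⊗[k] H →ₗ[k] H :=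
  TensorProduct.lift (sandwich₂ f g c)

/-- The linear map `a ⊗ b ⊗ e ↦ f(a) c g(b) d h(e)`. -/
def sandwich₃ {H : Type*} [Ring H] [Algebra k H] (f g h : H →ₗ[k] H) (c d : H) :
    H ⊗[k] (H ⊗[k] H) →ₗ[k] H :=
  TensorProduct.lift (LinearMap.mk₂ k (fun a t => f a * c * sandwich g h d t)
    (by intros; simp [add_mul]) (by intros; simp) (by intros; simp [mul_add]) (by intros; simp))

@[simp] theorem sandwich_tmul {H : Type*} [Ring H] [Algebra k H] (f g : H →ₗ[k] H) (c a b : H) :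
    sandwich f g c (a ⊗ₜ b) = f a * c * g b := rfl

@[simp] theorem sandwich₃_tmul {H : Type*} [Ring H] [Algebra k H] (f g h : H →ₗ[k] H)
    (c d a b e : H) :
    sandwich₃ f g h c d (a ⊗ₜ (b ⊗ₜ e)) = f a * c * (g b * d * h e) := rfl

variable (k)

/-- The associativity isomorphism `(X ⊗ Y) ⊗ Z ≅ X ⊗ (Y ⊗ Z)` of algebras. -/
abbrev aassoc (X Y Z : Type*) [Ring X] [Algebra k X] [Ring Y] [Algebra k Y] [Ring Z]
    [Algebra k Z] : (X ⊗[k] Y) ⊗[k] Z ≃ₐ[k] X ⊗[k] (Y ⊗[k] Z) :=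
  Algebra.TensorProduct.assoc k k k X Y Z

/-- The embedding `x ⊗ y ⊗ z ↦ x ⊗ y ⊗ z ⊗ 1`. -/
def padRight (X Y Z W : Type*) [Ring X] [Algebra k X] [Ring Y] [Algebra k Y] [Ring Z]
    [Algebra k Z] [Ring W] [Algebra k W] :
    X ⊗[k] (Y ⊗[k] Z) →ₐ[k] X ⊗[k] (Y ⊗[k] (Z ⊗[k] W)) :=
  Algebra.TensorProduct.map (AlgHom.id k X) (Algebra.TensorProduct.map (AlgHom.id k Y)
    Algebra.TensorProduct.includeLeft)

variable {k}

/-- For `f : X → X₁ ⊗ X₂`, the map `f ⊗ id : X ⊗ Y → X₁ ⊗ (X₂ ⊗ Y)`. -/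
def onFirst {X X₁ X₂ : Type*} [Ring X] [Algebra k X] [Ring X₁] [Algebra k X₁] [Ring X₂]
    [Algebra k X₂] (f : X →ₐ[k] X₁ ⊗[k] X₂) (Y : Type*) [Ring Y] [Algebra k Y] :
    X ⊗[k] Y →ₐ[k] X₁ ⊗[k] (X₂ ⊗[k] Y) :=
  (aassoc k X₁ X₂ Y).toAlgHom.comp (Algebra.TensorProduct.map f (AlgHom.id k Y))

/-- The map `id ⊗ f : Y ⊗ X → Y ⊗ X'`. -/
abbrev onSecond {X X' : Type*} [Ring X] [Algebra k X] [Ring X'] [Algebra k X']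
    (Y : Type*) [Ring Y] [Algebra k Y] (f : X →ₐ[k] X') : Y ⊗[k] X →ₐ[k] Y ⊗[k] X' :=
  Algebra.TensorProduct.map (AlgHom.id k Y) f

end Tensor

section Algebras

/-- A quasi-bialgebra `(H, Δ, ε, Φ)` over `k`. -/
structure QuasiBialgebra (k H : Type*) [Field k] [Ring H] [Algebra k H] where
  /-- the comultiplication `Δ` -/
  comul : H →ₐ[k] H ⊗[k] H
  /-- the counit `ε` -/
  counit : H →ₐ[k] k
  /-- the reassociator `Φ` -/
  Φ : (H ⊗[k] (H ⊗[k] H))ˣ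
  /-- `(id ⊗ Δ)(Δ(h)) = Φ (Δ ⊗ id)(Δ(h)) Φ⁻¹` -/
  coassoc : ∀ h : H, onSecond H comul (comul h) =
    (Φ : H ⊗[k] (H ⊗[k] H)) * onFirst comul H (comul h) * (↑Φ⁻¹ : H ⊗[k] (H ⊗[k] H))
  /-- `(id ⊗ ε)(Δ(h)) = h` -/
  comul_counit : ∀ h : H,
    Algebra.TensorProduct.map (AlgHom.id k H) counit (comul h) = h ⊗ₜ[k] (1 : k)
  /-- `(ε ⊗ id)(Δ(h)) = h` -/
  counit_comul : ∀ h : H,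
    Algebra.TensorProduct.map counit (AlgHom.id k H) (comul h) = (1 : k) ⊗ₜ[k] h
  /-- `(1 ⊗ Φ)(id ⊗ Δ ⊗ id)(Φ)(Φ ⊗ 1) = (id ⊗ id ⊗ Δ)(Φ)(Δ ⊗ id ⊗ id)(Φ)` -/
  pentagon : (1 ⊗ₜ[k] (Φ : H ⊗[k] (H ⊗[k] H))) * onSecond H (onFirst comul H) Φ *
      padRight k H H H H Φ =
    onSecond H (onSecond H comul) Φ * onFirst comul (H ⊗[k] H) Φ
  /-- `(id ⊗ ε ⊗ id)(Φ) = 1 ⊗ 1` -/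
  normalized : onSecond H (Algebra.TensorProduct.map counit (AlgHom.id k H)) Φ = 1

/-- A quasi-Hopf algebra `(H, Δ, ε, Φ, S, α, β)`; the antipode `S` is an anti-automorphism of the
algebra `H` (in particular bijective), and `α, β` are normalized by `ε(α) = ε(β) = 1`. -/
structure QuasiHopfAlgebra (k H : Type*) [Field k] [Ring H] [Algebra k H] extends
    QuasiBialgebra k H where
  /-- the antipode -/
  S : H ≃ₗ[k] H
  S_one : S 1 = 1
  S_mul : ∀ g h : H, S (g * h) = S h * S g
  α : H
  β : H
  /-- `S(h₁) α h₂ = ε(h) α` -/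
  antipode_left : ∀ h : H, sandwich S.toLinearMap LinearMap.id α (comul h) = counit h • α
  /-- `h₁ β S(h₂) = ε(h) β` -/
  antipode_right : ∀ h : H, sandwich LinearMap.id S.toLinearMap β (comul h) = counit h • β
  /-- `X¹ β S(X²) α X³ = 1` -/
  antipode_Φ : sandwich₃ LinearMap.id S.toLinearMap LinearMap.id β α Φ = 1
  /-- `S(x¹) α x² β S(x³) = 1` -/
  antipode_Φ_inv : sandwich₃ S.toLinearMap LinearMap.id S.toLinearMap α β
    (↑Φ⁻¹ : H ⊗[k] (H ⊗[k] H)) = 1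
  counit_α : counit α = 1
  counit_β : counit β = 1

namespace QuasiHopfAlgebra

variable {k H : Type*} [Field k] [Ring H] [Algebra k H] (Q : QuasiHopfAlgebra k H)

/-- `B = (Δ ⊗ id ⊗ id)(Φ)(Φ⁻¹ ⊗ 1)` -/
def B : H ⊗[k] (H ⊗[k] (H ⊗[k] H)) :=
  onFirst Q.comul (H ⊗[k] H) Q.Φ * padRight k H H H H (↑Q.Φ⁻¹ : H ⊗[k] (H ⊗[k] H))

/-- The linear map `b¹ ⊗ b² ⊗ b³ ⊗ b⁴ ↦ b¹ β S(b⁴) ⊗ b² β S(b³)`. -/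
def deltaMap : H ⊗[k] (H ⊗[k] (H ⊗[k] H)) →ₗ[k] H ⊗[k] H :=
  TensorProduct.lift
    ((TensorProduct.map₂ (sandwich₂ LinearMap.id Q.S.toLinearMap Q.β)
      (sandwich₂ LinearMap.id Q.S.toLinearMap Q.β)).compl₂
        (TensorProduct.comm k H H).toLinearMap) ∘ₗ
    (TensorProduct.assoc k H H (H ⊗[k] H)).symm.toLinearMap

theorem deltaMap_tmul (a b c d : H) : Q.deltaMap (a ⊗ₜ (b ⊗ₜ (c ⊗ₜ d))) =
    (a * Q.β * Q.S d) ⊗ₜ (b * Q.β * Q.S c) := rfl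

/-- `δ = B¹ β S(B⁴) ⊗ B² β S(B³)` -/
def δ : H ⊗[k] H := Q.deltaMap Q.B

/-- The linear map `x¹ ⊗ x² ⊗ x³ ↦ Δ(S(x¹) α x²) δ (S ⊗ S)(Δᶜᵒᵖ(x³))`. -/
def twistInvMap : H ⊗[k] (H ⊗[k] H) →ₗ[k] H ⊗[k] H :=
  TensorProduct.lift (LinearMap.mk₂ k
    (fun (y : H ⊗[k] H) (x : H) =>
      Q.comul (sandwich Q.S.toLinearMap LinearMap.id Q.α y) * Q.δ *
        TensorProduct.map Q.S.toLinearMap Q.S.toLinearMap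
          (TensorProduct.comm k H H (Q.comul x)))
    (by intros; simp [add_mul]) (by intros; simp) (by intros; simp [mul_add])
    (by intros; simp)) ∘ₗ
    (TensorProduct.assoc k H H H).symm.toLinearMap

theorem twistInvMap_tmul (x y z : H) : Q.twistInvMap (x ⊗ₜ (y ⊗ₜ z)) =
    Q.comul (Q.S x * Q.α * y) * Q.δ * TensorProduct.map Q.S.toLinearMap Q.S.toLinearMap
      (TensorProduct.comm k H H (Q.comul z)) := rfl

/-- The inverse `f⁻¹ = g¹ ⊗ g² = Δ(S(x¹) α x²) δ (S ⊗ S)(Δᶜᵒᵖ(x³))` of the Drinfeld twist,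
where `Φ⁻¹ = x¹ ⊗ x² ⊗ x³`. -/
def twistInv : H ⊗[k] H := Q.twistInvMap (↑Q.Φ⁻¹ : H ⊗[k] (H ⊗[k] H))

end QuasiHopfAlgebra

/-- A left `H`-comodule algebra `(A, λ, Φ_λ)`. -/
structure LeftComoduleAlgebra {k H : Type*} [Field k] [Ring H] [Algebra k H]
    (Q : QuasiBialgebra k H) (A : Type*) [Ring A] [Algebra k A] where
  /-- the coaction `λ` -/
  lcoact : A →ₐ[k] H ⊗[k] A
  /-- the reassociator `Φ_λ` -/
  Φl : (H ⊗[k] (H ⊗[k] A))ˣ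
  /-- `(id ⊗ λ)(λ(b)) Φ_λ = Φ_λ (Δ ⊗ id)(λ(b))` -/
  lcoassoc : ∀ b : A, onSecond H lcoact (lcoact b) * (Φl : H ⊗[k] (H ⊗[k] A)) =
    (Φl : H ⊗[k] (H ⊗[k] A)) * onFirst Q.comul A (lcoact b)
  /-- `(1 ⊗ Φ_λ)(id ⊗ Δ ⊗ id)(Φ_λ)(Φ ⊗ 1) = (id ⊗ id ⊗ λ)(Φ_λ)(Δ ⊗ id ⊗ id)(Φ_λ)` -/
  lpentagon : (1 ⊗ₜ[k] (Φl : H ⊗[k] (H ⊗[k] A))) * onSecond H (onFirst Q.comul A) Φl *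
      padRight k H H H A Q.Φ =
    onSecond H (onSecond H lcoact) Φl * onFirst Q.comul (H ⊗[k] A) Φl
  /-- `(ε ⊗ id) ∘ λ = id` -/
  lcounit : ∀ b : A,
    Algebra.TensorProduct.map Q.counit (AlgHom.id k A) (lcoact b) = (1 : k) ⊗ₜ[k] b
  /-- `(id ⊗ ε ⊗ id)(Φ_λ) = 1 ⊗ 1` -/
  lnormalized_mid : onSecond H (Algebra.TensorProduct.map Q.counit (AlgHom.id k A)) Φl = 1
  /-- `(ε ⊗ id ⊗ id)(Φ_λ) = 1 ⊗ 1` -/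
  lnormalized_left : Algebra.TensorProduct.map Q.counit (AlgHom.id k (H ⊗[k] A)) Φl = 1

/-- A right `H`-comodule algebra `(A, ρ, Φ_ρ)`. -/
structure RightComoduleAlgebra {k H : Type*} [Field k] [Ring H] [Algebra k H]
    (Q : QuasiBialgebra k H) (A : Type*) [Ring A] [Algebra k A] where
  /-- the coaction `ρ` -/
  rcoact : A →ₐ[k] A ⊗[k] H
  /-- the reassociator `Φ_ρ` -/
  Φr : (A ⊗[k] (H ⊗[k] H))ˣ
  /-- `Φ_ρ (ρ ⊗ id)(ρ(a)) = (id ⊗ Δ)(ρ(a)) Φ_ρ` -/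
  rcoassoc : ∀ a : A, (Φr : A ⊗[k] (H ⊗[k] H)) * onFirst rcoact H (rcoact a) =
    onSecond A Q.comul (rcoact a) * (Φr : A ⊗[k] (H ⊗[k] H))
  /-- `(1 ⊗ Φ)(id ⊗ Δ ⊗ id)(Φ_ρ)(Φ_ρ ⊗ 1) = (id ⊗ id ⊗ Δ)(Φ_ρ)(ρ ⊗ id ⊗ id)(Φ_ρ)` -/
  rpentagon : (1 ⊗ₜ[k] (Q.Φ : H ⊗[k] (H ⊗[k] H))) * onSecond A (onFirst Q.comul H) Φr *
      padRight k A H H H Φr =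
    onSecond A (onSecond H Q.comul) Φr * onFirst rcoact (H ⊗[k] H) Φr
  /-- `(id ⊗ ε) ∘ ρ = id` -/
  rcounit : ∀ a : A,
    Algebra.TensorProduct.map (AlgHom.id k A) Q.counit (rcoact a) = a ⊗ₜ[k] (1 : k)
  /-- `(id ⊗ ε ⊗ id)(Φ_ρ) = 1 ⊗ 1` -/
  rnormalized_mid : onSecond A (Algebra.TensorProduct.map Q.counit (AlgHom.id k H)) Φr = 1
  /-- `(id ⊗ id ⊗ ε)(Φ_ρ) = 1 ⊗ 1` -/
  rnormalized_right : onSecond A (Algebra.TensorProduct.map (AlgHom.id k H) Q.counit) Φr = 1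

/-- An `H`-bicomodule algebra `(A, λ, ρ, Φ_λ, Φ_ρ, Φ_{λ,ρ})`. -/
structure BicomoduleAlgebra {k H : Type*} [Field k] [Ring H] [Algebra k H]
    (Q : QuasiBialgebra k H) (A : Type*) [Ring A] [Algebra k A] extends
    LeftComoduleAlgebra Q A, RightComoduleAlgebra Q A where
  /-- the element `Φ_{λ,ρ}` -/
  Φlr : (H ⊗[k] (A ⊗[k] H))ˣ
  /-- `Φ_{λ,ρ} (λ ⊗ id)(ρ(u)) = (id ⊗ ρ)(λ(u)) Φ_{λ,ρ}` -/
  quasi_comm : ∀ u : A, (Φlr : H ⊗[k] (A ⊗[k] H)) * onFirst lcoact H (rcoact u) =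
    onSecond H rcoact (lcoact u) * (Φlr : H ⊗[k] (A ⊗[k] H))
  /-- `(1 ⊗ Φ_{λ,ρ})(id ⊗ λ ⊗ id)(Φ_{λ,ρ})(Φ_λ ⊗ 1)
  = (id ⊗ id ⊗ ρ)(Φ_λ)(Δ ⊗ id ⊗ id)(Φ_{λ,ρ})` -/
  pentagon_left : (1 ⊗ₜ[k] (Φlr : H ⊗[k] (A ⊗[k] H))) * onSecond H (onFirst lcoact H) Φlr *
      padRight k H H A H Φl =
    onSecond H (onSecond H rcoact) Φl * onFirst Q.comul (A ⊗[k] H) Φlr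
  /-- `(1 ⊗ Φ_ρ)(id ⊗ ρ ⊗ id)(Φ_{λ,ρ})(Φ_{λ,ρ} ⊗ 1)
  = (id ⊗ id ⊗ Δ)(Φ_{λ,ρ})(λ ⊗ id ⊗ id)(Φ_ρ)` -/
  pentagon_right : (1 ⊗ₜ[k] (Φr : A ⊗[k] (H ⊗[k] H))) * onSecond H (onFirst rcoact H) Φlr *
      padRight k H A H H Φlr =
    onSecond H (onSecond A Q.comul) Φlr * onFirst lcoact (H ⊗[k] H) Φr

/-- An `H`-bimodule coalgebra: an `(H, H)`-bimodule `C` with a comultiplication `Δ_C` and a counit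
`ε_C` making it a coalgebra in the monoidal category of `(H, H)`-bimodules. The right action of
`h` on `c` is written `op h • c`. -/
structure BimoduleCoalgebra {k H : Type*} [Field k] [Ring H] [Algebra k H]
    (Q : QuasiBialgebra k H) (C : Type*) [AddCommGroup C] [Module k C] [Module H C]
    [IsScalarTower k H C] [Module Hᵐᵒᵖ C] [IsScalarTower k Hᵐᵒᵖ C] [SMulCommClass H Hᵐᵒᵖ C] where
  /-- the comultiplication `Δ_C` -/
  comul : C →ₗ[k] C ⊗[k] C
  /-- the counit `ε_C` -/
  counit : C →ₗ[k] k
  /-- `Φ · (Δ_C ⊗ id)(Δ_C(c)) · Φ⁻¹ = (id ⊗ Δ_C)(Δ_C(c))` -/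
  coassoc : ∀ c : C,
    TensorProduct.map₂ (lact k H C) (TensorProduct.map₂ (lact k H C) (lact k H C)) Q.Φ
      (TensorProduct.map₂ (ract k H C) (TensorProduct.map₂ (ract k H C) (ract k H C))
        (↑Q.Φ⁻¹ : H ⊗[k] (H ⊗[k] H))
        (TensorProduct.assoc k C C C (comul.rTensor C (comul c)))) =
      comul.lTensor C (comul c)
  /-- `Δ_C(h · c) = h₁ · c₁ ⊗ h₂ · c₂` -/
  comul_smul : ∀ (h : H) (c : C),
    comul (h • c) = TensorProduct.map₂ (lact k H C) (lact k H C) (Q.comul h) (comul c)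
  /-- `Δ_C(c · h) = c₁ · h₁ ⊗ c₂ · h₂` -/
  comul_op_smul : ∀ (h : H) (c : C),
    comul (op h • c) = TensorProduct.map₂ (ract k H C) (ract k H C) (Q.comul h) (comul c)
  counit_comul : ∀ c : C, TensorProduct.lid k C (counit.rTensor C (comul c)) = c
  comul_counit : ∀ c : C, TensorProduct.rid k C (counit.lTensor C (comul c)) = c
  counit_smul : ∀ (h : H) (c : C), counit (h • c) = Q.counit h * counit c
  counit_op_smul : ∀ (h : H) (c : C), counit (op h • c) = counit c * Q.counit h

end Algebras

section YetterDrinfeld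

variable {k H A C : Type*} [Field k] [Ring H] [Algebra k H] [Ring A] [Algebra k A]
  [AddCommGroup C] [Module k C] [Module H C] [IsScalarTower k H C] [Module Hᵐᵒᵖ C]
  [IsScalarTower k Hᵐᵒᵖ C] [SMulCommClass H Hᵐᵒᵖ C]

section Coactions

variable {M : Type*} [AddCommGroup M] [Module k M] [Module A M] [IsScalarTower k A M]

/-- For a map `r : M → M ⊗ C`, `m ↦ m₀ ⊗ m₁`, and `m : M`, the linear map
`h ⊗ a ↦ (a · m)₀ ⊗ (a · m)₁ · h`. -/
def smulCoact (r : M →ₗ[k] M ⊗[k] C) (m : M) : H ⊗[k] A →ₗ[k] M ⊗[k] C :=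
  TensorProduct.lift (LinearMap.mk₂ k
    (fun (h : H) (a : A) => (ract k H C h).lTensor M (r (a • m)))
    (by intros; simp [LinearMap.lTensor_add]) (by intros; simp [LinearMap.lTensor_smul])
    (by intros; simp [add_smul]) (by intros; simp))

theorem smulCoact_tmul (r : M →ₗ[k] M ⊗[k] C) (m : M) (h : H) (a : A) :
    smulCoact r m (h ⊗ₜ[k] a) = (ract k H C h).lTensor M (r (a • m)) := rfl

/-- For a map `r : M → M ⊗ C`, `m ↦ m₀ ⊗ m₁`, and `m : M`, the linear map
`h ⊗ a ⊗ h' ↦ (a · m₀)₀ ⊗ (a · m₀)₁ · h ⊗ h' · m₁`. -/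
def coactTwice (r : M →ₗ[k] M ⊗[k] C) (m : M) :
    H ⊗[k] (A ⊗[k] H) →ₗ[k] M ⊗[k] (C ⊗[k] C) :=
  TensorProduct.lift (LinearMap.mk₂ k
    (fun (h : H) (t : A ⊗[k] H) => ((ract k H C h).rTensor C).lTensor M
      (TensorProduct.assoc k M C C
        (r.rTensor C (TensorProduct.map₂ (lact k A M) (lact k H C) t (r m)))))
    (by intros; simp [LinearMap.lTensor_add, LinearMap.rTensor_add])
    (by intros; simp [LinearMap.lTensor_smul, LinearMap.rTensor_smul])
    (by intros; simp) (by intros; simp))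

theorem coactTwice_tmul (r : M →ₗ[k] M ⊗[k] C) (m : M) (h : H) (t : A ⊗[k] H) :
    coactTwice r m (h ⊗ₜ[k] t) = ((ract k H C h).rTensor C).lTensor M
      (TensorProduct.assoc k M C C
        (r.rTensor C (TensorProduct.map₂ (lact k A M) (lact k H C) t (r m)))) := rfl

/-- For maps `r : M → M ⊗ C`, `m ↦ m₀ ⊗ m₁`, and `d : C → C ⊗ C`, `c ↦ c₁ ⊗ c₂`, and `m : M`,
the linear map `h ⊗ h' ⊗ a ↦ (a · m)₀ ⊗ ((a · m)₁)₁ · h ⊗ ((a · m)₁)₂ · h'`. -/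
def coactComul (r : M →ₗ[k] M ⊗[k] C) (d : C →ₗ[k] C ⊗[k] C) (m : M) :
    H ⊗[k] (H ⊗[k] A) →ₗ[k] M ⊗[k] (C ⊗[k] C) :=
  TensorProduct.lift (LinearMap.mk₂ k
    (fun (s : H ⊗[k] H) (a : A) =>
      (TensorProduct.map₂ (ract k H C) (ract k H C) s).lTensor M (d.lTensor M (r (a • m))))
    (by intros; simp [LinearMap.lTensor_add]) (by intros; simp [LinearMap.lTensor_smul])
    (by intros; simp [add_smul]) (by intros; simp)) ∘ₗ
    (TensorProduct.assoc k H H A).symm.toLinearMap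

theorem coactComul_tmul (r : M →ₗ[k] M ⊗[k] C) (d : C →ₗ[k] C ⊗[k] C) (m : M) (h h' : H) (a : A) :
    coactComul r d m (h ⊗ₜ[k] (h' ⊗ₜ[k] a)) =
      (TensorProduct.map (ract k H C h) (ract k H C h')).lTensor M
        (d.lTensor M (r (a • m))) := rfl

end Coactions

/-- A left-right `(H, A, C)`-Yetter-Drinfeld module: a left `A`-module `M` with a `k`-linear map
`M → M ⊗ C`, `m ↦ m₀ ⊗ m₁`, subject to the axioms below. -/
structure YDModule {Q : QuasiBialgebra k H} (𝔸 : BicomoduleAlgebra Q A)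
    (𝒞 : BimoduleCoalgebra Q C) where
  carrier : Type w
  [addCommGroup : AddCommGroup carrier]
  [moduleBase : Module k carrier]
  [module : Module A carrier]
  [isScalarTower : IsScalarTower k A carrier]
  /-- the coaction `m ↦ m₀ ⊗ m₁` -/
  coact : carrier →ₗ[k] carrier ⊗[k] C
  /-- `ε_C(m₁) m₀ = m` -/
  counit_coact : ∀ m : carrier,
    TensorProduct.rid k carrier (𝒞.counit.lTensor carrier (coact m)) = m
  /-- `(θ² · m₀)₀ ⊗ (θ² · m₀)₁ · θ¹ ⊗ θ³ · m₁
  = x¹ · (y³ · m)₀ ⊗ x² · ((y³ · m)₁)₁ · y¹ ⊗ x³ · ((y³ · m)₁)₂ · y²`, where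
  `θ = Φ_{λ,ρ}⁻¹`, `x = Φ_ρ⁻¹` and `y = Φ_λ⁻¹` -/
  coassoc : ∀ m : carrier,
    coactTwice coact m (↑𝔸.Φlr⁻¹ : H ⊗[k] (A ⊗[k] H)) =
      TensorProduct.map₂ (lact k A carrier) (TensorProduct.map₂ (lact k H C) (lact k H C))
        (↑𝔸.Φr⁻¹ : A ⊗[k] (H ⊗[k] H))
        (coactComul coact 𝒞.comul m (↑𝔸.Φl⁻¹ : H ⊗[k] (H ⊗[k] A)))
  /-- `u₀ · m₀ ⊗ u₁ · m₁ = (u_[0] · m)₀ ⊗ (u_[0] · m)₁ · u_[-1]`, where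
  `ρ(u) = u₀ ⊗ u₁` and `λ(u) = u_[-1] ⊗ u_[0]` -/
  compat : ∀ (u : A) (m : carrier),
    TensorProduct.map₂ (lact k A carrier) (lact k H C) (𝔸.rcoact u) (coact m) =
      smulCoact coact m (𝔸.lcoact u)

namespace YDModule

variable {Q : QuasiBialgebra k H} {𝔸 : BicomoduleAlgebra Q A} {𝒞 : BimoduleCoalgebra Q C}

attribute [instance] YDModule.addCommGroup YDModule.moduleBase YDModule.module
  YDModule.isScalarTower

/-- Morphisms of Yetter-Drinfeld modules: `A`-linear and `C`-colinear maps. -/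
@[ext] structure Hom (M N : YDModule.{w} 𝔸 𝒞) where
  toLinearMap : M.carrier →ₗ[A] N.carrier
  colinear : ∀ m : M.carrier,
    (toLinearMap.restrictScalars k).rTensor C (M.coact m) = N.coact (toLinearMap m)

/-- The category of left-right `(H, A, C)`-Yetter-Drinfeld modules. -/
instance : Category (YDModule.{w} 𝔸 𝒞) where
  Hom := Hom
  id M := ⟨LinearMap.id, fun m => by
    rw [LinearMap.restrictScalars_id, LinearMap.rTensor_id]; rfl⟩
  comp f g := ⟨g.toLinearMap ∘ₗ f.toLinearMap, fun m => by
    rw [LinearMap.restrictScalars_comp, LinearMap.rTensor_comp_apply, f.colinear, g.colinear]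
    rfl⟩

/-- The forgetful functor to left `A`-modules. -/
def forgetToModule : YDModule.{w} 𝔸 𝒞 ⥤ ModuleCat.{w} A where
  obj M := ModuleCat.of A M.carrier
  map f := ModuleCat.ofHom f.toLinearMap

end YDModule

end YetterDrinfeld

section Corings

/-- The relations `m · a ⊗ n = m ⊗ a · n` in `M ⊗ N`, where `r a m = m · a` and
`l a n = a · n`. -/
def balancedRel {k A M N : Type*} [Field k] [AddCommGroup M] [Module k M]
    [AddCommGroup N] [Module k N] (r : A → Module.End k M) (l : A → Module.End k N) :
    Submodule k (M ⊗[k] N) :=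
  Submodule.span k {x | ∃ (m : M) (a : A) (n : N), x = r a m ⊗ₜ[k] n - m ⊗ₜ[k] l a n}

/-- The tensor product `M ⊗_A N` over a (not necessarily commutative) `k`-algebra `A` of a right
`A`-module `M` and a left `A`-module `N`, as the quotient of `M ⊗ N` by the relations
`m · a ⊗ n = m ⊗ a · n`. Here `r a m = m · a` and `l a n = a · n`. -/
abbrev BTensor {k A M N : Type*} [Field k] [AddCommGroup M] [Module k M]
    [AddCommGroup N] [Module k N] (r : A → Module.End k M) (l : A → Module.End k N) :=
  (M ⊗[k] N) ⧸ balancedRel r l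

namespace BTensor

variable {k A M N P M' N' : Type*} [Field k] [AddCommGroup M] [Module k M]
  [AddCommGroup N] [Module k N] [AddCommGroup P] [Module k P]
  [AddCommGroup M'] [Module k M'] [AddCommGroup N'] [Module k N']

/-- The projection `M ⊗ N → M ⊗_A N`. -/
def mk (r : A → Module.End k M) (l : A → Module.End k N) : M ⊗[k] N →ₗ[k] BTensor r l :=
  (balancedRel r l).mkQ

/-- `m ⊗_A n` -/
abbrev tmul (r : A → Module.End k M) (l : A → Module.End k N) (m : M) (n : N) : BTensor r l :=
  mk r l (m ⊗ₜ n)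

theorem tmul_balanced (r : A → Module.End k M) (l : A → Module.End k N) (m : M) (a : A) (n : N) :
    tmul r l (r a m) n = tmul r l m (l a n) := by
  rw [← sub_eq_zero, ← map_sub]
  exact (Submodule.Quotient.mk_eq_zero _).2 (Submodule.subset_span ⟨m, a, n, rfl⟩)

/-- The map out of `M ⊗_A N` induced by a balanced map. -/
def lift {r : A → Module.End k M} {l : A → Module.End k N} (f : M ⊗[k] N →ₗ[k] P)
    (hf : ∀ m a n, f (r a m ⊗ₜ n) = f (m ⊗ₜ l a n)) : BTensor r l →ₗ[k] P :=
  (balancedRel r l).liftQ f (Submodule.span_le.2 (by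
    rintro _ ⟨m, a, n, rfl⟩
    simp [hf]))

@[simp] theorem lift_mk {r : A → Module.End k M} {l : A → Module.End k N} (f : M ⊗[k] N →ₗ[k] P)
    (hf : ∀ m a n, f (r a m ⊗ₜ n) = f (m ⊗ₜ l a n)) (x : M ⊗[k] N) :
    lift f hf (mk r l x) = f x := rfl

theorem hom_ext {r : A → Module.End k M} {l : A → Module.End k N} {f g : BTensor r l →ₗ[k] P}
    (h : ∀ m n, f (tmul r l m n) = g (tmul r l m n)) : f = g :=
  Submodule.linearMap_qext _ (TensorProduct.ext' h)

/-- `f ⊗_A g` for an `A`-linear map `f` of right modules and an `A`-linear map `g` of left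
modules. -/
def map {r : A → Module.End k M} {l : A → Module.End k N} {r' : A → Module.End k M'}
    {l' : A → Module.End k N'} (f : M →ₗ[k] M') (g : N →ₗ[k] N')
    (hf : ∀ a m, f (r a m) = r' a (f m)) (hg : ∀ a n, g (l a n) = l' a (g n)) :
    BTensor r l →ₗ[k] BTensor r' l' :=
  lift (mk r' l' ∘ₗ TensorProduct.map f g) (by
    intro m a n
    simp only [LinearMap.comp_apply, TensorProduct.map_tmul, hf, hg]
    exact tmul_balanced _ _ _ _ _)

@[simp] theorem map_mk {r : A → Module.End k M} {l : A → Module.End k N}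
    {r' : A → Module.End k M'} {l' : A → Module.End k N'} (f : M →ₗ[k] M') (g : N →ₗ[k] N')
    (hf : ∀ a m, f (r a m) = r' a (f m)) (hg : ∀ a n, g (l a n) = l' a (g n)) (x : M ⊗[k] N) :
    map f g hf hg (mk r l x) = mk r' l' (TensorProduct.map f g x) := rfl

/-- `f ⊗_A id` for an `A`-linear map `f` of right modules. -/
def mapLeft {r : A → Module.End k M} {r' : A → Module.End k M'} (l : A → Module.End k N)
    (f : M →ₗ[k] M') (hf : ∀ a m, f (r a m) = r' a (f m)) : BTensor r l →ₗ[k] BTensor r' l :=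
  map f LinearMap.id hf (fun _ _ => rfl)

/-- `id ⊗_A g` for an `A`-linear map `g` of left modules. -/
def mapRight (r : A → Module.End k M) {l : A → Module.End k N} {l' : A → Module.End k N'}
    (g : N →ₗ[k] N') (hg : ∀ a n, g (l a n) = l' a (g n)) : BTensor r l →ₗ[k] BTensor r l' :=
  map LinearMap.id g (fun _ _ => rfl) hg

/-- For an `A`-bimodule `X` with right action `r` and left action `lX`, the left `A`-action
`a · (x ⊗_A n) = (a · x) ⊗_A n` on `X ⊗_A N`. -/
def leftAct {r : A → Module.End k M} (l : A → Module.End k N) (lX : A → Module.End k M)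
    (hX : ∀ a b x, lX a (r b x) = r b (lX a x)) (a : A) : Module.End k (BTensor r l) :=
  mapLeft l (lX a) (fun b x => hX a b x)

/-- For an `A`-bimodule `Y` with left action `l` and right action `rY`, the right `A`-action
`(m ⊗_A y) · a = m ⊗_A (y · a)` on `M ⊗_A Y`. -/
def rightAct (r : A → Module.End k M) {l : A → Module.End k N} (rY : A → Module.End k N)
    (hY : ∀ a b y, l a (rY b y) = rY b (l a y)) (b : A) : Module.End k (BTensor r l) :=
  mapRight r (rY b) (fun a y => (hY a b y).symm)

/-- For an `A`-bimodule `Y` with actions `lY`, `rY`, the canonical isomorphism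
`(M ⊗_A Y) ⊗_A P → M ⊗_A (Y ⊗_A P)`, `(m ⊗_A y) ⊗_A p ↦ m ⊗_A (y ⊗_A p)`. -/
def assoc (r : A → Module.End k M) (lY rY : A → Module.End k N)
    (hY : ∀ a b y, lY a (rY b y) = rY b (lY a y)) (l : A → Module.End k P) :
    BTensor (rightAct r rY hY) l →ₗ[k] BTensor r (leftAct l lY hY) :=
  lift (TensorProduct.lift (lift (r := r) (l := lY)
    (TensorProduct.lift (LinearMap.mk₂ k
      (fun (m : M) (y : N) =>
        mk r (leftAct l lY hY) ∘ₗ (TensorProduct.mk k M _ m) ∘ₗ mk rY l ∘ₗ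
          TensorProduct.mk k N P y)
      (by intros; ext; simp)
      (by intros; ext; simp)
      (by intros; ext; simp [TensorProduct.tmul_add])
      (by intros; ext; simp)))
    (by
      intro m a y
      ext p
      exact tmul_balanced r (leftAct l lY hY) m a (tmul rY l y p))))
    (by
      intro x a p
      obtain ⟨x, rfl⟩ := Submodule.mkQ_surjective _ x
      induction x using TensorProduct.induction_on with
      | zero => simp
      | tmul m y =>
        change mk r (leftAct l lY hY) (m ⊗ₜ tmul rY l (rY a y) p) =
          mk r (leftAct l lY hY) (m ⊗ₜ tmul rY l y (l a p))
        rw [tmul_balanced]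
      | add x y hx hy => simp only [map_add, TensorProduct.add_tmul, hx, hy])

theorem assoc_tmul (r : A → Module.End k M) (lY rY : A → Module.End k N)
    (hY : ∀ a b y, lY a (rY b y) = rY b (lY a y)) (l : A → Module.End k P) (m : M) (y : N)
    (p : P) :
    assoc r lY rY hY l (tmul (rightAct r rY hY) l (tmul r lY m y) p) =
      tmul r (leftAct l lY hY) m (tmul rY l y p) := rfl

end BTensor

/-- An `A`-coring, for a `k`-algebra `A`: an `A`-bimodule `X` (given by commuting left and right
actions of `A`) with `A`-bimodule maps `Δ : X → X ⊗_A X` and `ε : X → A` that are coassociative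
and counital. -/
structure Coring (k A X : Type*) [Field k] [Ring A] [Algebra k A] [AddCommGroup X]
    [Module k X] where
  /-- the left action, `left a x = a · x` -/
  left : A →ₐ[k] Module.End k X
  /-- the right action, `right (op a) x = x · a` -/
  right : Aᵐᵒᵖ →ₐ[k] Module.End k X
  /-- `a · (x · b) = (a · x) · b` -/
  left_right : ∀ (a b : A) (x : X), left a (right (op b) x) = right (op b) (left a x)
  /-- the comultiplication -/
  comul : X →ₗ[k] BTensor (fun a : A => right (op a)) (fun a => left a)
  /-- the counit -/
  counit : X →ₗ[k] A
  comul_left : ∀ (a : A) (x : X),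
    comul (left a x) = BTensor.leftAct (fun a => left a) (fun a => left a) left_right a (comul x)
  comul_right : ∀ (a : A) (x : X), comul (right (op a) x) =
    BTensor.rightAct (fun a => right (op a)) (fun a => right (op a)) left_right a (comul x)
  counit_left : ∀ (a : A) (x : X), counit (left a x) = a * counit x
  counit_right : ∀ (a : A) (x : X), counit (right (op a) x) = counit x * a
  /-- `(Δ ⊗_A id) ∘ Δ = (id ⊗_A Δ) ∘ Δ` -/
  coassoc : ∀ x : X,
    BTensor.assoc (fun a => right (op a)) (fun a => left a) (fun a => right (op a)) left_right
      (fun a => left a)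
      (BTensor.mapLeft (fun a => left a) comul comul_right (comul x)) =
    BTensor.mapRight (fun a : A => right (op a)) comul comul_left (comul x)
  /-- `(ε ⊗_A id) ∘ Δ = id` -/
  counit_comul : ∀ x : X,
    BTensor.lift (P := X) (TensorProduct.lift (left.toLinearMap ∘ₗ counit))
      (by intro x a y; simp [counit_right]) (comul x) = x
  /-- `(id ⊗_A ε) ∘ Δ = id` -/
  comul_counit : ∀ x : X,
    BTensor.lift (P := X) (TensorProduct.lift
      ((right.toLinearMap ∘ₗ (opLinearEquiv k : A ≃ₗ[k] Aᵐᵒᵖ).toLinearMap ∘ₗ counit).flip))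
      (by intro x a y; simp [counit_left]) (comul x) = x

namespace Coring

variable {k A X : Type*} [Field k] [Ring A] [Algebra k A] [AddCommGroup X] [Module k X]

/-- The left action of `A` on a left `A`-module `M`, as endomorphisms. -/
abbrev act (k : Type*) {A : Type*} [Field k] [Ring A] [Algebra k A] (M : Type*) [AddCommGroup M]
    [Module k M] [Module A M] [IsScalarTower k A M] : A → Module.End k M :=
  fun a => lact k A M a

/-- A left comodule over an `A`-coring: a left `A`-module `M` with a left `A`-linear map
`M → X ⊗_A M` that is coassociative and counital. -/
structure LeftComodule (𝒦 : Coring k A X) where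
  carrier : Type w
  [addCommGroup : AddCommGroup carrier]
  [moduleBase : Module k carrier]
  [module : Module A carrier]
  [isScalarTower : IsScalarTower k A carrier]
  /-- the coaction -/
  coact : carrier →ₗ[k] BTensor (fun a : A => 𝒦.right (op a)) (act k carrier)
  coact_smul : ∀ (a : A) (m : carrier), coact (a • m) =
    BTensor.leftAct (act k carrier) (fun a => 𝒦.left a) 𝒦.left_right a (coact m)
  /-- `(Δ ⊗_A id) ∘ coact = (id ⊗_A coact) ∘ coact` -/
  coassoc : ∀ m : carrier,
    BTensor.assoc (fun a => 𝒦.right (op a)) (fun a => 𝒦.left a) (fun a => 𝒦.right (op a))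
      𝒦.left_right (act k carrier)
      (BTensor.mapLeft (act k carrier) 𝒦.comul 𝒦.comul_right (coact m)) =
    BTensor.mapRight (fun a : A => 𝒦.right (op a)) coact coact_smul (coact m)
  /-- `(ε ⊗_A id) ∘ coact = id` -/
  counit_coact : ∀ m : carrier,
    BTensor.lift (P := carrier) (TensorProduct.lift (lact k A carrier ∘ₗ 𝒦.counit))
      (by intro x a y; simp [𝒦.counit_right, mul_smul]) (coact m) = m

namespace LeftComodule

variable {𝒦 : Coring k A X}

attribute [instance] LeftComodule.addCommGroup LeftComodule.moduleBase LeftComodule.module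
  LeftComodule.isScalarTower

/-- For an `A`-linear map `f : M → N`, the map `id ⊗_A f : X ⊗_A M → X ⊗_A N`. -/
def mapRight (𝒦 : Coring k A X) {M N : Type*} [AddCommGroup M] [Module k M] [Module A M]
    [IsScalarTower k A M] [AddCommGroup N] [Module k N] [Module A N] [IsScalarTower k A N]
    (f : M →ₗ[A] N) : BTensor (fun a : A => 𝒦.right (op a)) (act k M) →ₗ[k]
      BTensor (fun a : A => 𝒦.right (op a)) (act k N) :=
  BTensor.mapRight _ (f.restrictScalars k) (fun a n => f.map_smul a n)

/-- Morphisms of left comodules: `A`-linear maps compatible with the coactions. -/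
@[ext] structure Hom (M N : LeftComodule.{w} 𝒦) where
  toLinearMap : M.carrier →ₗ[A] N.carrier
  colinear : ∀ m : M.carrier, mapRight 𝒦 toLinearMap (M.coact m) = N.coact (toLinearMap m)

theorem mapRight_id (𝒦 : Coring k A X) {M : Type*} [AddCommGroup M] [Module k M] [Module A M]
    [IsScalarTower k A M] : mapRight 𝒦 (LinearMap.id : M →ₗ[A] M) = LinearMap.id :=
  BTensor.hom_ext fun _ _ => rfl

theorem mapRight_comp (𝒦 : Coring k A X) {M N P : Type*} [AddCommGroup M] [Module k M]
    [Module A M] [IsScalarTower k A M] [AddCommGroup N] [Module k N] [Module A N]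
    [IsScalarTower k A N] [AddCommGroup P] [Module k P] [Module A P] [IsScalarTower k A P]
    (g : N →ₗ[A] P) (f : M →ₗ[A] N) :
    mapRight 𝒦 (g ∘ₗ f) = mapRight 𝒦 g ∘ₗ mapRight 𝒦 f :=
  BTensor.hom_ext fun _ _ => rfl

/-- The category of left comodules over an `A`-coring. -/
instance : Category (LeftComodule.{w} 𝒦) where
  Hom := Hom
  id M := ⟨LinearMap.id, fun m => by rw [mapRight_id]; rfl⟩
  comp f g := ⟨g.toLinearMap ∘ₗ f.toLinearMap, fun m => by
    rw [mapRight_comp, LinearMap.comp_apply, f.colinear, g.colinear]; rfl⟩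

/-- The forgetful functor to left `A`-modules. -/
def forgetToModule : LeftComodule.{w} 𝒦 ⥤ ModuleCat.{w} A where
  obj M := ModuleCat.of A M.carrier
  map f := ModuleCat.ofHom f.toLinearMap

end LeftComodule

end Coring

end Corings

section StructureMaps

variable {k H A C : Type*} [Field k] [Ring H] [Algebra k H] [Ring A] [Algebra k A]
  [AddCommGroup C] [Module k C] [Module H C] [IsScalarTower k H C] [Module Hᵐᵒᵖ C]
  [IsScalarTower k Hᵐᵒᵖ C] [SMulCommClass H Hᵐᵒᵖ C]
  (Q : QuasiHopfAlgebra k H)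

/-- The bilinear map `(h, c) ↦ c · S⁻¹(h)`. -/
def ractSInv (C : Type*) [AddCommGroup C] [Module k C] [Module Hᵐᵒᵖ C] [IsScalarTower k Hᵐᵒᵖ C] :
    H →ₗ[k] C →ₗ[k] C :=
  ract k H C ∘ₗ Q.S.symm.toLinearMap

/-- For `c : C` and `v : A`, the linear map `h ⊗ a ⊗ h' ↦ h' · c · S⁻¹(h) ⊗ a v`. -/
def leftActMap (c : C) (v : A) : H ⊗[k] (A ⊗[k] H) →ₗ[k] C ⊗[k] A :=
  TensorProduct.lift (LinearMap.mk₂ k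
    (fun (h : H) (t : A ⊗[k] H) => (ractSInv Q C h).rTensor A
      (TensorProduct.map₂ (lact k H C) (LinearMap.mul k A) (TensorProduct.comm k A H t)
        (c ⊗ₜ[k] v)))
    (by intros; simp [LinearMap.rTensor_add]) (by intros; simp [LinearMap.rTensor_smul])
    (by intros; simp) (by intros; simp))

theorem leftActMap_tmul (c : C) (v : A) (h : H) (a : A) (h' : H) :
    leftActMap Q c v (h ⊗ₜ[k] (a ⊗ₜ[k] h')) = (op (Q.S.symm h) • h' • c) ⊗ₜ[k] (a * v) := rfl

/-- For `v : A`, the bilinear map `(a, c ⊗ c') ↦ (c ⊗ 1) ⊗ (c' ⊗ a v)`. -/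
def insertMap (C : Type*) [AddCommGroup C] [Module k C] (v : A) :
    A →ₗ[k] C ⊗[k] C →ₗ[k] (C ⊗[k] A) ⊗[k] (C ⊗[k] A) :=
  LinearMap.mk₂ k (fun a x => TensorProduct.map ((TensorProduct.mk k C A).flip 1)
      ((TensorProduct.mk k C A).flip (a * v)) x)
    (by intros; simp [add_mul, TensorProduct.map_add_right])
    (by intros; simp [TensorProduct.map_smul_right]) (by intros; simp) (by intros; simp)

/-- For `d = c₁ ⊗ c₂` in `C ⊗ C`, the bilinear map
`(h¹ ⊗ h², h³ ⊗ h⁴) ↦ h⁴ · c₂ · S⁻¹(h¹) ⊗ h³ · c₁ · S⁻¹(h²)`. -/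
def swapActMap (d : C ⊗[k] C) : H ⊗[k] H →ₗ[k] H ⊗[k] H →ₗ[k] C ⊗[k] C :=
  (TensorProduct.map₂ (ractSInv Q C) (ractSInv Q C)).compl₂
    ((TensorProduct.comm k C C).toLinearMap ∘ₗ
      (TensorProduct.map₂ (lact k H C) (lact k H C)).flip d)

/-- For `d = c₁ ⊗ c₂` in `C ⊗ C` and `v : A`, the linear map
`(h¹ ⊗ h²) ⊗ (a ⊗ (h³ ⊗ h⁴)) ↦ (h⁴ · c₂ · S⁻¹(h¹) ⊗ 1) ⊗ (h³ · c₁ · S⁻¹(h²) ⊗ a v)`. -/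
def comulMap (d : C ⊗[k] C) (v : A) :
    (H ⊗[k] H) ⊗[k] (A ⊗[k] (H ⊗[k] H)) →ₗ[k] (C ⊗[k] A) ⊗[k] (C ⊗[k] A) :=
  TensorProduct.lift (LinearMap.mk₂ k
    (fun z t => TensorProduct.lift ((insertMap C v).compl₂ (swapActMap Q d z)) t)
    (by
      intro z z' t
      rw [← LinearMap.add_apply]
      congr 1
      ext
      simp)
    (by
      intro c z t
      rw [← LinearMap.smul_apply]
      congr 1
      ext
      simp)
    (by intros; simp) (by intros; simp))

theorem comulMap_tmul (c₁ c₂ : C) (v : A) (h₁ h₂ : H) (a : A) (h₃ h₄ : H) :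
    comulMap Q (c₁ ⊗ₜ[k] c₂) v ((h₁ ⊗ₜ h₂) ⊗ₜ (a ⊗ₜ (h₃ ⊗ₜ h₄))) =
      ((op (Q.S.symm h₁) • h₄ • c₂) ⊗ₜ 1) ⊗ₜ ((op (Q.S.symm h₂) • h₃ • c₁) ⊗ₜ (a * v)) := rfl

variable (𝔸 : BicomoduleAlgebra Q.toQuasiBialgebra A)

/-- The element
`(X¹ g¹ ⊗ θ¹ X² g²) ⊗ (θ²₀ x¹ X³₀ ⊗ (θ²₁ x² (X³₁)₁ ⊗ θ³ x³ (X³₁)₂))` of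
`(H ⊗ H) ⊗ (A ⊗ (H ⊗ H))`, where `X = Φ_λ`, `x = Φ_ρ⁻¹`, `θ = Φ_{λ,ρ}⁻¹`, `g = f⁻¹` is the
inverse of the Drinfeld twist, `ρ(u) = u₀ ⊗ u₁` and `Δ(h) = h₁ ⊗ h₂`. -/
def comulElement : (H ⊗[k] H) ⊗[k] (A ⊗[k] (H ⊗[k] H)) :=
  Algebra.TensorProduct.map
      (Algebra.TensorProduct.includeRight : H →ₐ[k] H ⊗[k] H) (onFirst 𝔸.rcoact H)
      (↑𝔸.Φlr⁻¹ : H ⊗[k] (A ⊗[k] H)) *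
    (1 ⊗ₜ[k] (↑𝔸.Φr⁻¹ : A ⊗[k] (H ⊗[k] H))) *
    onSecond (H ⊗[k] H) ((onSecond A Q.comul).comp 𝔸.rcoact)
      ((aassoc k H H A).symm (𝔸.Φl : H ⊗[k] (H ⊗[k] A))) *
    (Q.twistInv ⊗ₜ[k] 1)

end StructureMaps

end QuasiHopf

namespace QuasiHopf

/-! ### Placing the legs of a tensor in an algebra through commuting representations -/

section Placement

variable {k : Type*} [Field k]

/-! Because $(C\otimes\mathbb A)\otimes_{\mathbb A}M\cong M\otimes C$ (`untensor`), a comodule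
coaction is a map $F:M\to M\otimes C$ that is linear for $u\cdot(m\otimes
c)=u_{[0]\langle0\rangle}m\otimes u_{[0]\langle1\rangle}c\,S^{-1}(u_{[-1]})$. A Yetter-Drinfeld
coaction $r$ satisfies a different compatibility, and the bridge is the element
$p=X^2S^{-1}(X^1\beta)\otimes X^3$ built from $\Phi_\lambda$ (`pElem`): put
$F(m)=(p^2m)_{(0)}\otimes(p^2m)_{(1)}p^1$. The identity `pElem_intertwine` makes $F$ linear. In the
other direction `recov` contracts with $\Phi_\lambda^{-1}$ and $\alpha$. The two passages are
inverse to each other (`recov_hat`, `hat_recov`), by the pentagon of $\Phi_\lambda$ and the antipode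
identities $X^1\beta S(X^2)\alpha X^3=1$ and $S(x^1)\alpha x^2\beta S(x^3)=1$.

For coassociativity the passage is made twice, with $p^1\otimes\lambda(p^2)p$ in place of $p$. This
loses nothing (`recov_recov`, `eq_iff_hat₂`). The left side of the Yetter-Drinfeld axiom becomes
$\Phi_{\lambda,\rho}$ acting on $(F\otimes\mathrm{id})F$. The right side is computed from
`pElem_comul`, which expresses $\Phi_\lambda^{-1}(p^1\otimes\lambda(p^2)p)$ through
$\Delta(p^1)\otimes p^2$, the inverse twist $f^{-1}$ and $\Phi_\lambda$. After cancelling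
$\Phi_{\lambda,\rho}$ the axiom reads
$(F\otimes\mathrm{id})F=\omega\cdot(\mathrm{id}\otimes\underline\Delta)F$, where $\omega$ is the
action of the element that defines $\Delta_{\mathfrak C'}$ (`coassocLeft_eq_iff`). That is the
comodule axiom under `untensor`.

The coring axioms follow the same pattern. Linearity of $\Delta_{\mathfrak C'}$ is `coringOp_mul`.
Coassociativity combines `coringOp_assoc`, where the pentagons of $\Phi_\lambda$, $\Phi_\rho$ and
$\Phi_{\lambda,\rho}$ meet, with the cocycle identity `twist_cocycle`. The counit axioms reduce to
the normalizations of the reassociators and of $f^{-1}$.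

The facts about $f^{-1}$ come from one correspondence. Let $D,\sigma$ be commuting representations
of $H$ on $V$. Then $U\mapsto D(\beta)U$ is a bijection from the vectors with $D(S(h))U=\sigma(h)U$
onto the vectors on which $h\mapsto D(h_1)\sigma(h_2)$ acts by $\varepsilon$, with inverse the
contraction with $\Phi^{-1}$ (`contrAct_intertwine`, `apply_β_contrAct`, `contrAct_apply_β`). The
twist $f^{-1}$ corresponds to $\delta$. An identity between such vectors may therefore be checked
after applying $\beta$, and the cocycle identity becomes an identity between products of $\delta$'s
that follows from the pentagon (`bop_assoc`).

No Sweedler computation is carried out. The legs of a tensor are sent to an algebra, mostly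
$\mathrm{End}(V)$, by commuting representations, and coproducts and coactions become convolutions
`⋆`, `▷`, `◁`. Every axiom turns into an equation between operators. Where a convolution acts on a
vector, or under a functional, through $\varepsilon$, it is replaced by the trivial representation,
and a reassociator with a suitable trivial leg is $1$. -/

/-- A linear map to an algebra that is multiplicative and unital. -/
class IsRep {X B : Type*} [Ring X] [Algebra k X] [Ring B] [Algebra k B] (f : X →ₗ[k] B) :
    Prop where
  map_mul : ∀ x y, f (x * y) = f x * f y
  map_one : f 1 = 1

/-- Two linear maps to an algebra with commuting images. -/
class Cmm {X Y B : Type*} [Ring X] [Algebra k X] [Ring Y] [Algebra k Y] [Ring B] [Algebra k B]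
    (f : X →ₗ[k] B) (g : Y →ₗ[k] B) : Prop where
  comm : ∀ x y, f x * g y = g y * f x

variable {B : Type*} [Ring B] [Algebra k B]
variable {X Y Z W : Type*} [Ring X] [Algebra k X] [Ring Y] [Algebra k Y] [Ring Z] [Algebra k Z]
  [Ring W] [Algebra k W]

/-- The low priority makes instance search try the structural instances before turning the pair
around. -/
instance (priority := 50) Cmm.symm (f : X →ₗ[k] B) (g : Y →ₗ[k] B) [h : Cmm f g] : Cmm g f :=
  ⟨fun x y => (h.comm y x).symm⟩

instance : IsRep (Algebra.linearMap k B) := ⟨fun x y => by simp, by simp⟩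

instance (φ : X →ₐ[k] Y) (f : Y →ₗ[k] B) [IsRep f] : IsRep (f ∘ₗ φ.toLinearMap) :=
  ⟨fun x y => by simp [IsRep.map_mul], by simp [IsRep.map_one]⟩

instance (φ : X →ₗ[k] Y) (f : Y →ₗ[k] B) (g : Z →ₗ[k] B) [h : Cmm f g] : Cmm (f ∘ₗ φ) g :=
  ⟨fun _ _ => h.comm _ _⟩

theorem IsRep.map_units (f : X →ₗ[k] B) [IsRep f] (u : Xˣ) :
    f (u : X) * f (↑u⁻¹ : X) = 1 := by
  rw [← IsRep.map_mul, Units.mul_inv, IsRep.map_one]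

theorem IsRep.map_units_inv (f : X →ₗ[k] B) [IsRep f] (u : Xˣ) :
    f (↑u⁻¹ : X) * f (u : X) = 1 := by
  rw [← IsRep.map_mul, Units.inv_mul, IsRep.map_one]

/-- The linear map `x ⊗ y ↦ f(x) g(y)`. -/
def pl (f : X →ₗ[k] B) (g : Y →ₗ[k] B) : X ⊗[k] Y →ₗ[k] B :=
  LinearMap.mul' k B ∘ₗ TensorProduct.map f g

@[simp] theorem pl_tmul (f : X →ₗ[k] B) (g : Y →ₗ[k] B) (x : X) (y : Y) :
    pl f g (x ⊗ₜ y) = f x * g y := rfl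

/-- The convolution `x ↦ f(x₁) g(x₂)` along `φ(x) = x₁ ⊗ x₂`. -/
def conv (φ : Z →ₐ[k] X ⊗[k] Y) (f : X →ₗ[k] B) (g : Y →ₗ[k] B) : Z →ₗ[k] B :=
  pl f g ∘ₗ φ.toLinearMap

theorem conv_apply (φ : Z →ₐ[k] X ⊗[k] Y) (f : X →ₗ[k] B) (g : Y →ₗ[k] B) (z : Z) :
    conv φ f g z = pl f g (φ z) := rfl

/-- Commuting images are what makes a placement multiplicative. Together with the instances for
`conv`, this lets instance search verify all placements used below. -/
instance (f : X →ₗ[k] B) (g : Y →ₗ[k] B) [hf : IsRep f] [hg : IsRep g] [h : Cmm f g] :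
    IsRep (pl f g) where
  map_one := by
    rw [Algebra.TensorProduct.one_def, pl_tmul, hf.map_one, hg.map_one, one_mul]
  map_mul s t := by
    induction s using TensorProduct.induction_on with
    | zero => simp
    | add s₁ s₂ h₁ h₂ => simp only [add_mul, map_add, h₁, h₂]
    | tmul a b =>
      induction t using TensorProduct.induction_on with
      | zero => simp
      | add s₁ s₂ h₁ h₂ => simp only [mul_add, map_add, h₁, h₂]
      | tmul c d =>
        simp only [Algebra.TensorProduct.tmul_mul_tmul, pl_tmul, hf.map_mul, hg.map_mul]
        rw [mul_assoc, mul_assoc, ← mul_assoc (f c), h.comm, mul_assoc]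

instance (f : X →ₗ[k] B) (g : Y →ₗ[k] B) (e : Z →ₗ[k] B) [h₁ : Cmm f e] [h₂ : Cmm g e] :
    Cmm (pl f g) e where
  comm s z := by
    induction s using TensorProduct.induction_on with
    | zero => simp
    | add s₁ s₂ h₁ h₂ => simp only [add_mul, mul_add, map_add, h₁, h₂]
    | tmul a b => rw [pl_tmul, mul_assoc, h₂.comm, ← mul_assoc, h₁.comm, mul_assoc]

instance (φ : Z →ₐ[k] X ⊗[k] Y) (f : X →ₗ[k] B) (g : Y →ₗ[k] B) [IsRep f] [IsRep g] [Cmm f g] :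
    IsRep (conv φ f g) := inferInstanceAs (IsRep (pl f g ∘ₗ φ.toLinearMap))

instance (φ : Z →ₐ[k] X ⊗[k] Y) (f : X →ₗ[k] B) (g : Y →ₗ[k] B) (e : W →ₗ[k] B) [Cmm f e]
    [Cmm g e] : Cmm (conv φ f g) e := inferInstanceAs (Cmm (pl f g ∘ₗ φ.toLinearMap) e)

theorem pl_one_tmul (f : X →ₗ[k] B) (g : Y →ₗ[k] B) [IsRep f] (y : Y) :
    pl f g (1 ⊗ₜ y) = g y := by rw [pl_tmul, IsRep.map_one, one_mul]

/-- Absorbs a coproduct inside a tensor into a convolution. With `pl_onSecond` and `pl_padRight` it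
translates each pentagon axiom into an equation in `B`. -/
theorem pl_comp_onFirst (φ : Z →ₐ[k] X ⊗[k] Y) (f : X →ₗ[k] B) (g : Y →ₗ[k] B) (e : W →ₗ[k] B) :
    pl f (pl g e) ∘ₗ (onFirst φ W).toLinearMap = pl (conv φ f g) e := by
  apply TensorProduct.ext'
  intro z y
  change pl f (pl g e) (aassoc k X Y W (φ z ⊗ₜ y)) = pl f g (φ z) * e y
  induction φ z using TensorProduct.induction_on with
  | zero => simp
  | add s₁ s₂ h₁ h₂ => simp only [add_mul, TensorProduct.add_tmul, map_add, h₁, h₂]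
  | tmul a b => simp [mul_assoc]

theorem pl_onFirst (φ : Z →ₐ[k] X ⊗[k] Y) (f : X →ₗ[k] B) (g : Y →ₗ[k] B) (e : W →ₗ[k] B)
    (t : Z ⊗[k] W) : pl f (pl g e) (onFirst φ W t) = pl (conv φ f g) e t :=
  LinearMap.congr_fun (pl_comp_onFirst φ f g e) t

theorem pl_map {X' Y' : Type*} [Ring X'] [Algebra k X'] [Ring Y'] [Algebra k Y']
    (φ : X →ₐ[k] X') (ψ : Y →ₐ[k] Y') (f : X' →ₗ[k] B) (g : Y' →ₗ[k] B) (t : X ⊗[k] Y) :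
    pl f g (Algebra.TensorProduct.map φ ψ t) =
      pl (f ∘ₗ φ.toLinearMap) (g ∘ₗ ψ.toLinearMap) t := by
  induction t using TensorProduct.induction_on with
  | zero => simp
  | add s₁ s₂ h₁ h₂ => simp only [map_add, h₁, h₂]
  | tmul a b => simp

theorem pl_onSecond (φ : Y →ₐ[k] Z) (f : X →ₗ[k] B) (g : Z →ₗ[k] B) (t : X ⊗[k] Y) :
    pl f g (onSecond X φ t) = pl f (g ∘ₗ φ.toLinearMap) t :=
  pl_map (AlgHom.id k X) φ f g t

theorem pl_comp_onSecond (φ : Y →ₐ[k] Z) (f : X →ₗ[k] B) (g : Z →ₗ[k] B) :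
    pl f g ∘ₗ (onSecond X φ).toLinearMap = pl f (g ∘ₗ φ.toLinearMap) :=
  LinearMap.ext (pl_onSecond φ f g)

theorem pl_padRight (f : X →ₗ[k] B) (g : Y →ₗ[k] B) (h : Z →ₗ[k] B) (e : W →ₗ[k] B) [IsRep e]
    (t : X ⊗[k] (Y ⊗[k] Z)) :
    pl f (pl g (pl h e)) (padRight k X Y Z W t) = pl f (pl g h) t := by
  rw [padRight, pl_map]
  congr 2
  apply TensorProduct.ext'
  intro y z
  simp [IsRep.map_one]

/-- To move `J` past a placed tensor it suffices to move it past each leg. Taken with $J$ itself a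
placed reassociator, this is the standard rebracketing step. -/
theorem pl_intertwine {J : B} {f f' : X →ₗ[k] B} {g g' : Y →ₗ[k] B}
    (hf : ∀ x, J * f x = f' x * J) (hg : ∀ y, J * g y = g' y * J) (t : X ⊗[k] Y) :
    J * pl f g t = pl f' g' t * J := by
  induction t using TensorProduct.induction_on with
  | zero => simp
  | add s₁ s₂ h₁ h₂ => simp only [map_add, mul_add, add_mul, h₁, h₂]
  | tmul a b => rw [pl_tmul, pl_tmul, ← mul_assoc, hf, mul_assoc, hg, mul_assoc]

section EndMaps

variable {V V' : Type*} [AddCommGroup V] [Module k V] [AddCommGroup V'] [Module k V']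

theorem pl_intertwine_end {J : V →ₗ[k] V'} {f : X →ₗ[k] Module.End k V}
    {f' : X →ₗ[k] Module.End k V'} {g : Y →ₗ[k] Module.End k V} {g' : Y →ₗ[k] Module.End k V'}
    (hf : ∀ x v, J (f x v) = f' x (J v)) (hg : ∀ y v, J (g y v) = g' y (J v)) (t : X ⊗[k] Y)
    (v : V) : J (pl f g t v) = pl f' g' t (J v) := by
  induction t using TensorProduct.induction_on with
  | zero => simp
  | add s₁ s₂ h₁ h₂ => simp only [map_add, LinearMap.add_apply, h₁, h₂]
  | tmul a b => simp only [pl_tmul, Module.End.mul_apply, hf, hg]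

/-- The left leg acts last, so commutation is needed to bring it next to `v`. For the right leg, in
`pl_apply_right`, it is not. Both serve to replace a leg by the trivial representation on one
particular vector. -/
theorem pl_apply_left {f f' : X →ₗ[k] Module.End k V} {g : Y →ₗ[k] Module.End k V} {v : V}
    [h : Cmm f g] [h' : Cmm f' g] (hf : ∀ x, f x v = f' x v) (t : X ⊗[k] Y) :
    pl f g t v = pl f' g t v := by
  induction t using TensorProduct.induction_on with
  | zero => simp
  | add s₁ s₂ h₁ h₂ => simp only [map_add, LinearMap.add_apply, h₁, h₂]
  | tmul a b =>
    rw [pl_tmul, pl_tmul, h.comm, h'.comm, Module.End.mul_apply, Module.End.mul_apply, hf]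

theorem pl_apply_right {f : X →ₗ[k] Module.End k V} {g g' : Y →ₗ[k] Module.End k V} {v : V}
    (hg : ∀ y, g y v = g' y v) (t : X ⊗[k] Y) : pl f g t v = pl f g' t v := by
  induction t using TensorProduct.induction_on with
  | zero => simp
  | add s₁ s₂ h₁ h₂ => simp only [map_add, LinearMap.add_apply, h₁, h₂]
  | tmul a b => simp only [pl_tmul, Module.End.mul_apply, hg]

/-- Dual to `pl_apply_left`: a leg is replaced under a functional `μ`. Here it is the left leg that
stands next to `μ`, and the right one that needs commutation. -/
theorem pl_covector_left {f f' : X →ₗ[k] Module.End k V} {g : Y →ₗ[k] Module.End k V}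
    {μ : V →ₗ[k] V'} (hf : ∀ x v, μ (f x v) = μ (f' x v)) (t : X ⊗[k] Y) (v : V) :
    μ (pl f g t v) = μ (pl f' g t v) := by
  induction t using TensorProduct.induction_on with
  | zero => simp
  | add s₁ s₂ h₁ h₂ => simp only [map_add, LinearMap.add_apply, h₁, h₂]
  | tmul a b => simp only [pl_tmul, Module.End.mul_apply, hf]

theorem pl_covector_right {f : X →ₗ[k] Module.End k V} {g g' : Y →ₗ[k] Module.End k V}
    [h : Cmm f g] [h' : Cmm f g']
    {μ : V →ₗ[k] V'} (hg : ∀ y v, μ (g y v) = μ (g' y v)) (t : X ⊗[k] Y) (v : V) :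
    μ (pl f g t v) = μ (pl f g' t v) := by
  induction t using TensorProduct.induction_on with
  | zero => simp
  | add s₁ s₂ h₁ h₂ => simp only [map_add, LinearMap.add_apply, h₁, h₂]
  | tmul a b =>
    rw [pl_tmul, pl_tmul, h.comm, h'.comm, Module.End.mul_apply, Module.End.mul_apply, hg]

end EndMaps

end Placement

/-! ### The axioms of quasi-bialgebras and (bi)comodule algebras as operator identities -/

section PlacedAxioms

variable {k H A B : Type*} [Field k] [Ring H] [Algebra k H] [Ring A] [Algebra k A]
  [Ring B] [Algebra k B]

section Quasi

variable (Q : QuasiBialgebra k H)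

local infixl:75 " ⋆ " => conv (QuasiBialgebra.comul Q)

/-- The trivial representation `h ↦ ε(h) 1`. -/
def triv (B : Type*) [Ring B] [Algebra k B] : H →ₗ[k] B :=
  Algebra.linearMap k B ∘ₗ Q.counit.toLinearMap

theorem triv_apply (h : H) : triv Q B h = algebraMap k B (Q.counit h) := rfl

theorem triv_apply_apply {V : Type*} [AddCommGroup V] [Module k V] (h : H) (v : V) :
    triv Q (Module.End k V) h v = Q.counit h • v := by
  simp [triv_apply, Module.algebraMap_end_apply]

instance : IsRep (triv Q B) := ⟨fun x y => by simp [triv_apply], by simp [triv_apply]⟩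

instance {X : Type*} [Ring X] [Algebra k X] (f : X →ₗ[k] B) : Cmm (triv Q B) f :=
  ⟨fun _ _ => Algebra.commutes _ _⟩

theorem pl_triv_left {X : Type*} [Ring X] [Algebra k X] (g : X →ₗ[k] B) [IsRep g] (t : H ⊗[k] X)
    (ht : Algebra.TensorProduct.map Q.counit (AlgHom.id k X) t = 1) :
    pl (triv Q B) g t = 1 := by
  have := pl_map Q.counit (AlgHom.id k X) (Algebra.linearMap k B) g t
  rw [ht, Algebra.TensorProduct.one_def, pl_tmul] at this
  simpa [triv, IsRep.map_one] using this.symm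

@[simp] theorem triv_star (f : H →ₗ[k] B) : triv Q B ⋆ f = f := by
  ext h
  have := pl_map Q.counit (AlgHom.id k H) (Algebra.linearMap k B) f (Q.comul h)
  rw [Q.counit_comul] at this
  simpa [triv, conv_apply] using this.symm

@[simp] theorem star_triv (f : H →ₗ[k] B) : f ⋆ triv Q B = f := by
  ext h
  have := pl_map (AlgHom.id k H) Q.counit f (Algebra.linearMap k B) (Q.comul h)
  rw [Q.comul_counit] at this
  simpa [triv, conv_apply] using this.symm

variable (f g h i : H →ₗ[k] B) [IsRep f] [IsRep g] [IsRep h] [IsRep i] [Cmm f g] [Cmm f h]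
  [Cmm f i] [Cmm g h] [Cmm g i] [Cmm h i]

/-- Convolution is associative only up to conjugation by the placed $\Phi$. This is how
quasi-coassociativity enters. -/
theorem star_assoc (x : H) : (f ⋆ (g ⋆ h)) x * pl f (pl g h) Q.Φ =
    pl f (pl g h) Q.Φ * ((f ⋆ g) ⋆ h) x := by
  have e := congrArg (pl f (pl g h)) (congrArg (· * (Q.Φ : H ⊗[k] (H ⊗[k] H))) (Q.coassoc x))
  simp only [Units.inv_mul_cancel_right] at e
  rw [IsRep.map_mul, IsRep.map_mul, pl_onFirst, pl_onSecond] at e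
  exact e

theorem star_assoc_inv (x : H) : pl f (pl g h) (↑Q.Φ⁻¹ : H ⊗[k] (H ⊗[k] H)) * (f ⋆ (g ⋆ h)) x =
    ((f ⋆ g) ⋆ h) x * pl f (pl g h) (↑Q.Φ⁻¹ : H ⊗[k] (H ⊗[k] H)) := by
  have e := star_assoc Q f g h x
  have e1 := IsRep.map_units (pl f (pl g h)) Q.Φ
  have e2 := IsRep.map_units_inv (pl f (pl g h)) Q.Φ
  calc _ = pl f (pl g h) (↑Q.Φ⁻¹ : H ⊗[k] (H ⊗[k] H)) * ((f ⋆ (g ⋆ h)) x * pl f (pl g h) Q.Φ) *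
        pl f (pl g h) (↑Q.Φ⁻¹ : H ⊗[k] (H ⊗[k] H)) := by simp only [mul_assoc, e1, mul_one]
    _ = _ := by rw [e, ← mul_assoc, e2, one_mul]

theorem pl_pentagon : pl g (pl h i) Q.Φ * pl f (pl (g ⋆ h) i) Q.Φ * pl f (pl g h) Q.Φ =
    pl f (pl g (h ⋆ i)) Q.Φ * pl (f ⋆ g) (pl h i) Q.Φ := by
  have e := congrArg (pl f (pl g (pl h i))) Q.pentagon
  rw [IsRep.map_mul, IsRep.map_mul, IsRep.map_mul, pl_one_tmul, pl_onSecond, pl_comp_onFirst,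
    pl_padRight, pl_onFirst, pl_onSecond] at e
  rwa [pl_comp_onSecond] at e

theorem pl_Φ_mid (f h : H →ₗ[k] B) [IsRep f] [IsRep h] [Cmm f h] :
    pl f (pl (triv Q B) h) Q.Φ = 1 := by
  have e := pl_onSecond (X := H) (Algebra.TensorProduct.map Q.counit (AlgHom.id k H)) f
    (pl (Algebra.linearMap k B) h) Q.Φ
  rw [Q.normalized] at e
  have : pl (triv Q B) h = pl (Algebra.linearMap k B) h ∘ₗ
      (Algebra.TensorProduct.map Q.counit (AlgHom.id k H)).toLinearMap := by
    ext; simp [triv]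
  rw [this, ← e, Algebra.TensorProduct.one_def, Algebra.TensorProduct.one_def, pl_tmul, pl_tmul,
    IsRep.map_one, IsRep.map_one, IsRep.map_one, one_mul, one_mul]

/-- An idempotent with a right inverse is trivial. The pentagon with two trivial legs produces such
idempotents. -/
theorem eq_one_of_mul_self {b c : B} (h : b * b = b) (hc : b * c = 1) : b = 1 := by
  calc b = b * b * c := by rw [mul_assoc, hc, mul_one]
    _ = 1 := by rw [h, hc]

/-- With the first two legs trivial, the pentagon says that this element is idempotent, and it is
invertible. Thus only the middle normalization of $\Phi$ has to be an axiom. -/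
theorem pl_Φ_left : pl (triv Q B) (pl h i) Q.Φ = 1 := by
  have e := pl_pentagon Q (triv Q B) (triv Q B) h i
  rw [triv_star, triv_star, pl_Φ_mid, pl_Φ_mid, mul_one, one_mul] at e
  exact eq_one_of_mul_self e (IsRep.map_units _ Q.Φ)

theorem pl_Φ_right : pl f (pl g (triv Q B)) Q.Φ = 1 := by
  have e := pl_pentagon Q f g (triv Q B) (triv Q B)
  rw [star_triv, star_triv, pl_Φ_mid, pl_Φ_mid, mul_one, one_mul] at e
  exact eq_one_of_mul_self e (IsRep.map_units _ Q.Φ)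

end Quasi

section Left

variable {Q : QuasiBialgebra k H} (L : LeftComoduleAlgebra Q A)

local infixl:75 " ⋆ " => conv (QuasiBialgebra.comul Q)
local infixr:75 " ▷ " => conv (LeftComoduleAlgebra.lcoact L)

@[simp] theorem triv_lco (a : A →ₗ[k] B) : triv Q B ▷ a = a := by
  ext u
  have := pl_map Q.counit (AlgHom.id k A) (Algebra.linearMap k B) a (L.lcoact u)
  rw [L.lcounit] at this
  simpa [triv, conv_apply] using this.symm

variable (f g h : H →ₗ[k] B) (a : A →ₗ[k] B) [IsRep f] [IsRep g] [IsRep h] [IsRep a] [Cmm f g]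
  [Cmm f h] [Cmm f a] [Cmm g h] [Cmm g a] [Cmm h a]

theorem lco_assoc (u : A) : (f ▷ (g ▷ a)) u * pl f (pl g a) L.Φl =
    pl f (pl g a) L.Φl * ((f ⋆ g) ▷ a) u := by
  have e := congrArg (pl f (pl g a)) (L.lcoassoc u)
  rw [IsRep.map_mul, IsRep.map_mul, pl_onFirst, pl_onSecond] at e
  exact e

theorem lco_assoc_inv (u : A) :
    pl f (pl g a) (↑L.Φl⁻¹ : H ⊗[k] (H ⊗[k] A)) * (f ▷ (g ▷ a)) u =
    ((f ⋆ g) ▷ a) u * pl f (pl g a) (↑L.Φl⁻¹ : H ⊗[k] (H ⊗[k] A)) := by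
  have e := lco_assoc L f g a u
  have e1 := IsRep.map_units (pl f (pl g a)) L.Φl
  have e2 := IsRep.map_units_inv (pl f (pl g a)) L.Φl
  calc _ = pl f (pl g a) (↑L.Φl⁻¹ : H ⊗[k] (H ⊗[k] A)) *
        ((f ▷ (g ▷ a)) u * pl f (pl g a) L.Φl) *
        pl f (pl g a) (↑L.Φl⁻¹ : H ⊗[k] (H ⊗[k] A)) := by simp only [mul_assoc, e1, mul_one]
    _ = _ := by rw [e, ← mul_assoc, e2, one_mul]

theorem pl_lpentagon : pl g (pl h a) L.Φl * pl f (pl (g ⋆ h) a) L.Φl * pl f (pl g h) Q.Φ =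
    pl f (pl g (h ▷ a)) L.Φl * pl (f ⋆ g) (pl h a) L.Φl := by
  have e := congrArg (pl f (pl g (pl h a))) L.lpentagon
  rw [IsRep.map_mul, IsRep.map_mul, IsRep.map_mul, pl_one_tmul, pl_onSecond, pl_comp_onFirst,
    pl_padRight, pl_onFirst, pl_onSecond] at e
  rwa [pl_comp_onSecond] at e

theorem pl_Φl_mid : pl f (pl (triv Q B) a) L.Φl = 1 := by
  have e := pl_onSecond (X := H) (Algebra.TensorProduct.map Q.counit (AlgHom.id k A)) f
    (pl (Algebra.linearMap k B) a) L.Φl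
  rw [L.lnormalized_mid] at e
  have : pl (triv Q B) a = pl (Algebra.linearMap k B) a ∘ₗ
      (Algebra.TensorProduct.map Q.counit (AlgHom.id k A)).toLinearMap := by
    ext; simp [triv]
  rw [this, ← e, Algebra.TensorProduct.one_def, Algebra.TensorProduct.one_def, pl_tmul, pl_tmul,
    IsRep.map_one, IsRep.map_one, IsRep.map_one, one_mul, one_mul]

theorem pl_Φl_left : pl (triv Q B) (pl g a) L.Φl = 1 :=
  pl_triv_left Q _ _ L.lnormalized_left

end Left

section Right

variable {Q : QuasiBialgebra k H} (R : RightComoduleAlgebra Q A)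

local infixl:75 " ⋆ " => conv (QuasiBialgebra.comul Q)
local infixl:75 " ◁ " => conv (RightComoduleAlgebra.rcoact R)

@[simp] theorem rco_triv (a : A →ₗ[k] B) : a ◁ triv Q B = a := by
  ext u
  have := pl_map (AlgHom.id k A) Q.counit a (Algebra.linearMap k B) (R.rcoact u)
  rw [R.rcounit] at this
  simpa [triv, conv_apply] using this.symm

variable (f g h : H →ₗ[k] B) (a : A →ₗ[k] B) [IsRep f] [IsRep g] [IsRep h] [IsRep a] [Cmm f g]
  [Cmm f h] [Cmm a f] [Cmm g h] [Cmm a g] [Cmm a h]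

theorem rco_assoc (u : A) : pl a (pl g h) R.Φr * ((a ◁ g) ◁ h) u =
    (a ◁ (g ⋆ h)) u * pl a (pl g h) R.Φr := by
  have e := congrArg (pl a (pl g h)) (R.rcoassoc u)
  rw [IsRep.map_mul, IsRep.map_mul, pl_onFirst, pl_onSecond] at e
  exact e

theorem rco_assoc_inv (u : A) :
    pl a (pl g h) (↑R.Φr⁻¹ : A ⊗[k] (H ⊗[k] H)) * (a ◁ (g ⋆ h)) u =
    ((a ◁ g) ◁ h) u * pl a (pl g h) (↑R.Φr⁻¹ : A ⊗[k] (H ⊗[k] H)) := by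
  have e := rco_assoc R g h a u
  have e1 := IsRep.map_units (pl a (pl g h)) R.Φr
  have e2 := IsRep.map_units_inv (pl a (pl g h)) R.Φr
  calc _ = pl a (pl g h) (↑R.Φr⁻¹ : A ⊗[k] (H ⊗[k] H)) *
        ((a ◁ (g ⋆ h)) u * pl a (pl g h) R.Φr) *
        pl a (pl g h) (↑R.Φr⁻¹ : A ⊗[k] (H ⊗[k] H)) := by simp only [mul_assoc, e1, mul_one]
    _ = _ := by rw [← e, ← mul_assoc, e2, one_mul]

theorem pl_rpentagon : pl f (pl g h) Q.Φ * pl a (pl (f ⋆ g) h) R.Φr * pl a (pl f g) R.Φr =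
    pl a (pl f (g ⋆ h)) R.Φr * pl (a ◁ f) (pl g h) R.Φr := by
  have e := congrArg (pl a (pl f (pl g h))) R.rpentagon
  rw [IsRep.map_mul, IsRep.map_mul, IsRep.map_mul, pl_one_tmul, pl_onSecond, pl_comp_onFirst,
    pl_padRight, pl_onFirst, pl_onSecond] at e
  rwa [pl_comp_onSecond] at e

theorem pl_Φr_mid : pl a (pl (triv Q B) h) R.Φr = 1 := by
  have e := pl_onSecond (X := A) (Algebra.TensorProduct.map Q.counit (AlgHom.id k H)) a
    (pl (Algebra.linearMap k B) h) R.Φr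
  rw [R.rnormalized_mid] at e
  have : pl (triv Q B) h = pl (Algebra.linearMap k B) h ∘ₗ
      (Algebra.TensorProduct.map Q.counit (AlgHom.id k H)).toLinearMap := by
    ext; simp [triv]
  rw [this, ← e, Algebra.TensorProduct.one_def, Algebra.TensorProduct.one_def, pl_tmul, pl_tmul,
    IsRep.map_one, IsRep.map_one, IsRep.map_one, one_mul, one_mul]

theorem pl_Φr_right : pl a (pl f (triv Q B)) R.Φr = 1 := by
  have e := pl_onSecond (X := A) (Algebra.TensorProduct.map (AlgHom.id k H) Q.counit) a
    (pl f (Algebra.linearMap k B)) R.Φr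
  rw [R.rnormalized_right] at e
  have : pl f (triv Q B) = pl f (Algebra.linearMap k B) ∘ₗ
      (Algebra.TensorProduct.map (AlgHom.id k H) Q.counit).toLinearMap := by
    ext; simp [triv]
  rw [this, ← e, Algebra.TensorProduct.one_def, Algebra.TensorProduct.one_def, pl_tmul, pl_tmul,
    IsRep.map_one, IsRep.map_one, IsRep.map_one, one_mul, one_mul]

end Right

section Bi

variable {Q : QuasiBialgebra k H} (R : BicomoduleAlgebra Q A)

local infixl:75 " ⋆ " => conv (QuasiBialgebra.comul Q)
local infixr:75 " ▷ " => conv (LeftComoduleAlgebra.lcoact (BicomoduleAlgebra.toLeftComoduleAlgebra R))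
local infixl:75 " ◁ " => conv (RightComoduleAlgebra.rcoact (BicomoduleAlgebra.toRightComoduleAlgebra R))

variable (f g h : H →ₗ[k] B) (a : A →ₗ[k] B) [IsRep f] [IsRep g] [IsRep h] [IsRep a] [Cmm f g]
  [Cmm f h] [Cmm f a] [Cmm g h] [Cmm g a] [Cmm a h]

theorem bico_comm (u : A) : pl f (pl a h) R.Φlr * ((f ▷ a) ◁ h) u =
    (f ▷ (a ◁ h)) u * pl f (pl a h) R.Φlr := by
  have e := congrArg (pl f (pl a h)) (R.quasi_comm u)
  rw [IsRep.map_mul, IsRep.map_mul, pl_onFirst, pl_onSecond] at e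
  exact e

theorem bico_comm_inv (u : A) :
    pl f (pl a h) (↑R.Φlr⁻¹ : H ⊗[k] (A ⊗[k] H)) * (f ▷ (a ◁ h)) u =
    ((f ▷ a) ◁ h) u * pl f (pl a h) (↑R.Φlr⁻¹ : H ⊗[k] (A ⊗[k] H)) := by
  have e := bico_comm R f h a u
  have e1 := IsRep.map_units (pl f (pl a h)) R.Φlr
  have e2 := IsRep.map_units_inv (pl f (pl a h)) R.Φlr
  calc _ = pl f (pl a h) (↑R.Φlr⁻¹ : H ⊗[k] (A ⊗[k] H)) *
        ((f ▷ (a ◁ h)) u * pl f (pl a h) R.Φlr) *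
        pl f (pl a h) (↑R.Φlr⁻¹ : H ⊗[k] (A ⊗[k] H)) := by simp only [mul_assoc, e1, mul_one]
    _ = _ := by rw [← e, ← mul_assoc, e2, one_mul]

theorem pl_pentagon_left :
    pl g (pl a h) R.Φlr * pl f (pl (g ▷ a) h) R.Φlr * pl f (pl g a) R.Φl =
    pl f (pl g (a ◁ h)) R.Φl * pl (f ⋆ g) (pl a h) R.Φlr := by
  have e := congrArg (pl f (pl g (pl a h))) R.pentagon_left
  rw [IsRep.map_mul, IsRep.map_mul, IsRep.map_mul, pl_one_tmul, pl_onSecond, pl_comp_onFirst,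
    pl_padRight, pl_onFirst, pl_onSecond] at e
  rwa [pl_comp_onSecond] at e

theorem pl_pentagon_right [Cmm a g] :
    pl a (pl g h) R.Φr * pl f (pl (a ◁ g) h) R.Φlr * pl f (pl a g) R.Φlr =
    pl f (pl a (g ⋆ h)) R.Φlr * pl (f ▷ a) (pl g h) R.Φr := by
  have e := congrArg (pl f (pl a (pl g h))) R.pentagon_right
  rw [IsRep.map_mul, IsRep.map_mul, IsRep.map_mul, pl_one_tmul, pl_onSecond, pl_comp_onFirst,
    pl_padRight, pl_onFirst, pl_onSecond] at e
  rwa [pl_comp_onSecond] at e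

/-- Idempotent and invertible, by the mixed pentagon with two trivial legs and the normalization of
$\Phi_\lambda$. On the other side $\Phi_\rho$ plays this role. -/
theorem pl_Φlr_left : pl (triv Q B) (pl a h) R.Φlr = 1 := by
  have e := pl_pentagon_left R (triv Q B) (triv Q B) h a
  rw [triv_star, triv_lco, pl_Φl_left, pl_Φl_left, mul_one, one_mul] at e
  exact eq_one_of_mul_self e (IsRep.map_units _ R.Φlr)

theorem pl_Φlr_right : pl f (pl a (triv Q B)) R.Φlr = 1 := by
  have e := pl_pentagon_right R f (triv Q B) (triv Q B) a
  rw [star_triv, rco_triv, pl_Φr_right, pl_Φr_right, mul_one, one_mul] at e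
  exact eq_one_of_mul_self e (IsRep.map_units _ R.Φlr)

end Bi

end PlacedAxioms

/-! ### Operators on the factors of a tensor product -/

section Operators

variable {k : Type*} [Field k]
variable {X Y Z : Type*} [Ring X] [Algebra k X] [Ring Y] [Algebra k Y] [Ring Z] [Algebra k Z]

section TensorFactors

variable {V V' : Type*} [AddCommGroup V] [Module k V] [AddCommGroup V'] [Module k V']

/-- Operators on the left factor of `V ⊗ V'`. -/
def onL (V' : Type*) [AddCommGroup V'] [Module k V'] (f : X →ₗ[k] Module.End k V) :
    X →ₗ[k] Module.End k (V ⊗[k] V') :=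
  LinearMap.rTensorHom V' ∘ₗ f

/-- Operators on the right factor of `V ⊗ V'`. -/
def onR (V : Type*) [AddCommGroup V] [Module k V] (f : X →ₗ[k] Module.End k V') :
    X →ₗ[k] Module.End k (V ⊗[k] V') :=
  LinearMap.lTensorHom V ∘ₗ f

@[simp] theorem onL_tmul (f : X →ₗ[k] Module.End k V) (x : X) (v : V) (v' : V') :
    onL V' f x (v ⊗ₜ v') = f x v ⊗ₜ v' := rfl

@[simp] theorem onR_tmul (f : X →ₗ[k] Module.End k V') (x : X) (v : V) (v' : V') :
    onR V f x (v ⊗ₜ v') = v ⊗ₜ f x v' := rfl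

instance (f : X →ₗ[k] Module.End k V) [IsRep f] : IsRep (onL V' f) :=
  ⟨fun x y => TensorProduct.ext' fun v v' => by simp [IsRep.map_mul],
    TensorProduct.ext' fun v v' => by simp [IsRep.map_one]⟩

instance (f : X →ₗ[k] Module.End k V') [IsRep f] : IsRep (onR V f) :=
  ⟨fun x y => TensorProduct.ext' fun v v' => by simp [IsRep.map_mul],
    TensorProduct.ext' fun v v' => by simp [IsRep.map_one]⟩

theorem Cmm.apply {f : X →ₗ[k] Module.End k V} {g : Y →ₗ[k] Module.End k V} [h : Cmm f g]
    (x : X) (y : Y) (v : V) : f x (g y v) = g y (f x v) :=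
  LinearMap.congr_fun (h.comm x y) v

instance (f : X →ₗ[k] Module.End k V) (g : Y →ₗ[k] Module.End k V) [Cmm f g] :
    Cmm (onL V' f) (onL V' g) :=
  ⟨fun x y => TensorProduct.ext' fun v v' => by simp [Cmm.apply (f := f) (g := g)]⟩

instance (f : X →ₗ[k] Module.End k V') (g : Y →ₗ[k] Module.End k V') [Cmm f g] :
    Cmm (onR V f) (onR V g) :=
  ⟨fun x y => TensorProduct.ext' fun v v' => by simp [Cmm.apply (f := f) (g := g)]⟩

instance (f : X →ₗ[k] Module.End k V) (g : Y →ₗ[k] Module.End k V') :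
    Cmm (onL V' f) (onR V g) :=
  ⟨fun x y => TensorProduct.ext' fun v v' => by simp⟩

theorem pl_onR (f : X →ₗ[k] Module.End k V') (g : Y →ₗ[k] Module.End k V') (t : X ⊗[k] Y)
    (v : V) (v' : V') : pl (onR V f) (onR V g) t (v ⊗ₜ v') = v ⊗ₜ pl f g t v' := by
  induction t using TensorProduct.induction_on with
  | zero => simp
  | add s₁ s₂ h₁ h₂ => simp only [map_add, LinearMap.add_apply, h₁, h₂, TensorProduct.tmul_add]
  | tmul a b => simp

theorem pl_onL (f : X →ₗ[k] Module.End k V) (g : Y →ₗ[k] Module.End k V) (t : X ⊗[k] Y)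
    (v : V) (v' : V') : pl (onL V' f) (onL V' g) t (v ⊗ₜ v') = pl f g t v ⊗ₜ v' := by
  induction t using TensorProduct.induction_on with
  | zero => simp
  | add s₁ s₂ h₁ h₂ => simp only [map_add, LinearMap.add_apply, h₁, h₂, TensorProduct.add_tmul]
  | tmul a b => simp

end TensorFactors

end Operators

/-! ### Antipode identities and the correspondence $U\mapsto\beta U$ -/

section Antipode

variable {k H B : Type*} [Field k] [Ring H] [Algebra k H] [Ring B] [Algebra k B]
  (Q : QuasiHopfAlgebra k H)

local infixl:75 " ⋆ " => conv (QuasiBialgebra.comul (QuasiHopfAlgebra.toQuasiBialgebra Q))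

/-- Left multiplication by `f(h)`. -/
def lop {X : Type*} [Ring X] [Algebra k X] (f : X →ₗ[k] B) : X →ₗ[k] Module.End k B :=
  LinearMap.mul k B ∘ₗ f

/-- Right multiplication by `f(S(h))`. -/
def rop (f : H →ₗ[k] B) : H →ₗ[k] Module.End k B :=
  (LinearMap.mul k B).flip ∘ₗ f ∘ₗ Q.S.toLinearMap

@[simp] theorem lop_apply {X : Type*} [Ring X] [Algebra k X] (f : X →ₗ[k] B) (h : X) (b : B) :
    lop f h b = f h * b := rfl

@[simp] theorem rop_apply (f : H →ₗ[k] B) (h : H) (b : B) : rop Q f h b = b * f (Q.S h) := rfl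

section OperatorInstances

variable {X Y : Type*} [Ring X] [Algebra k X] [Ring Y] [Algebra k Y]

instance (f : X →ₗ[k] B) [IsRep f] : IsRep (lop f) :=
  ⟨fun x y => LinearMap.ext fun b => by simp [IsRep.map_mul, mul_assoc],
    LinearMap.ext fun b => by simp [IsRep.map_one]⟩

instance (f : H →ₗ[k] B) [IsRep f] : IsRep (rop Q f) :=
  ⟨fun x y => LinearMap.ext fun b => by simp [IsRep.map_mul, mul_assoc, Q.S_mul],
    LinearMap.ext fun b => by simp [IsRep.map_one, Q.S_one]⟩

instance (f : X →ₗ[k] B) (g : Y →ₗ[k] B) [h : Cmm f g] : Cmm (lop f) (lop g) :=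
  ⟨fun x y => LinearMap.ext fun b => by simp [← mul_assoc, h.comm]⟩

instance (f g : H →ₗ[k] B) [h : Cmm f g] : Cmm (rop Q f) (rop Q g) :=
  ⟨fun x y => LinearMap.ext fun b => by simp [mul_assoc, h.comm]⟩

instance (f : X →ₗ[k] B) (g : H →ₗ[k] B) : Cmm (lop f) (rop Q g) :=
  ⟨fun x y => LinearMap.ext fun b => by simp [mul_assoc]⟩

end OperatorInstances

theorem lop_conv {X Y Z : Type*} [Ring X] [Algebra k X] [Ring Y] [Algebra k Y] [Ring Z]
    [Algebra k Z] (φ : Z →ₐ[k] X ⊗[k] Y) (f : X →ₗ[k] B) (g : Y →ₗ[k] B) :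
    lop (conv φ f g) = conv φ (lop f) (lop g) := by
  ext z b
  rw [lop_apply, conv_apply, conv_apply]
  induction φ z using TensorProduct.induction_on with
  | zero => simp
  | add s₁ s₂ h₁ h₂ => simp only [map_add, LinearMap.add_apply, add_mul, h₁, h₂]
  | tmul a c => simp [mul_assoc]

theorem pl_mul_right {X Y : Type*} [Ring X] [Algebra k X] [Ring Y] [Algebra k Y]
    {f : X →ₗ[k] B} {g : Y →ₗ[k] B} {r : X →ₗ[k] Module.End k B} {s : Y →ₗ[k] Module.End k B}
    (hr : ∀ x b, r x b = b * f x) (hs : ∀ x b, s x b = b * g x) [h : Cmm f g] (t : X ⊗[k] Y)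
    (b : B) : pl r s t b = b * pl f g t := by
  induction t using TensorProduct.induction_on with
  | zero => simp
  | add s₁ s₂ h₁ h₂ => simp only [map_add, LinearMap.add_apply, mul_add, h₁, h₂]
  | tmul a c => simp [mul_assoc, hr, hs, ← h.comm]

theorem rop_star (f g : H →ₗ[k] B) [Cmm f g] (x : H) (b : B) :
    (rop Q f ⋆ rop Q g) x b = b * (f ∘ₗ Q.S.toLinearMap ⋆ g ∘ₗ Q.S.toLinearMap) x :=
  pl_mul_right (fun _ _ => rfl) (fun _ _ => rfl) _ b

/-- The identity $h_1\beta S(h_2)=\varepsilon(h)\beta$, transported along any `j` for which `l`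
becomes left multiplication and `r` right multiplication by the antipode. -/
theorem invariant_β {V : Type*} [AddCommGroup V] [Module k V] {l r : H →ₗ[k] Module.End k V}
    {j : H →ₗ[k] V} (h : ∀ a b c, l a (r b (j c)) = j (a * c * Q.S b)) (x : H) :
    (l ⋆ r) x (j Q.β) = Q.counit x • j Q.β := by
  rw [conv_apply, ← map_smul, ← Q.antipode_right]
  induction Q.comul x using TensorProduct.induction_on with
  | zero => simp
  | add s₁ s₂ h₁ h₂ => simp only [map_add, LinearMap.add_apply, h₁, h₂]
  | tmul a b => simp [h]

theorem invariant_β_mul (f : H →ₗ[k] B) [IsRep f] (y z : B) (hy : ∀ x, f x * y = y * f x)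
    (hz : ∀ x, f x * z = z * f x) (x : H) :
    (lop f ⋆ rop Q f) x (y * f Q.β * z) = Q.counit x • (y * f Q.β * z) := by
  refine invariant_β Q (j := (LinearMap.mul k B).flip z ∘ₗ LinearMap.mul k B y ∘ₗ f) ?_ x
  intro a b c
  simp only [rop_apply, lop_apply, LinearMap.comp_apply, LinearMap.flip_apply,
    LinearMap.mul_apply_apply, IsRep.map_mul]
  rw [mul_assoc _ z, ← hz]
  simp only [← mul_assoc]
  rw [hy]

/-- The operator `z ↦ z S(h)` on `H`. -/
abbrev ropS : H →ₗ[k] Module.End k H := rop Q LinearMap.id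

instance : IsRep (LinearMap.id : H →ₗ[k] H) := ⟨fun _ _ => rfl, rfl⟩

section Contraction

variable {V : Type*} [AddCommGroup V] [Module k V] (D σ : H →ₗ[k] Module.End k V)

/-- The linear map `z ⊗ y ↦ D(z α) y`. -/
def contr : H ⊗[k] V →ₗ[k] V :=
  TensorProduct.lift (D ∘ₗ (LinearMap.mul k H).flip Q.α)

@[simp] theorem contr_tmul (z : H) (y : V) : contr Q D (z ⊗ₜ y) = D (z * Q.α) y := rfl

/-- The identity $S(h_1)\alpha h_2=\varepsilon(h)\alpha$ in operator form: under the functional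
`contr` the convolution `onL V (ropS Q) ⋆ onR H D` acts as the trivial representation. -/
theorem contr_invariant [IsRep D] (x : H) (t : H ⊗[k] V) :
    contr Q D ((onL V (ropS Q) ⋆ onR H D) x t) = Q.counit x • contr Q D t := by
  induction t using TensorProduct.induction_on with
  | zero => simp
  | add s₁ s₂ h₁ h₂ => simp only [map_add, h₁, h₂, smul_add]
  | tmul z y =>
    have h := congrArg (fun w => D (z * w) y) (Q.antipode_left x)
    simp only [mul_smul_comm, map_smul, LinearMap.smul_apply] at h
    rw [contr_tmul, ← h, conv_apply]
    induction Q.comul x using TensorProduct.induction_on with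
    | zero => simp
    | add s₁ s₂ h₁ h₂ => simp only [map_add, LinearMap.add_apply, mul_add, h₁, h₂]
    | tmul a b => simp [← mul_assoc, IsRep.map_mul]

/-- The linear map `x ⊗ y ⊗ z ↦ (v ↦ D(S(x) α y) σ(z) v)`. -/
def contrAct (t : H ⊗[k] (H ⊗[k] H)) : V →ₗ[k] V :=
  contr Q D ∘ₗ pl (onL V (ropS Q)) (pl (onR H D) (onR H σ)) t ∘ₗ TensorProduct.mk k H V 1

theorem contrAct_tmul [IsRep D] (x y z : H) (v : V) :
    contrAct Q D σ (x ⊗ₜ (y ⊗ₜ z)) v = D (Q.S x * Q.α * y) (σ z v) := by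
  simp [contrAct, IsRep.map_mul]

theorem contr_mul_left [IsRep D] (h : H) (t : H ⊗[k] V) :
    contr Q D ((LinearMap.mul k H h).rTensor V t) = D h (contr Q D t) := by
  induction t using TensorProduct.induction_on with
  | zero => simp
  | add s₁ s₂ h₁ h₂ => simp only [map_add, h₁, h₂]
  | tmul z y => simp [mul_assoc, IsRep.map_mul]

theorem pl_mul_left {X : Type*} [Ring X] [Algebra k X] (h : H) (F : X →ₗ[k] Module.End k V)
    (t : H ⊗[k] X) (v : H ⊗[k] V) :
    (LinearMap.mul k H h).rTensor V (pl (onL V (ropS Q)) (onR H F) t v) =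
      pl (onL V (ropS Q)) (onR H F) t ((LinearMap.mul k H h).rTensor V v) := by
  refine pl_intertwine_end ?_ ?_ t v
  · intro x v
    induction v using TensorProduct.induction_on with
    | zero => simp
    | add s₁ s₂ h₁ h₂ => simp only [map_add, h₁, h₂]
    | tmul z y => simp [mul_assoc]
  · intro x v
    induction v using TensorProduct.induction_on with
    | zero => simp
    | add s₁ s₂ h₁ h₂ => simp only [map_add, h₁, h₂]
    | tmul z y => simp

theorem pl_onR_eq {X Y : Type*} [Ring X] [Algebra k X] [Ring Y] [Algebra k Y]
    (f : X →ₗ[k] Module.End k V) (g : Y →ₗ[k] Module.End k V) :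
    pl (onR H f) (onR H g) = onR H (pl f g) :=
  LinearMap.ext fun t => TensorProduct.ext' fun v v' => pl_onR f g t v v'

theorem conv_onR {X Y Z : Type*} [Ring X] [Algebra k X] [Ring Y] [Algebra k Y] [Ring Z]
    [Algebra k Z] (φ : Z →ₐ[k] X ⊗[k] Y)
    (f : X →ₗ[k] Module.End k V) (g : Y →ₗ[k] Module.End k V) :
    conv φ (onR H f) (onR H g) = onR H (conv φ f g) := by
  rw [conv, pl_onR_eq]; rfl

/-- Multiplication by `h` on the left of a contraction. -/
theorem apply_contrAct [IsRep D] (h : H) (t : H ⊗[k] (H ⊗[k] H)) (v : V) :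
    D h (contrAct Q D σ t v) =
      contr Q D (pl (onL V (ropS Q)) (pl (onR H D) (onR H σ)) t (h ⊗ₜ v)) := by
  rw [contrAct, LinearMap.comp_apply, LinearMap.comp_apply, ← contr_mul_left, pl_onR_eq,
    pl_mul_left]
  simp

variable [IsRep D] [IsRep σ] [Cmm D σ]

/-- Move $x$ through $\Phi^{-1}$. Invariance of `d` absorbs `D ⋆ σ` on the vector side, the
contraction absorbs `ropS ⋆ D` on the functional side, and $\sigma(x)$ is what remains. -/
theorem contrAct_intertwine {d : V} (hd : ∀ x, (D ⋆ σ) x d = Q.counit x • d) (x : H) :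
    D (Q.S x) (contrAct Q D σ (↑Q.Φ⁻¹ : H ⊗[k] (H ⊗[k] H)) d) =
      σ x (contrAct Q D σ (↑Q.Φ⁻¹ : H ⊗[k] (H ⊗[k] H)) d) := by
  have e := star_assoc_inv Q.toQuasiBialgebra (onL V (ropS Q)) (onR H D) (onR H σ) x
  -- The factor `S x` is produced by a full convolution acting on `1 ⊗ d`, in which the last two
  -- legs are trivial.
  have h1 : (onL V (ropS Q) ⋆ (onR H D ⋆ onR H σ)) x ((1 : H) ⊗ₜ d) = Q.S x ⊗ₜ d := by
    rw [conv_onR, conv_apply, pl_apply_right (g' := triv Q.toQuasiBialgebra _), ← conv_apply,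
      star_triv]
    · simp
    · intro y
      rw [onR_tmul, hd, triv_apply_apply, TensorProduct.tmul_smul]
  rw [apply_contrAct, ← h1, ← Module.End.mul_apply, e, Module.End.mul_apply, conv_apply,
    pl_covector_left (f' := triv Q.toQuasiBialgebra _), ← conv_apply, triv_star]
  · rw [contrAct, LinearMap.comp_apply, LinearMap.comp_apply]
    generalize (pl (onL V (ropS Q)) (pl (onR H D) (onR H σ))
      (↑Q.Φ⁻¹ : H ⊗[k] (H ⊗[k] H)) : H ⊗[k] V →ₗ[k] H ⊗[k] V) = T
    change _ = σ x (contr Q D (T (1 ⊗ₜ d)))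
    induction T (1 ⊗ₜ d) using TensorProduct.induction_on with
    | zero => simp
    | add s₁ s₂ h₁ h₂ => simp only [map_add, h₁, h₂]
    | tmul z y => simp [Cmm.apply (f := D) (g := σ)]
  · intro y v
    rw [contr_invariant, triv_apply_apply, map_smul]

/-- This is $X^1\beta S(X^2)\alpha X^3=1$ acting through `D`. -/
theorem contr_β (D : H →ₗ[k] Module.End k V) [IsRep D] (d : V) :
    contr Q D (pl (onL V (lop (LinearMap.id : H →ₗ[k] H))) (pl (onL V (ropS Q))
      (onR H D)) Q.Φ (Q.β ⊗ₜ[k] d)) = d := by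
  have e3 : ∀ t, contr Q D (pl (onL V (lop (LinearMap.id : H →ₗ[k] H))) (pl (onL V (ropS Q))
      (onR H D)) t (Q.β ⊗ₜ[k] d)) =
      D (sandwich₃ LinearMap.id Q.S.toLinearMap LinearMap.id Q.β Q.α t) d := by
    intro t
    induction t using TensorProduct.induction_on with
    | zero => simp
    | add s₁ s₂ h₁ h₂ => simp only [map_add, LinearMap.add_apply, h₁, h₂]
    | tmul a t =>
      induction t using TensorProduct.induction_on with
      | zero => simp
      | add s₁ s₂ h₁ h₂ =>
        simp only [map_add, LinearMap.add_apply, TensorProduct.tmul_add, h₁, h₂]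
      | tmul b c => simp [mul_assoc, IsRep.map_mul]
  rw [e3, Q.antipode_Φ, IsRep.map_one, Module.End.one_apply]

theorem β_tmul_invariant (d : V) (x : H) :
    (onL V (lop (LinearMap.id : H →ₗ[k] H)) ⋆ onL V (ropS Q)) x (Q.β ⊗ₜ[k] d) =
      triv Q.toQuasiBialgebra (Module.End k (H ⊗[k] V)) x (Q.β ⊗ₜ[k] d) := by
  rw [triv_apply_apply]
  refine invariant_β Q (j := (TensorProduct.mk k H V).flip d) ?_ x
  intro a b c
  simp [mul_assoc]

/-- The pentagon is applied to $\beta\otimes d$. Invariance of $\beta$ and of $d$ makes its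
two-factor side trivial, the contraction kills the middle factor of the other side, and `contr_β`
evaluates the last one. -/
theorem apply_β_contrAct {d : V} (hd : ∀ x, (D ⋆ σ) x d = Q.counit x • d) :
    D Q.β (contrAct Q D σ (↑Q.Φ⁻¹ : H ⊗[k] (H ⊗[k] H)) d) = d := by
  have e := pl_pentagon Q.toQuasiBialgebra (onL V (lop (LinearMap.id : H →ₗ[k] H)))
    (onL V (ropS Q)) (onR H D) (onR H σ)
  have e' := IsRep.map_units_inv (pl (onL V (ropS Q)) (pl (onR H D) (onR H σ))) Q.Φ
  have k1 := β_tmul_invariant Q d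
  have k2 : ∀ x, (onR H D ⋆ onR H σ) x (Q.β ⊗ₜ[k] d) =
      triv Q.toQuasiBialgebra (Module.End k (H ⊗[k] V)) x (Q.β ⊗ₜ[k] d) := by
    intro x
    rw [triv_apply_apply, conv_onR, onR_tmul, hd, TensorProduct.tmul_smul]
  have e1 := congrArg (· (Q.β ⊗ₜ[k] d)) e
  simp only [Module.End.mul_apply] at e1
  rw [pl_apply_left (f := onL V (lop (LinearMap.id : H →ₗ[k] H)) ⋆ onL V (ropS Q)) k1, pl_Φ_left,
    Module.End.one_apply, pl_apply_right (fun t => pl_apply_right k2 t), pl_Φ_right,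
    Module.End.one_apply] at e1
  have e2 := congrArg (fun y => contr Q D (pl (onL V (ropS Q)) (pl (onR H D) (onR H σ))
      (↑Q.Φ⁻¹ : H ⊗[k] (H ⊗[k] H)) y)) e1
  rw [← Module.End.mul_apply (pl _ _ (↑Q.Φ⁻¹ : H ⊗[k] (H ⊗[k] H))), e', Module.End.one_apply,
    pl_covector_right (g' := pl (triv Q.toQuasiBialgebra _) (onR H σ)), pl_Φ_mid,
    Module.End.one_apply, ← apply_contrAct] at e2
  · rw [← e2]
    rw [contr_β]
  · intro t v
    exact pl_covector_left (fun x v => by rw [contr_invariant, triv_apply_apply, map_smul]) t v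

/-- Moving $\sigma(x^3)$ onto `U` as $D(S(x^3))$ leaves $S(x^1)\alpha x^2\beta S(x^3)=1$.
Consequently such a `U` is determined by `D Q.β U`; this is the uniqueness principle behind
`twist_cocycle` and `twist_eq_one`. -/
theorem contrAct_apply_β {U : V} (hU : ∀ x, D (Q.S x) U = σ x U) :
    contrAct Q D σ (↑Q.Φ⁻¹ : H ⊗[k] (H ⊗[k] H)) (D Q.β U) = U := by
  have e : ∀ t, contrAct Q D σ t (D Q.β U) =
      D (sandwich₃ Q.S.toLinearMap LinearMap.id Q.S.toLinearMap Q.α Q.β t) U := by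
    intro t
    induction t using TensorProduct.induction_on with
    | zero => simp [contrAct]
    | add s₁ s₂ h₁ h₂ =>
      simp only [map_add, LinearMap.add_apply, ← h₁, ← h₂]
      simp [contrAct]
    | tmul a t =>
      induction t using TensorProduct.induction_on with
      | zero => simp [contrAct]
      | add s₁ s₂ h₁ h₂ =>
        simp only [map_add, LinearMap.add_apply, TensorProduct.tmul_add, ← h₁, ← h₂]
        simp [contrAct]
      | tmul b c =>
        rw [contrAct_tmul, ← Cmm.apply (f := D) (g := σ), ← hU]
        simp [IsRep.map_mul]
  rw [e, Q.antipode_Φ_inv, IsRep.map_one, Module.End.one_apply]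

end Contraction

end Antipode

/-! ### Solved forms of a pentagon in a monoid -/

section Words

variable {M : Type*} [Monoid M] {a b c d e a' b' c' d' e' : M}

/-- This lemma and those after it rearrange a pentagon $abc=de$, each isolating a different pair of
factors. Only the one-sided inverses that are needed are assumed. -/
theorem word_left (h : a * b * c = d * e) (hb : b * b' = 1) (hc : c * c' = 1) (hd : d' * d = 1) :
    d' * a = e * c' * b' := by
  calc d' * a = d' * (a * b * c) * c' * b' := by
        simp only [mul_assoc, reassoc_mul hc, hb, mul_one]
    _ = e * c' * b' := by rw [h, ← mul_assoc, hd, one_mul]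
where
  reassoc_mul {x y : M} (hxy : x * y = 1) {z : M} : x * (y * z) = z := by
    rw [← mul_assoc, hxy, one_mul]

theorem word_mid (h : a * b * c = d * e) (ha : a' * a = 1) (he : e * e' = 1) :
    a' * d = b * c * e' := by
  calc a' * d = a' * (d * e) * e' := by simp only [mul_assoc, he, mul_one]
    _ = b * c * e' := by rw [← h, ← mul_assoc, ← mul_assoc, ha, one_mul]

theorem word_inv (h : a * b * c = d * e) (hd : d * d' = 1) (he : e * e' = 1)
    (ha' : a' * a = 1) (hb' : b' * b = 1) :
    b' * a' = c * e' * d' := by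
  have h1 : b' * a' * (a * b * c) = c := by
    calc _ = b' * (a' * a) * b * c := by simp only [mul_assoc]
      _ = c := by rw [ha', mul_one, hb', one_mul]
  calc b' * a' = b' * a' * (d * e) * (e' * d') := by
        rw [mul_assoc _ (d * e), mul_assoc d e, ← mul_assoc e, he, one_mul, hd, mul_one]
    _ = c * e' * d' := by rw [← h, h1, mul_assoc]

end Words

/-! ### The inverse Drinfeld twist: intertwining, cocycle identity, counit -/

section Twist

variable {k H B : Type*} [Field k] [Ring H] [Algebra k H] [Ring B] [Algebra k B]

section Quasi

variable (Q : QuasiBialgebra k H)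

local infixl:75 " ⋆ " => conv (QuasiBialgebra.comul Q)

variable (f g h i : H →ₗ[k] B) [IsRep f] [IsRep g] [IsRep h] [IsRep i] [Cmm f g] [Cmm f h]
  [Cmm f i] [Cmm g h] [Cmm g i] [Cmm h i]

theorem pl_pentagon_left_form :
    pl f (pl g (h ⋆ i)) (↑Q.Φ⁻¹ : H ⊗[k] (H ⊗[k] H)) * pl g (pl h i) Q.Φ =
    pl (f ⋆ g) (pl h i) Q.Φ * pl f (pl g h) (↑Q.Φ⁻¹ : H ⊗[k] (H ⊗[k] H)) *
      pl f (pl (g ⋆ h) i) (↑Q.Φ⁻¹ : H ⊗[k] (H ⊗[k] H)) :=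
  word_left (pl_pentagon Q f g h i) (IsRep.map_units _ _) (IsRep.map_units _ _)
    (IsRep.map_units_inv _ _)

theorem pl_pentagon_inv :
    pl f (pl (g ⋆ h) i) (↑Q.Φ⁻¹ : H ⊗[k] (H ⊗[k] H)) *
      pl g (pl h i) (↑Q.Φ⁻¹ : H ⊗[k] (H ⊗[k] H)) =
    pl f (pl g h) Q.Φ * pl (f ⋆ g) (pl h i) (↑Q.Φ⁻¹ : H ⊗[k] (H ⊗[k] H)) *
      pl f (pl g (h ⋆ i)) (↑Q.Φ⁻¹ : H ⊗[k] (H ⊗[k] H)) :=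
  word_inv (pl_pentagon Q f g h i) (IsRep.map_units _ _) (IsRep.map_units _ _)
    (IsRep.map_units_inv _ _) (IsRep.map_units_inv _ _)

theorem IsRep.inv_eq_one {X : Type*} [Ring X] [Algebra k X] (F : X →ₗ[k] B) [IsRep F] {u : Xˣ}
    (hu : F (u : X) = 1) : F (↑u⁻¹ : X) = 1 := by
  have e := IsRep.map_units F u
  rwa [hu, one_mul] at e

theorem pl_Φ_inv_right : pl f (pl g (triv Q B)) (↑Q.Φ⁻¹ : H ⊗[k] (H ⊗[k] H)) = 1 :=
  IsRep.inv_eq_one _ (pl_Φ_right Q f g)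

theorem pl_Φ_inv_left : pl (triv Q B) (pl h i) (↑Q.Φ⁻¹ : H ⊗[k] (H ⊗[k] H)) = 1 :=
  IsRep.inv_eq_one _ (pl_Φ_left Q h i)

/-- The element `Φ(f ⋆ g, h, i) Φ⁻¹(f, g, h)`. -/
def bop : B :=
  pl (f ⋆ g) (pl h i) Q.Φ * pl f (pl g h) (↑Q.Φ⁻¹ : H ⊗[k] (H ⊗[k] H))

section Vectors

variable {V : Type*} [AddCommGroup V] [Module k V]

theorem conv_apply_left_of_kill {X Y Z : Type*} [Ring X] [Algebra k X] [Ring Y] [Algebra k Y]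
    [Ring Z] [Algebra k Z] {φ : Z →ₐ[k] X ⊗[k] Y} {f f' : X →ₗ[k] Module.End k V}
    {g : Y →ₗ[k] Module.End k V} {v : V} [Cmm f g] [Cmm f' g] (hf : ∀ x, f x v = f' x v) (z : Z) :
    conv φ f g z v = conv φ f' g z v := pl_apply_left hf _

theorem conv_apply_right_of_kill {X Y Z : Type*} [Ring X] [Algebra k X] [Ring Y] [Algebra k Y]
    [Ring Z] [Algebra k Z] {φ : Z →ₐ[k] X ⊗[k] Y} {f : X →ₗ[k] Module.End k V}
    {g g' : Y →ₗ[k] Module.End k V} {v : V} (hg : ∀ x, g x v = g' x v) (z : Z) :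
    conv φ f g z v = conv φ f g' z v := pl_apply_right hg _

theorem kill_of_cmm {X Y : Type*} [Ring X] [Algebra k X] [Ring Y] [Algebra k Y]
    {F F' : X →ₗ[k] Module.End k V} (G : Y →ₗ[k] Module.End k V) [Cmm F G] [Cmm F' G] {v : V}
    (hF : ∀ x, F x v = F' x v) (y : Y) (x : X) : F x (G y v) = F' x (G y v) := by
  rw [Cmm.apply (f := F) (g := G), hF, Cmm.apply (f := F') (g := G)]

variable (f₁ f₂ f₃ f₄ f₅ f₆ : H →ₗ[k] Module.End k V) [IsRep f₁] [IsRep f₂] [IsRep f₃] [IsRep f₄]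
  [IsRep f₅] [IsRep f₆] [Cmm f₁ f₂] [Cmm f₁ f₃] [Cmm f₁ f₄] [Cmm f₁ f₅] [Cmm f₁ f₆] [Cmm f₂ f₃]
  [Cmm f₂ f₄] [Cmm f₂ f₅] [Cmm f₂ f₆] [Cmm f₃ f₄] [Cmm f₃ f₅] [Cmm f₃ f₆] [Cmm f₄ f₅]
  [Cmm f₄ f₆] [Cmm f₅ f₆]

/-- Carrying the four-fold convolution through the two reassociators brackets it as `(f₁ ⋆ (f₂ ⋆
f₃)) ⋆ f₄`. On `w` the inner pair collapses first, then the outer one. This is the invariance of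
$\delta$ in abstract form. -/
theorem bop_invariant {w : V} (h23 : ∀ x, (f₂ ⋆ f₃) x w = triv Q (Module.End k V) x w)
    (h14 : ∀ x, (f₁ ⋆ f₄) x w = triv Q (Module.End k V) x w) (x : H) :
    ((f₁ ⋆ f₂) ⋆ (f₃ ⋆ f₄)) x (bop Q f₁ f₂ f₃ f₄ w) = Q.counit x • bop Q f₁ f₂ f₃ f₄ w := by
  have e1 := star_assoc Q (f₁ ⋆ f₂) f₃ f₄ x
  have e2 : pl f₁ (pl f₂ f₃) (↑Q.Φ⁻¹ : H ⊗[k] (H ⊗[k] H)) * ((f₁ ⋆ (f₂ ⋆ f₃)) ⋆ f₄) x =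
      (((f₁ ⋆ f₂) ⋆ f₃) ⋆ f₄) x * pl f₁ (pl f₂ f₃) (↑Q.Φ⁻¹ : H ⊗[k] (H ⊗[k] H)) :=
    pl_intertwine (star_assoc_inv Q f₁ f₂ f₃) (fun y => Cmm.comm (f := pl f₁ (pl f₂ f₃)) _ y) _
  rw [bop, ← Module.End.mul_apply, ← mul_assoc, e1, mul_assoc, ← e2, Module.End.mul_apply,
    Module.End.mul_apply, Module.End.mul_apply, conv_apply_left_of_kill (f' := f₁), h14,
    triv_apply_apply, map_smul, map_smul]
  intro y
  rw [conv_apply_right_of_kill h23, star_triv]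

/-- The cocycle identity at the level of $\delta$, for nested pairs of legs (`f₁` with `f₆`, `f₂`
with `f₅`, `f₃` with `f₄`). It is a consequence of the pentagon, and only the innermost pair has to
be trivial on `w`. -/
theorem bop_assoc {w : V} (h34 : ∀ x, (f₃ ⋆ f₄) x w = triv Q (Module.End k V) x w) :
    bop Q f₁ (f₂ ⋆ f₃) (f₄ ⋆ f₅) f₆ (bop Q f₂ f₃ f₄ f₅ w) =
    pl f₁ (pl f₂ f₃) Q.Φ (pl f₄ (pl f₅ f₆) (↑Q.Φ⁻¹ : H ⊗[k] (H ⊗[k] H))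
      (bop Q (f₁ ⋆ f₂) f₃ f₄ (f₅ ⋆ f₆) (bop Q f₁ f₂ f₅ f₆ w))) := by
  have app {a b : Module.End k V} (h : a = b) (v : V) : a v = b v := by rw [h]
  set w' := pl f₁ (pl f₂ f₅) (↑Q.Φ⁻¹ : H ⊗[k] (H ⊗[k] H)) w with hw'
  have h34' : ∀ x, (f₃ ⋆ f₄) x w' = triv Q (Module.End k V) x w' :=
    kill_of_cmm (pl f₁ (pl f₂ f₅)) h34 _
  have e1 := app (pl_pentagon_left_form Q f₁ (f₂ ⋆ f₃) f₄ f₅)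
  have e2 : pl f₂ (pl f₃ f₄) (↑Q.Φ⁻¹ : H ⊗[k] (H ⊗[k] H)) *
        pl f₁ (pl (f₂ ⋆ (f₃ ⋆ f₄)) f₅) (↑Q.Φ⁻¹ : H ⊗[k] (H ⊗[k] H)) =
      pl f₁ (pl ((f₂ ⋆ f₃) ⋆ f₄) f₅) (↑Q.Φ⁻¹ : H ⊗[k] (H ⊗[k] H)) *
        pl f₂ (pl f₃ f₄) (↑Q.Φ⁻¹ : H ⊗[k] (H ⊗[k] H)) :=
    pl_intertwine (fun x => Cmm.comm (f := pl f₂ (pl f₃ f₄)) _ x)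
      (pl_intertwine (star_assoc_inv Q f₂ f₃ f₄)
        (fun y => Cmm.comm (f := pl f₂ (pl f₃ f₄)) _ y)) _
  -- Here, and in `e5` and `e10`, the pair `f₃ ⋆ f₄` acts through the counit, so it disappears from
  -- a longer convolution or trivializes a reassociator.
  have e3 : pl f₁ (pl (f₂ ⋆ (f₃ ⋆ f₄)) f₅) (↑Q.Φ⁻¹ : H ⊗[k] (H ⊗[k] H)) w = w' :=
    pl_apply_right (pl_apply_left fun y => by
      rw [conv_apply_right_of_kill h34, star_triv]) _
  have e4 := app (pl_pentagon_inv Q f₁ f₂ f₃ f₄)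
  have e5 : pl f₁ (pl f₂ (f₃ ⋆ f₄)) (↑Q.Φ⁻¹ : H ⊗[k] (H ⊗[k] H)) w' = w' := by
    rw [pl_apply_right (pl_apply_right h34'), pl_Φ_inv_right, Module.End.one_apply]
  have e6 : pl f₁ (pl f₂ f₃) Q.Φ * pl ((f₁ ⋆ f₂) ⋆ f₃) (pl (f₄ ⋆ f₅) f₆) Q.Φ =
      pl (f₁ ⋆ (f₂ ⋆ f₃)) (pl (f₄ ⋆ f₅) f₆) Q.Φ * pl f₁ (pl f₂ f₃) Q.Φ :=
    pl_intertwine (fun x => (star_assoc Q f₁ f₂ f₃ x).symm)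
      (fun y => Cmm.comm (f := pl f₁ (pl f₂ f₃)) _ y) _
  have e7 : pl f₁ (pl f₂ f₃) Q.Φ * pl ((f₁ ⋆ f₂) ⋆ f₃) (pl f₄ f₅) Q.Φ =
      pl (f₁ ⋆ (f₂ ⋆ f₃)) (pl f₄ f₅) Q.Φ * pl f₁ (pl f₂ f₃) Q.Φ :=
    pl_intertwine (fun x => (star_assoc Q f₁ f₂ f₃ x).symm)
      (fun y => Cmm.comm (f := pl f₁ (pl f₂ f₃)) _ y) _
  have e8 := app (pl_pentagon Q ((f₁ ⋆ f₂) ⋆ f₃) f₄ f₅ f₆)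
  have e9 : pl (f₁ ⋆ f₂) (pl f₃ f₄) (↑Q.Φ⁻¹ : H ⊗[k] (H ⊗[k] H)) *
        pl ((f₁ ⋆ f₂) ⋆ (f₃ ⋆ f₄)) (pl f₅ f₆) Q.Φ =
      pl (((f₁ ⋆ f₂) ⋆ f₃) ⋆ f₄) (pl f₅ f₆) Q.Φ *
        pl (f₁ ⋆ f₂) (pl f₃ f₄) (↑Q.Φ⁻¹ : H ⊗[k] (H ⊗[k] H)) :=
    pl_intertwine (star_assoc_inv Q (f₁ ⋆ f₂) f₃ f₄)
      (fun y => Cmm.comm (f := pl (f₁ ⋆ f₂) (pl f₃ f₄)) _ y) _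
  have e10 : pl ((f₁ ⋆ f₂) ⋆ (f₃ ⋆ f₄)) (pl f₅ f₆) Q.Φ w' = pl (f₁ ⋆ f₂) (pl f₅ f₆) Q.Φ w' :=
    pl_apply_left (fun y => by rw [conv_apply_right_of_kill h34', star_triv]) _
  have e11 := app (IsRep.map_units_inv (pl f₄ (pl f₅ f₆)) Q.Φ)
  have e2 := app e2
  have e6 := app e6
  have e7 := app e7
  have e9 := app e9
  simp only [Module.End.mul_apply, Module.End.one_apply] at e1 e2 e4 e6 e7 e8 e9 e11
  simp only [bop, Module.End.mul_apply]
  rw [e1, ← e2, e3, e4, e5, ← e7, ← e6, ← hw', ← e10, e9, ← e8, e11]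

end Vectors

end Quasi

variable (Q : QuasiHopfAlgebra k H)

local infixl:75 " ⋆ " => conv (QuasiBialgebra.comul (QuasiHopfAlgebra.toQuasiBialgebra Q))

/-- The composition `f ∘ S`. -/
abbrev antip (f : H →ₗ[k] B) : H →ₗ[k] B := f ∘ₗ Q.S.toLinearMap

theorem pl_B (f g h i : H →ₗ[k] B) [IsRep f] [IsRep g] [IsRep h] [IsRep i] [Cmm f g] [Cmm f h]
    [Cmm f i] [Cmm g h] [Cmm g i] [Cmm h i] :
    pl f (pl g (pl h i)) Q.B = bop Q.toQuasiBialgebra f g h i := by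
  rw [QuasiHopfAlgebra.B, IsRep.map_mul, pl_onFirst, pl_padRight, bop]

section TwoLegs

variable (f g : H →ₗ[k] B) [IsRep f] [IsRep g] [Cmm f g]

/-- Left multiplications and right multiplications by antipodes are treated as four commuting
representations, so that $\delta$ becomes a reassociator expression applied to the vector
$\beta\beta$. -/
theorem pl_deltaMap (t : H ⊗[k] (H ⊗[k] (H ⊗[k] H))) : pl f g (Q.deltaMap t) =
    pl (lop f) (pl (lop g) (pl (rop Q g) (rop Q f))) t (f Q.β * g Q.β) := by
  induction t using TensorProduct.induction_on with
  | zero => simp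
  | add s₁ s₂ h₁ h₂ => simp only [map_add, LinearMap.add_apply, h₁, h₂]
  | tmul a t =>
    induction t using TensorProduct.induction_on with
    | zero => simp
    | add s₁ s₂ h₁ h₂ =>
      simp only [map_add, LinearMap.add_apply, TensorProduct.tmul_add, h₁, h₂]
    | tmul b t =>
      induction t using TensorProduct.induction_on with
      | zero => simp
      | add s₁ s₂ h₁ h₂ =>
        simp only [map_add, LinearMap.add_apply, TensorProduct.tmul_add, h₁, h₂]
      | tmul c d =>
        have h : ∀ x y, f x * g y = g y * f x := Cmm.comm
        simp only [Q.deltaMap_tmul, pl_tmul, Module.End.mul_apply, lop_apply, rop_apply,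
          IsRep.map_mul, mul_assoc]
        congr 1
        rw [← mul_assoc (f (Q.S d)), h, ← mul_assoc (f Q.β), ← mul_assoc (f Q.β)]
        simp only [mul_assoc]
        rw [← mul_assoc (f (Q.S d)), h, mul_assoc, ← mul_assoc (f Q.β), h, mul_assoc]

theorem pl_δ : pl f g Q.δ = bop Q.toQuasiBialgebra (lop f) (lop g) (rop Q g) (rop Q f)
    (f Q.β * g Q.β) := by
  rw [QuasiHopfAlgebra.δ, pl_deltaMap, pl_B]

theorem kill_outer : ∀ x, (lop f ⋆ rop Q f) x (f Q.β * g Q.β) =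
    triv Q.toQuasiBialgebra (Module.End k B) x (f Q.β * g Q.β) := by
  intro x
  have := invariant_β_mul Q f 1 (g Q.β) (by simp) (fun x => Cmm.comm _ _) x
  rwa [one_mul, ← triv_apply_apply Q.toQuasiBialgebra] at this

theorem kill_inner : ∀ x, (lop g ⋆ rop Q g) x (f Q.β * g Q.β) =
    triv Q.toQuasiBialgebra (Module.End k B) x (f Q.β * g Q.β) := by
  intro x
  have := invariant_β_mul Q g (f Q.β) 1 (fun x => Cmm.comm _ _) (by simp) x
  rwa [mul_one, ← triv_apply_apply Q.toQuasiBialgebra] at this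

/-- The hypothesis under which the correspondence $U\mapsto\beta U$ produces $f^{-1}$ from $\delta$.
-/
theorem δ_invariant (x : H) : (lop (f ⋆ g) ⋆ (rop Q g ⋆ rop Q f)) x (pl f g Q.δ) =
    Q.counit x • pl f g Q.δ := by
  rw [pl_δ, lop_conv]
  exact bop_invariant _ _ _ _ _ (kill_inner Q f g) (kill_outer Q f g) x

/-- The defining formula of $f^{-1}$ is literally the contraction of $\delta$ with $\Phi^{-1}$, so
the general correspondence applies. -/
theorem pl_twistInvMap (t : H ⊗[k] (H ⊗[k] H)) : pl f g (Q.twistInvMap t) =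
    contrAct Q (lop (f ⋆ g)) (rop Q g ⋆ rop Q f) t (pl f g Q.δ) := by
  induction t using TensorProduct.induction_on with
  | zero => simp [contrAct]
  | add s₁ s₂ h₁ h₂ => simp only [map_add, h₁, h₂]; simp [contrAct]
  | tmul a t =>
    induction t using TensorProduct.induction_on with
    | zero => simp [contrAct]
    | add s₁ s₂ h₁ h₂ =>
      simp only [map_add, TensorProduct.tmul_add, h₁, h₂]; simp [contrAct]
    | tmul b c =>
      rw [contrAct_tmul, Q.twistInvMap_tmul, IsRep.map_mul, IsRep.map_mul, lop_apply, rop_star,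
        ← mul_assoc]
      congr 1
      rw [conv_apply]
      induction Q.comul c using TensorProduct.induction_on with
      | zero => simp
      | add s₁ s₂ h₁ h₂ => simp only [map_add, h₁, h₂]
      | tmul x y => simp [Cmm.comm (f := f) (g := g)]

/-- The relation $\Delta(S(x))f^{-1}=f^{-1}(S\otimes S)(\Delta^{\rm cop}(x))$. The legs are
exchanged on the right because of $\Delta^{\rm cop}$. -/
theorem twist_intertwine (x : H) : (f ⋆ g) (Q.S x) * pl f g Q.twistInv =
    pl f g Q.twistInv * (antip Q g ⋆ antip Q f) x := by
  have := contrAct_intertwine Q (lop (f ⋆ g)) (rop Q g ⋆ rop Q f) (δ_invariant Q f g) x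
  rwa [← pl_twistInvMap, lop_apply, rop_star] at this

/-- The relation $\Delta(\beta)f^{-1}=\delta$, which characterizes $f^{-1}$ together with
`twist_intertwine`. -/
theorem β_mul_twist : (f ⋆ g) Q.β * pl f g Q.twistInv = pl f g Q.δ := by
  have := apply_β_contrAct Q (lop (f ⋆ g)) (rop Q g ⋆ rop Q f) (δ_invariant Q f g)
  rwa [← pl_twistInvMap, lop_apply] at this

end TwoLegs

section ThreeLegs

theorem conv_intertwine_end {X Y Z : Type*} [Ring X] [Algebra k X] [Ring Y] [Algebra k Y] [Ring Z]
    [Algebra k Z] {V V' : Type*} [AddCommGroup V] [Module k V] [AddCommGroup V'] [Module k V']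
    {φ : Z →ₐ[k] X ⊗[k] Y} {J : V →ₗ[k] V'} {f : X →ₗ[k] Module.End k V}
    {f' : X →ₗ[k] Module.End k V'} {g : Y →ₗ[k] Module.End k V} {g' : Y →ₗ[k] Module.End k V'}
    (hf : ∀ x v, J (f x v) = f' x (J v)) (hg : ∀ y v, J (g y v) = g' y (J v)) (z : Z) (v : V) :
    J (conv φ f g z v) = conv φ f' g' z (J v) :=
  pl_intertwine_end hf hg (φ z) v

theorem bop_intertwine {V V' : Type*} [AddCommGroup V] [Module k V] [AddCommGroup V'] [Module k V']
    {J : V →ₗ[k] V'} {f g h i : H →ₗ[k] Module.End k V} {f' g' h' i' : H →ₗ[k] Module.End k V'}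
    (hf : ∀ x v, J (f x v) = f' x (J v)) (hg : ∀ x v, J (g x v) = g' x (J v))
    (hh : ∀ x v, J (h x v) = h' x (J v)) (hi : ∀ x v, J (i x v) = i' x (J v)) (v : V) :
    J (bop Q.toQuasiBialgebra f g h i v) = bop Q.toQuasiBialgebra f' g' h' i' (J v) := by
  rw [bop, bop, Module.End.mul_apply, Module.End.mul_apply,
    pl_intertwine_end (conv_intertwine_end hf hg) (pl_intertwine_end hh hi),
    pl_intertwine_end hf (pl_intertwine_end hg hh)]

variable (f g h : H →ₗ[k] B) [IsRep f] [IsRep g] [IsRep h] [Cmm f g] [Cmm f h] [Cmm g h]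

theorem pl_lop (t : H ⊗[k] (H ⊗[k] H)) (b : B) :
    pl (lop f) (pl (lop g) (lop h)) t b = pl f (pl g h) t * b := by
  have e1 := lop_conv (AlgHom.id k _) f (pl g h)
  have e2 : lop (pl g h) = pl (lop g) (lop h) := lop_conv (AlgHom.id k _) g h
  rw [← e2]
  exact (LinearMap.congr_fun (LinearMap.congr_fun e1 t) b).symm

theorem pl_rop (t : H ⊗[k] (H ⊗[k] H)) (b : B) :
    pl (rop Q h) (pl (rop Q g) (rop Q f)) t b =
      b * pl (antip Q h) (pl (antip Q g) (antip Q f)) t :=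
  pl_mul_right (f := antip Q h) (g := pl (antip Q g) (antip Q f)) (rop_apply Q h)
    (pl_mul_right (f := antip Q g) (g := antip Q f) (rop_apply Q g) (rop_apply Q f)) t b

theorem rop_star_left (x : H) (b : B) : ((rop Q h ⋆ rop Q g) ⋆ rop Q f) x b =
    b * ((antip Q h ⋆ antip Q g) ⋆ antip Q f) x :=
  pl_mul_right (f := antip Q h ⋆ antip Q g) (g := antip Q f) (rop_star Q h g) (rop_apply Q f) _ b

theorem rop_star_right (x : H) (b : B) : (rop Q h ⋆ (rop Q g ⋆ rop Q f)) x b =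
    b * (antip Q h ⋆ (antip Q g ⋆ antip Q f)) x :=
  pl_mul_right (f := antip Q h) (g := antip Q g ⋆ antip Q f) (rop_apply Q h) (rop_star Q g f) _ b

/-- Both sides of the cocycle identity must satisfy one and the same intertwining relation for the
uniqueness principle to apply. This is the relation for the right side; `twist_conj_intertwine`
gives it for the left side. -/
theorem twist_right_intertwine (x : H) :
    lop (f ⋆ (g ⋆ h)) (Q.S x) (pl f (g ⋆ h) Q.twistInv * pl g h Q.twistInv) =
      ((rop Q h ⋆ rop Q g) ⋆ rop Q f) x (pl f (g ⋆ h) Q.twistInv * pl g h Q.twistInv) := by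
  rw [lop_apply, rop_star_left, ← mul_assoc, twist_intertwine, mul_assoc, mul_assoc]
  congr 1
  exact (pl_intertwine (fun y => (twist_intertwine Q g h y).symm)
    (fun y => Cmm.comm (f := pl g h) (g := antip Q f) _ y) _).symm

theorem twist_left_intertwine (x : H) :
    (f ⋆ g ⋆ h) (Q.S x) * (pl (f ⋆ g) h Q.twistInv * pl f g Q.twistInv) =
      (pl (f ⋆ g) h Q.twistInv * pl f g Q.twistInv) *
        (antip Q h ⋆ (antip Q g ⋆ antip Q f)) x := by
  rw [← mul_assoc, twist_intertwine, mul_assoc, mul_assoc]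
  congr 1
  exact (pl_intertwine (fun y => (Cmm.comm (f := pl f g) (g := antip Q h) _ y))
    (fun y => (twist_intertwine Q f g y).symm) _).symm

theorem lop_star_assoc (x : H) (b : B) :
    lop (f ⋆ (g ⋆ h)) x (pl (lop f) (pl (lop g) (lop h)) Q.Φ b) =
      pl (lop f) (pl (lop g) (lop h)) Q.Φ (lop (f ⋆ g ⋆ h) x b) := by
  rw [pl_lop, pl_lop, lop_apply, lop_apply, ← mul_assoc, star_assoc, mul_assoc]

theorem twist_conj_intertwine (x : H) : lop (f ⋆ (g ⋆ h)) (Q.S x)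
      (pl (lop f) (pl (lop g) (lop h)) Q.Φ
        (pl (rop Q h) (pl (rop Q g) (rop Q f)) (↑Q.Φ⁻¹ : H ⊗[k] (H ⊗[k] H))
          (pl (f ⋆ g) h Q.twistInv * pl f g Q.twistInv))) =
    ((rop Q h ⋆ rop Q g) ⋆ rop Q f) x (pl (lop f) (pl (lop g) (lop h)) Q.Φ
        (pl (rop Q h) (pl (rop Q g) (rop Q f)) (↑Q.Φ⁻¹ : H ⊗[k] (H ⊗[k] H))
          (pl (f ⋆ g) h Q.twistInv * pl f g Q.twistInv))) := by
  have e1 := LinearMap.congr_fun (star_assoc_inv Q.toQuasiBialgebra (rop Q h) (rop Q g) (rop Q f) x)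
  simp only [Module.End.mul_apply] at e1
  rw [Cmm.apply (f := (rop Q h ⋆ rop Q g) ⋆ rop Q f) (g := pl (lop f) (pl (lop g) (lop h))),
    ← e1, rop_star_right,
    lop_star_assoc,
    Cmm.apply (f := lop (f ⋆ g ⋆ h)) (g := pl (rop Q h) (pl (rop Q g) (rop Q f))),
    lop_apply, twist_left_intertwine]

/-- The factor $f^{-1}(g,h)$ turns `rop Q (g ⋆ h)` into `rop Q h ⋆ rop Q g` and completes the inner
$\beta$ to a second $\delta$. The outcome is a nested `bop` of the shape required by `bop_assoc`. -/
theorem β_mul_twist_right :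
    lop (f ⋆ (g ⋆ h)) Q.β (pl f (g ⋆ h) Q.twistInv * pl g h Q.twistInv) =
      bop Q.toQuasiBialgebra (lop f) (lop g ⋆ lop h) (rop Q h ⋆ rop Q g) (rop Q f)
        (bop Q.toQuasiBialgebra (lop g) (lop h) (rop Q h) (rop Q g)
          (f Q.β * (g Q.β * h Q.β))) := by
  have e1 := bop_intertwine Q (J := LinearMap.mulLeft k (f Q.β)) (f := lop g) (g := lop h)
    (h := rop Q h) (i := rop Q g) (f' := lop g) (g' := lop h) (h' := rop Q h) (i' := rop Q g)
    (by intro x v; simp [← mul_assoc, Cmm.comm (f := f) (g := g)])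
    (by intro x v; simp [← mul_assoc, Cmm.comm (f := f) (g := h)])
    (by intro x v; simp [mul_assoc]) (by intro x v; simp [mul_assoc]) (g Q.β * h Q.β)
  have e2 := bop_intertwine Q (J := LinearMap.mulRight k (pl g h Q.twistInv)) (f := lop f)
    (g := lop (g ⋆ h)) (h := rop Q (g ⋆ h)) (i := rop Q f) (f' := lop f) (g' := lop (g ⋆ h))
    (h' := rop Q h ⋆ rop Q g) (i' := rop Q f)
    (by intro x v; simp [mul_assoc]) (by intro x v; simp [mul_assoc])
    (by
      intro x v
      rw [rop_star, LinearMap.mulRight_apply, rop_apply, mul_assoc, twist_intertwine,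
        LinearMap.mulRight_apply, mul_assoc])
    (by
      intro x v
      simp only [LinearMap.mulRight_apply, rop_apply, mul_assoc]
      rw [Cmm.comm (f := f) (g := pl g h)]) (f Q.β * (g ⋆ h) Q.β)
  rw [lop_apply, ← mul_assoc, β_mul_twist, pl_δ]
  simp only [LinearMap.mulRight_apply, LinearMap.mulLeft_apply] at e1 e2
  rw [e2, mul_assoc, β_mul_twist, pl_δ, e1, lop_conv]

theorem β_mul_twist_left :
    lop (f ⋆ g ⋆ h) Q.β (pl (f ⋆ g) h Q.twistInv * pl f g Q.twistInv) =
      bop Q.toQuasiBialgebra (lop f ⋆ lop g) (lop h) (rop Q h) (rop Q g ⋆ rop Q f)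
        (bop Q.toQuasiBialgebra (lop f) (lop g) (rop Q g) (rop Q f)
          (f Q.β * (g Q.β * h Q.β))) := by
  have e1 := bop_intertwine Q (J := LinearMap.mulRight k (h Q.β)) (f := lop f) (g := lop g)
    (h := rop Q g) (i := rop Q f) (f' := lop f) (g' := lop g) (h' := rop Q g) (i' := rop Q f)
    (by intro x v; simp [mul_assoc]) (by intro x v; simp [mul_assoc])
    (by intro x v; simp [mul_assoc, Cmm.comm (f := g) (g := h)])
    (by intro x v; simp [mul_assoc, Cmm.comm (f := f) (g := h)]) (f Q.β * g Q.β)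
  have e2 := bop_intertwine Q (J := LinearMap.mulRight k (pl f g Q.twistInv)) (f := lop (f ⋆ g))
    (g := lop h) (h := rop Q h) (i := rop Q (f ⋆ g)) (f' := lop (f ⋆ g)) (g' := lop h)
    (h' := rop Q h) (i' := rop Q g ⋆ rop Q f)
    (by intro x v; simp [mul_assoc]) (by intro x v; simp [mul_assoc])
    (by
      intro x v
      simp only [LinearMap.mulRight_apply, rop_apply, mul_assoc]
      rw [Cmm.comm (f := h) (g := pl f g)])
    (by
      intro x v
      rw [rop_star, LinearMap.mulRight_apply, rop_apply, mul_assoc, twist_intertwine,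
        LinearMap.mulRight_apply, mul_assoc]) ((f ⋆ g) Q.β * h Q.β)
  rw [lop_apply, ← mul_assoc, β_mul_twist, pl_δ]
  simp only [LinearMap.mulRight_apply] at e1 e2
  rw [e2, mul_assoc, Cmm.comm (f := h) (g := pl f g), ← mul_assoc, β_mul_twist, pl_δ, e1,
    lop_conv, mul_assoc]

/-- The cocycle identity for the inverse of the Drinfeld twist. -/
theorem twist_cocycle : pl f (pl g h) Q.Φ * (pl (f ⋆ g) h Q.twistInv * pl f g Q.twistInv) *
      pl (antip Q h) (pl (antip Q g) (antip Q f)) (↑Q.Φ⁻¹ : H ⊗[k] (H ⊗[k] H)) =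
    pl f (g ⋆ h) Q.twistInv * pl g h Q.twistInv := by
  -- Uniqueness: both sides are contractions of their products with $\beta$, and these products are
  -- compared by `bop_assoc`.
  rw [mul_assoc, ← pl_rop, ← pl_lop,
    ← contrAct_apply_β Q _ _ (twist_right_intertwine Q f g h),
    ← contrAct_apply_β Q _ _ (twist_conj_intertwine Q f g h)]
  congr 1
  rw [β_mul_twist_right, lop_star_assoc,
    Cmm.apply (f := lop (f ⋆ g ⋆ h)) (g := pl (rop Q h) (pl (rop Q g) (rop Q f))),
    β_mul_twist_left]
  refine (bop_assoc Q.toQuasiBialgebra _ _ _ _ _ _ ?_).symm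
  intro x
  have := invariant_β_mul Q h (f Q.β * g Q.β) 1
    (fun x => by
      rw [← mul_assoc, Cmm.comm (f := h) (g := f), mul_assoc, Cmm.comm (f := h) (g := g),
        mul_assoc]) (by simp) x
  rwa [mul_one, mul_assoc, ← triv_apply_apply Q.toQuasiBialgebra] at this

end ThreeLegs

section TwistCounit

/-- Apply $\varepsilon$ to $S(x_1)\alpha x_2=\varepsilon(x)\alpha$ and use $\varepsilon(\alpha)=1$.
-/
theorem counit_S (x : H) : Q.counit (Q.S x) = Q.counit x := by
  have h1 : (antip Q (triv Q.toQuasiBialgebra k) ⋆ triv Q.toQuasiBialgebra k) x =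
      Q.counit (Q.S x) := by rw [star_triv]; rfl
  have h2 := congrArg Q.counit (Q.antipode_left x)
  rw [map_smul, Q.counit_α, smul_eq_mul, mul_one] at h2
  rw [← h1, ← h2, conv_apply]
  induction Q.comul x using TensorProduct.induction_on with
  | zero => simp
  | add s₁ s₂ h₁ h₂ => simp only [map_add, h₁, h₂]
  | tmul a b => simp [triv_apply, Q.counit_α]

variable (g : H →ₗ[k] B) [IsRep g]

theorem lop_triv : lop (triv Q.toQuasiBialgebra B) =
    triv Q.toQuasiBialgebra (Module.End k B) := by
  ext x b
  rw [triv_apply_apply, lop_apply, triv_apply, Algebra.smul_def]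

theorem rop_triv : rop Q (triv Q.toQuasiBialgebra B) =
    triv Q.toQuasiBialgebra (Module.End k B) := by
  ext x b
  rw [triv_apply_apply, rop_apply, triv_apply, counit_S, Algebra.smul_def, Algebra.commutes]

/-- `G` and `1` satisfy the same intertwining relation and agree after applying $\beta$, so
uniqueness identifies them. -/
theorem twist_eq_one {D : H →ₗ[k] B} [IsRep D] {G : B}
    (hG : ∀ x, lop D (Q.S x) G = rop Q D x G) (hβ : lop D Q.β G = D Q.β) : G = 1 := by
  rw [← contrAct_apply_β Q (lop D) (rop Q D) hG,
    ← contrAct_apply_β Q (lop D) (rop Q D) (U := 1) (by simp), hβ]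
  simp

theorem pl_triv_twist : pl (triv Q.toQuasiBialgebra B) g Q.twistInv = 1 := by
  refine twist_eq_one Q (D := g) (fun x => ?_) ?_
  · have e := twist_intertwine Q (triv Q.toQuasiBialgebra B) g x
    rwa [triv_star, ← rop_star, rop_triv, star_triv] at e
  · have e := β_mul_twist Q (triv Q.toQuasiBialgebra B) g
    rw [triv_star, pl_δ, lop_triv, rop_triv, bop, pl_Φ_right, pl_Φ_inv_left] at e
    rw [lop_apply, e]
    simp [triv_apply, Q.counit_β]

theorem pl_twist_triv : pl g (triv Q.toQuasiBialgebra B) Q.twistInv = 1 := by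
  refine twist_eq_one Q (D := g) (fun x => ?_) ?_
  · have e := twist_intertwine Q g (triv Q.toQuasiBialgebra B) x
    rwa [star_triv, ← rop_star, rop_triv, triv_star] at e
  · have e := β_mul_twist Q g (triv Q.toQuasiBialgebra B)
    rw [star_triv, pl_δ, lop_triv, rop_triv, bop, pl_Φ_mid, pl_Φ_inv_right] at e
    rw [lop_apply, e]
    simp [triv_apply, Q.counit_β]

end TwistCounit

end Twist

/-! ### The element $p$ and the contraction that undoes it -/

section Recovery

variable {k H A B : Type*} [Field k] [Ring H] [Algebra k H] [Ring A] [Algebra k A] [Ring B]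
  [Algebra k B] (Q : QuasiHopfAlgebra k H)

local infixl:75 " ⋆ " => conv (QuasiBialgebra.comul (QuasiHopfAlgebra.toQuasiBialgebra Q))

theorem S_symm_mul (x y : H) : Q.S.symm (x * y) = Q.S.symm y * Q.S.symm x := by
  apply Q.S.injective
  rw [Q.S_mul]
  simp

theorem S_symm_one : Q.S.symm 1 = 1 := by
  rw [LinearEquiv.symm_apply_eq, Q.S_one]

/-- The operator `z ↦ z S⁻¹(h)` on `H`. -/
def rinv : H →ₗ[k] Module.End k H :=
  (LinearMap.mul k H).flip ∘ₗ Q.S.symm.toLinearMap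

@[simp] theorem rinv_apply (h z : H) : rinv Q h z = z * Q.S.symm h := rfl

instance : IsRep (rinv Q) :=
  ⟨fun x y => LinearMap.ext fun z => by simp [S_symm_mul, mul_assoc],
    LinearMap.ext fun z => by simp [S_symm_one]⟩

instance {X : Type*} [Ring X] [Algebra k X] (f : X →ₗ[k] H) : Cmm (rinv Q) (lop f) :=
  ⟨fun x y => LinearMap.ext fun z => by simp [mul_assoc]⟩

/-- Left multiplication by an element. -/
abbrev lid (k X : Type*) [Field k] [Ring X] [Algebra k X] : X →ₗ[k] Module.End k X :=
  lop (LinearMap.id : X →ₗ[k] X)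

instance (X : Type*) [Ring X] [Algebra k X] : IsRep (lid k X) :=
  ⟨fun x y => LinearMap.ext fun z => by simp [mul_assoc], LinearMap.ext fun z => by simp⟩

/-- The identity for $\beta$ read through $S^{-1}$: the vector $S^{-1}(\beta)$ is invariant under
$z\mapsto x_2zS^{-1}(x_1)$. This is why $S^{-1}(\beta)$ is the starting vector of `pElem`. -/
theorem rinv_kill {V : Type*} [AddCommGroup V] [Module k V] (f g : H →ₗ[k] Module.End k V)
    (j : H →ₗ[k] V) (hf : ∀ x z, f x (j z) = j (z * Q.S.symm x))
    (hg : ∀ x z, g x (j z) = j (x * z)) (x : H) :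
    (f ⋆ g) x (j (Q.S.symm Q.β)) =
      triv Q.toQuasiBialgebra (Module.End k V) x (j (Q.S.symm Q.β)) := by
  rw [triv_apply_apply]
  refine invariant_β Q (j := j ∘ₗ Q.S.symm.toLinearMap) ?_ x
  intro a b c
  simp [hf, hg, S_symm_mul, mul_assoc]

variable (L : LeftComoduleAlgebra Q.toQuasiBialgebra A)

local infixr:75 " ▷ " => conv (LeftComoduleAlgebra.lcoact L)

/-- The element `p = X² S⁻¹(X¹ β) ⊗ X³` of `H ⊗ A`, where `X = Φ_λ`. -/
def pElem : H ⊗[k] A :=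
  pl (onL A (rinv Q)) (pl (onL A (lid k H)) (onR H (lid k A))) L.Φl (Q.S.symm Q.β ⊗ₜ 1)

theorem pElem_kill {W : Type*} [AddCommGroup W] [Module k W] (w : W) (x : H) :
    (onL W (rinv Q) ⋆ onL W (lid k H)) x (Q.S.symm Q.β ⊗ₜ[k] w) =
      triv Q.toQuasiBialgebra (Module.End k (H ⊗[k] W)) x (Q.S.symm Q.β ⊗ₜ[k] w) :=
  rinv_kill Q _ _ ((TensorProduct.mk k H W).flip w) (fun _ _ => rfl) (fun _ _ => rfl) x

/-- `λ(u₀) p (S⁻¹(u₋₁) ⊗ 1) = p (1 ⊗ u)` -/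
theorem pElem_intertwine (u : A) :
    (onL A (rinv Q) ▷ (onL A (lid k H) ▷ onR H (lid k A))) u (pElem Q L) =
      (LinearMap.mulRight k u).lTensor H (pElem Q L) := by
  have e := lco_assoc L (onL A (rinv Q)) (onL A (lid k H)) (onR H (lid k A)) u
  have e2 := pl_intertwine_end (J := (LinearMap.mulRight k u).lTensor H)
    (f := onL A (rinv Q)) (f' := onL A (rinv Q))
    (g := pl (onL A (lid k H)) (onR H (lid k A))) (g' := pl (onL A (lid k H)) (onR H (lid k A)))
    (fun x v => LinearMap.congr_fun (show (LinearMap.mulRight k u).lTensor H ∘ₗ onL A (rinv Q) x =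
      onL A (rinv Q) x ∘ₗ (LinearMap.mulRight k u).lTensor H from
        TensorProduct.ext' fun _ _ => by simp) v)
    (pl_intertwine_end
      (fun x v => LinearMap.congr_fun (show (LinearMap.mulRight k u).lTensor H ∘ₗ
        onL A (lid k H) x = onL A (lid k H) x ∘ₗ (LinearMap.mulRight k u).lTensor H from
          TensorProduct.ext' fun _ _ => by simp) v)
      (fun x v => LinearMap.congr_fun (show (LinearMap.mulRight k u).lTensor H ∘ₗ
        onR H (lid k A) x = onR H (lid k A) x ∘ₗ (LinearMap.mulRight k u).lTensor H from
          TensorProduct.ext' fun _ _ => by simp [mul_assoc]) v))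
    (L.Φl : H ⊗[k] (H ⊗[k] A)) (Q.S.symm Q.β ⊗ₜ 1)
  -- Beyond $\Phi_\lambda$ the two `H`-legs are bracketed together and act trivially on
  -- $S^{-1}(\beta)$, so $u$ survives only as a multiplication in `A`.
  rw [pElem, e2, ← Module.End.mul_apply, e, Module.End.mul_apply,
    conv_apply_left_of_kill (pElem_kill Q _), triv_lco]
  simp

section Rec

variable {V : Type*} [AddCommGroup V] [Module k V] (s : H →ₗ[k] Module.End k V)
  (e : A →ₗ[k] Module.End k V) [IsRep s] [IsRep e] [Cmm s e]

/-- The operator `v ↦ S(x¹) α x² · x³ · v`, where `x = Φ_λ⁻¹`, `H` acts through `s` and `A`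
through `e`. -/
def recov : V →ₗ[k] V :=
  contr Q s ∘ₗ pl (onL V (ropS Q)) (pl (onR H s) (onR H e)) (↑L.Φl⁻¹ : H ⊗[k] (H ⊗[k] A)) ∘ₗ
    TensorProduct.mk k H V 1

theorem recov_apply (v : V) : recov Q L s e v = contr Q s (pl (onL V (ropS Q))
    (pl (onR H s) (onR H e)) (↑L.Φl⁻¹ : H ⊗[k] (H ⊗[k] A)) (1 ⊗ₜ v)) := rfl

theorem apply_recov (h : H) (v : V) : s h (recov Q L s e v) = contr Q s (pl (onL V (ropS Q))
    (pl (onR H s) (onR H e)) (↑L.Φl⁻¹ : H ⊗[k] (H ⊗[k] A)) (h ⊗ₜ v)) := by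
  rw [recov_apply, ← contr_mul_left, pl_onR_eq, pl_mul_left]
  simp

theorem contr_onR (u : A) (t : H ⊗[k] V) : contr Q s (onR H e u t) = e u (contr Q s t) := by
  induction t using TensorProduct.induction_on with
  | zero => simp
  | add s₁ s₂ h₁ h₂ => simp only [map_add, h₁, h₂]
  | tmul z y => simp [Cmm.apply (f := s) (g := e)]

theorem contr_kill (x : H) (t : H ⊗[k] V) :
    contr Q s ((onL V (ropS Q) ⋆ onR H s) x t) =
      contr Q s (triv Q.toQuasiBialgebra (Module.End k (H ⊗[k] V)) x t) := by
  rw [contr_invariant, triv_apply_apply, map_smul]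

/-- The map `h ⊗ a ↦ S(h) · recov((s ▷ e)(a) v)`. -/
def recovHat (v : V) : H ⊗[k] A →ₗ[k] V :=
  contr Q s ∘ₗ pl (onL V (ropS Q)) (pl (onR H s) (onR H e)) (↑L.Φl⁻¹ : H ⊗[k] (H ⊗[k] A)) ∘ₗ
    TensorProduct.map Q.S.toLinearMap ((s ▷ e).flip v)

theorem recovHat_tmul (v : V) (h : H) (a : A) :
    recovHat Q L s e v (h ⊗ₜ a) = s (Q.S h) (recov Q L s e ((s ▷ e) a v)) := by
  rw [apply_recov]; rfl

/-- Carry $u$ through $\Phi_\lambda^{-1}$; the contraction absorbs the two `H`-legs that come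
together. This is the Yetter-Drinfeld compatibility before a module `M` is introduced. -/
theorem apply_recov_eq (u : A) (v : V) :
    e u (recov Q L s e v) = recovHat Q L s e v (L.lcoact u) := by
  have e1 := LinearMap.congr_fun (lco_assoc_inv L (onL V (ropS Q)) (onR H s) (onR H e) u) (1 ⊗ₜ v)
  simp only [Module.End.mul_apply] at e1
  have e2 : ∀ t, pl (onL V (ropS Q)) (onR H (s ▷ e)) t (1 ⊗ₜ v) =
      TensorProduct.map Q.S.toLinearMap ((s ▷ e).flip v) t := by
    intro t
    induction t using TensorProduct.induction_on with
    | zero => simp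
    | add s₁ s₂ h₁ h₂ => simp only [map_add, LinearMap.add_apply, h₁, h₂]
    | tmul z y => simp
  have e3 := pl_covector_left (g := onR H e) (contr_kill Q s) (L.lcoact u)
    (pl (onL V (ropS Q)) (pl (onR H s) (onR H e)) (↑L.Φl⁻¹ : H ⊗[k] (H ⊗[k] A)) (1 ⊗ₜ v))
  rw [← conv_apply, ← conv_apply, triv_lco, ← e1, contr_onR, conv_onR, conv_apply, e2] at e3
  exact e3.symm

/-- Half of the inversion. The pentagon of $\Phi_\lambda$ leaves three factors: the contraction
removes one, invariance of $\beta$ another, and the third gives $X^1\beta S(X^2)\alpha X^3=1$. -/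
theorem recovHat_pElem (v : V) : recovHat Q L s e v (pElem Q L) = v := by
  -- $S$ exchanges right multiplication by $S^{-1}$ with left multiplication and turns
  -- $S^{-1}(\beta)$ into $\beta$.
  have e1 : TensorProduct.map Q.S.toLinearMap ((s ▷ e).flip v) (pElem Q L) =
      pl (onL V (lid k H)) (pl (onL V (ropS Q)) (onR H (s ▷ e))) L.Φl (Q.β ⊗ₜ v) := by
    rw [pElem, pl_intertwine_end (f' := onL V (lid k H))
      (g' := pl (onL V (ropS Q)) (onR H (s ▷ e)))]
    · simp [IsRep.map_one]
    · intro x w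
      induction w using TensorProduct.induction_on with
      | zero => simp
      | add s₁ s₂ h₁ h₂ => simp only [map_add, h₁, h₂]
      | tmul z y => simp [Q.S_mul]
    · refine pl_intertwine_end ?_ ?_
      · intro x w
        induction w using TensorProduct.induction_on with
        | zero => simp
        | add s₁ s₂ h₁ h₂ => simp only [map_add, h₁, h₂]
        | tmul z y => simp [Q.S_mul]
      · intro x w
        induction w using TensorProduct.induction_on with
        | zero => simp
        | add s₁ s₂ h₁ h₂ => simp only [map_add, h₁, h₂]
        | tmul z y => simp [IsRep.map_mul]
  have e2 := LinearMap.congr_fun (word_mid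
    (pl_lpentagon L (onL V (lid k H)) (onL V (ropS Q)) (onR H s) (onR H e))
    (IsRep.map_units_inv _ _) (IsRep.map_units _ _)) (Q.β ⊗ₜ v)
  simp only [Module.End.mul_apply] at e2
  rw [pl_apply_left (β_tmul_invariant Q v), IsRep.inv_eq_one _ (pl_Φl_left L (onR H s) (onR H e)),
    Module.End.one_apply, conv_onR] at e2
  rw [recovHat, LinearMap.comp_apply, LinearMap.comp_apply, e1, e2,
    pl_covector_right (g' := pl (triv Q.toQuasiBialgebra _) (onR H e)), pl_Φl_mid,
    Module.End.one_apply, contr_β]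
  exact pl_covector_left (contr_kill Q s)

theorem recov_natural {V' : Type*} [AddCommGroup V'] [Module k V'] (s' : H →ₗ[k] Module.End k V')
    (e' : A →ₗ[k] Module.End k V') [IsRep s'] [IsRep e'] [Cmm s' e'] {χ : V →ₗ[k] V'} (hs : ∀ h v, χ (s h v) = s' h (χ v))
    (he : ∀ u v, χ (e u v) = e' u (χ v)) (v : V) :
    recov Q L s' e' (χ v) = χ (recov Q L s e v) := by
  have hc : ∀ t, contr Q s' (χ.lTensor H t) = χ (contr Q s t) := by
    intro t
    induction t using TensorProduct.induction_on with
    | zero => simp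
    | add s₁ s₂ h₁ h₂ => simp only [map_add, h₁, h₂]
    | tmul z y => simp [hs]
  rw [recov_apply, recov_apply, ← hc, pl_intertwine_end (J := χ.lTensor H)
    (f' := onL V' (ropS Q)) (g' := pl (onR H s') (onR H e'))]
  · rfl
  · intro x w
    induction w using TensorProduct.induction_on with
    | zero => simp
    | add s₁ s₂ h₁ h₂ => simp only [map_add, h₁, h₂]
    | tmul z y => rfl
  · refine pl_intertwine_end ?_ ?_
    · intro x w
      induction w using TensorProduct.induction_on with
      | zero => simp
      | add s₁ s₂ h₁ h₂ => simp only [map_add, h₁, h₂]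
      | tmul z y => simp [hs]
    · intro x w
      induction w using TensorProduct.induction_on with
      | zero => simp
      | add s₁ s₂ h₁ h₂ => simp only [map_add, h₁, h₂]
      | tmul z y => simp [he]

/-- The other half of the inversion. By naturality it is enough to treat $H\otimes A$ itself, where
the pentagon of $\Phi_\lambda$ reduces the claim to $S(x^1)\alpha x^2\beta S(x^3)=1$. -/
theorem recov_eq {χ : H ⊗[k] A →ₗ[k] V} (hs : ∀ h t, χ (onL A (rinv Q) h t) = s h (χ t))
    (he : ∀ u t, χ ((onL A (lid k H) ▷ onR H (lid k A)) u t) = e u (χ t)) :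
    recov Q L s e (χ (pElem Q L)) = χ 1 := by
  rw [recov_natural Q L (onL A (rinv Q)) (onL A (lid k H) ▷ onR H (lid k A)) s e hs he]
  congr 1
  have e2 := LinearMap.congr_fun (word_left
    (pl_lpentagon L (onL (H ⊗[k] A) (ropS Q)) (onR H (onL A (rinv Q)))
      (onR H (onL A (lid k H))) (onR H (onR H (lid k A))))
    (IsRep.map_units _ _) (IsRep.map_units _ _) (IsRep.map_units_inv _ _))
    (1 ⊗ₜ (Q.S.symm Q.β ⊗ₜ 1))
  simp only [Module.End.mul_apply] at e2
  rw [recov_apply, pElem, ← pl_onR, ← pl_onR_eq, ← conv_onR, e2,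
    pl_covector_left (contr_kill Q _), pl_Φl_left, Module.End.one_apply]
  rw [pl_apply_right (g' := pl (triv Q.toQuasiBialgebra _) (onR H (onR H (lid k A)))),
    IsRep.inv_eq_one _ (pl_Φl_mid L _ _), Module.End.one_apply]
  -- What is left is the $S^{-1}$-image of the antipode identity for $\Phi^{-1}$.
  · have e3 : ∀ t, contrAct Q (onL A (rinv Q)) (onL A (lid k H)) t (Q.S.symm Q.β ⊗ₜ[k] (1 : A)) =
        Q.S.symm (sandwich₃ Q.S.toLinearMap LinearMap.id Q.S.toLinearMap Q.α Q.β t) ⊗ₜ 1 := by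
      intro t
      induction t using TensorProduct.induction_on with
      | zero => simp [contrAct]
      | add s₁ s₂ h₁ h₂ =>
        simp only [map_add, TensorProduct.add_tmul, ← h₁, ← h₂]
        simp [contrAct]
      | tmul a t =>
        induction t using TensorProduct.induction_on with
        | zero => simp [contrAct]
        | add s₁ s₂ h₁ h₂ =>
          simp only [map_add, TensorProduct.tmul_add, TensorProduct.add_tmul, ← h₁, ← h₂]
          simp [contrAct]
        | tmul b c => simp [contrAct_tmul, S_symm_mul, mul_assoc]
    have e4 := e3 (↑Q.Φ⁻¹ : H ⊗[k] (H ⊗[k] H))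
    rw [Q.antipode_Φ_inv, S_symm_one] at e4
    exact e4
  · refine pl_apply_left fun x => ?_
    rw [conv_onR, onR_tmul, pElem_kill, triv_apply_apply, triv_apply_apply,
      TensorProduct.tmul_smul]

end Rec

end Recovery

/-! ### The coproduct of $p$ compared with the iterated $p$ -/

section Key

variable {k H A : Type*} [Field k] [Ring H] [Algebra k H] [Ring A] [Algebra k A]
  (Q : QuasiHopfAlgebra k H)

local infixl:75 " ⋆ " => conv (QuasiBialgebra.comul (QuasiHopfAlgebra.toQuasiBialgebra Q))

section General

variable {V : Type*} [AddCommGroup V] [Module k V]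

/-- On a vector where the antipode of one leg agrees with the action of another, the factors
$S(b^3)$, $S(b^4)$ of $\delta$ can be traded for two further representations. -/
theorem pl_deltaMap_apply (f₁ f₂ f₃ f₄ : H →ₗ[k] Module.End k V) [IsRep f₁] [IsRep f₂]
    [Cmm f₁ f₂] [Cmm f₁ f₃] [Cmm f₁ f₄] [Cmm f₂ f₃] [Cmm f₂ f₄] [Cmm f₃ f₄] {v : V}
    (h₁ : ∀ x, f₁ (Q.S x) v = f₄ x v) (h₂ : ∀ x, f₂ (Q.S x) v = f₃ x v)
    (t : H ⊗[k] (H ⊗[k] (H ⊗[k] H))) :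
    pl f₁ f₂ (Q.deltaMap t) v = pl f₁ (pl f₂ (pl f₃ f₄)) t (f₁ Q.β (f₂ Q.β v)) := by
  induction t using TensorProduct.induction_on with
  | zero => simp
  | add s₁ s₂ h₁ h₂ => simp only [map_add, LinearMap.add_apply, h₁, h₂]
  | tmul a t =>
    induction t using TensorProduct.induction_on with
    | zero => simp
    | add s₁ s₂ h₁ h₂ =>
      simp only [map_add, LinearMap.add_apply, TensorProduct.tmul_add, h₁, h₂]
    | tmul b t =>
      induction t using TensorProduct.induction_on with
      | zero => simp
      | add s₁ s₂ h₁ h₂ =>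
        simp only [map_add, LinearMap.add_apply, TensorProduct.tmul_add, h₁, h₂]
      | tmul c d =>
        simp only [Q.deltaMap_tmul, pl_tmul, Module.End.mul_apply, IsRep.map_mul, h₂]
        rw [Cmm.apply (f := f₁) (g := f₂) (Q.S d), Cmm.apply (f := f₁) (g := f₂) (Q.S d),
          Cmm.apply (f := f₁) (g := f₃) (Q.S d), h₁, Cmm.apply (f := f₁) (g := f₂) Q.β,
          Cmm.apply (f := f₁) (g := f₂) Q.β, Cmm.apply (f := f₁) (g := f₃) Q.β,
          Cmm.apply (f := f₁) (g := f₄) Q.β,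
          Cmm.apply (f := f₂) (g := f₃) Q.β, Cmm.apply (f := f₂) (g := f₄) Q.β,
          Cmm.apply (f := f₁) (g := f₂) Q.β Q.β]

variable (L : LeftComoduleAlgebra Q.toQuasiBialgebra A)

local infixr:75 " ▷ " => conv (LeftComoduleAlgebra.lcoact L)

/-- Nested contractions of `Φ_λ`: the operator identity behind the comparison of the two iterated
coactions. -/
theorem lpentagon_bop (f₁ f₂ f₃ f₄ : H →ₗ[k] Module.End k V) (a : A →ₗ[k] Module.End k V)
    [IsRep f₁] [IsRep f₂] [IsRep f₃] [IsRep f₄] [IsRep a]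
    [Cmm f₁ f₂] [Cmm f₁ f₃] [Cmm f₁ f₄] [Cmm f₂ f₃] [Cmm f₂ f₄] [Cmm f₃ f₄]
    [Cmm f₁ a] [Cmm f₂ a] [Cmm f₃ a] [Cmm f₄ a] {w : V}
    (h23 : ∀ x, (f₂ ⋆ f₃) x w = triv Q.toQuasiBialgebra (Module.End k V) x w) :
    pl f₁ (pl f₂ ((f₃ ⋆ f₄) ▷ a)) L.Φl (pl (f₁ ⋆ f₂) (pl (f₃ ⋆ f₄) a) L.Φl
      (bop Q.toQuasiBialgebra f₁ f₂ f₃ f₄ w)) =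
    pl f₃ (pl f₄ a) (↑L.Φl⁻¹ : H ⊗[k] (H ⊗[k] A)) (pl f₂ (pl f₃ (f₄ ▷ a)) L.Φl
      (pl f₁ (pl f₄ a) L.Φl w)) := by
  have app {a b : Module.End k V} (h : a = b) (v : V) : a v = b v := by rw [h]
  have e1 := app (pl_lpentagon L f₁ f₂ (f₃ ⋆ f₄) a)
  have e2 := app (pl_pentagon Q.toQuasiBialgebra f₁ f₂ f₃ f₄)
  have e3 := app (IsRep.map_units (pl f₁ (pl f₂ f₃)) Q.Φ)
  -- The pair `f₂ ⋆ f₃` acts through the counit on `w`; the same collapse is used in `e6` and `e9`.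
  have e4 : pl f₁ (pl (f₂ ⋆ f₃) f₄) (Q.Φ : H ⊗[k] (H ⊗[k] H)) w = w := by
    rw [pl_apply_right (pl_apply_left h23), pl_Φ_mid, Module.End.one_apply]
  have e5 : pl f₂ (pl f₃ f₄) Q.Φ * pl f₁ (pl ((f₂ ⋆ f₃) ⋆ f₄) a) L.Φl =
      pl f₁ (pl (f₂ ⋆ (f₃ ⋆ f₄)) a) L.Φl * pl f₂ (pl f₃ f₄) Q.Φ :=
    pl_intertwine (fun x => Cmm.comm (f := pl f₂ (pl f₃ f₄)) _ x)
      (pl_intertwine (fun x => (star_assoc Q.toQuasiBialgebra f₂ f₃ f₄ x).symm)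
        (fun y => Cmm.comm (f := pl f₂ (pl f₃ f₄)) _ y)) _
  have e5 := app e5
  have e6 : pl f₁ (pl ((f₂ ⋆ f₃) ⋆ f₄) a) (L.Φl : H ⊗[k] (H ⊗[k] A)) w =
      pl f₁ (pl f₄ a) L.Φl w :=
    pl_apply_right (pl_apply_left fun y => by
      rw [conv_apply_left_of_kill h23, triv_star]) _
  have e7 := app (pl_lpentagon L f₂ f₃ f₄ a)
  have e8 := app (IsRep.map_units_inv (pl f₃ (pl f₄ a)) L.Φl)
  have e9 : pl (f₂ ⋆ f₃) (pl f₄ a) (L.Φl : H ⊗[k] (H ⊗[k] A)) (pl f₁ (pl f₄ a) L.Φl w) =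
      pl f₁ (pl f₄ a) L.Φl w := by
    rw [pl_apply_left (kill_of_cmm (pl f₁ (pl f₄ a)) h23 _)]
    rw [pl_Φl_left, Module.End.one_apply]
  simp only [Module.End.mul_apply, Module.End.one_apply] at e1 e2 e3 e5 e7 e8
  rw [bop, Module.End.mul_apply, ← e1, ← e2, e3, e4, ← e5, e6]
  conv_rhs => rw [← e9, ← e7, e8]

end General

section Iterated

variable (L : LeftComoduleAlgebra Q.toQuasiBialgebra A)

local infixr:75 " ▷ " => conv (LeftComoduleAlgebra.lcoact L)

theorem pl_onL_onR_lid {X Y : Type*} [Ring X] [Algebra k X] [Ring Y] [Algebra k Y] :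
    pl (onL Y (lid k X)) (onR X (lid k Y)) = lid k (X ⊗[k] Y) := by
  ext x y x' y'
  simp

theorem onL_lid_apply {X Y : Type*} [Ring X] [Algebra k X] [Ring Y] [Algebra k Y] (x : X)
    (v : X ⊗[k] Y) : onL Y (lid k X) x v = (x ⊗ₜ 1) * v := by
  induction v using TensorProduct.induction_on with
  | zero => simp
  | add s₁ s₂ h₁ h₂ => simp only [map_add, mul_add, h₁, h₂]
  | tmul z y => simp

theorem onR_lid_apply {X Y : Type*} [Ring X] [Algebra k X] [Ring Y] [Algebra k Y] (y : Y)
    (v : X ⊗[k] Y) : onR X (lid k Y) y v = (1 ⊗ₜ y) * v := by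
  induction v using TensorProduct.induction_on with
  | zero => simp
  | add s₁ s₂ h₁ h₂ => simp only [map_add, mul_add, h₁, h₂]
  | tmul z y => simp

theorem onL_rinv_apply {Y : Type*} [Ring Y] [Algebra k Y] (x : H) (v : H ⊗[k] Y) :
    onL Y (rinv Q) x v = v * (Q.S.symm x ⊗ₜ 1) := by
  induction v using TensorProduct.induction_on with
  | zero => simp
  | add s₁ s₂ h₁ h₂ => simp only [map_add, add_mul, h₁, h₂]
  | tmul z y => simp

theorem pl_antip_rinv (t : H ⊗[k] H) (v : H ⊗[k] (H ⊗[k] A)) :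
    pl (antip Q (onL (H ⊗[k] A) (rinv Q))) (antip Q (onR H (onL A (rinv Q)))) t v =
      v * aassoc k H H A (t ⊗ₜ 1) := by
  induction t using TensorProduct.induction_on with
  | zero => simp
  | add s₁ s₂ h₁ h₂ =>
    simp only [map_add, LinearMap.add_apply, TensorProduct.add_tmul, mul_add, h₁, h₂]
  | tmul x y =>
    induction v using TensorProduct.induction_on with
    | zero => simp
    | add s₁ s₂ h₁ h₂ => simp only [map_add, add_mul, h₁, h₂]
    | tmul z v =>
      induction v using TensorProduct.induction_on with
      | zero => simp
      | add s₁ s₂ h₁ h₂ => simp only [map_add, TensorProduct.tmul_add, add_mul, h₁, h₂]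
      | tmul y c => simp

theorem pl_lid_lid (t : H ⊗[k] H) (v : H ⊗[k] (H ⊗[k] A)) :
    pl (onL (H ⊗[k] A) (lid k H)) (onR H (onL A (lid k H))) t v =
      aassoc k H H A (t ⊗ₜ 1) * v := by
  induction t using TensorProduct.induction_on with
  | zero => simp
  | add s₁ s₂ h₁ h₂ =>
    simp only [map_add, LinearMap.add_apply, TensorProduct.add_tmul, add_mul, h₁, h₂]
  | tmul x y =>
    induction v using TensorProduct.induction_on with
    | zero => simp
    | add s₁ s₂ h₁ h₂ => simp only [map_add, mul_add, h₁, h₂]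
    | tmul z v =>
      induction v using TensorProduct.induction_on with
      | zero => simp
      | add s₁ s₂ h₁ h₂ => simp only [map_add, TensorProduct.tmul_add, mul_add, h₁, h₂]
      | tmul y c => simp

theorem onFirst_tmul_one {X Y Z W : Type*} [Ring X] [Algebra k X] [Ring Y] [Algebra k Y] [Ring Z]
    [Algebra k Z] [Ring W] [Algebra k W] (φ : Z →ₐ[k] X ⊗[k] Y) (z : Z) :
    onFirst φ W (z ⊗ₜ 1) = aassoc k X Y W (φ z ⊗ₜ 1) := by
  simp [onFirst]

theorem onFirst_one_tmul {X Y Z W : Type*} [Ring X] [Algebra k X] [Ring Y] [Algebra k Y] [Ring Z]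
    [Algebra k Z] [Ring W] [Algebra k W] (φ : Z →ₐ[k] X ⊗[k] Y) (w : W) :
    onFirst φ W (1 ⊗ₜ w) = 1 ⊗ₜ (1 ⊗ₜ w) := by
  simp [onFirst, Algebra.TensorProduct.one_def]

/-- The element `p¹ ⊗ λ(p²) p` of `H ⊗ H ⊗ A`. -/
def pElem₂ : H ⊗[k] (H ⊗[k] A) :=
  pl (onL (H ⊗[k] A) (rinv Q)) (pl (onL (H ⊗[k] A) (lid k H))
    (onR H (onL A (lid k H)) ▷ onR H (onR H (lid k A)))) L.Φl (Q.S.symm Q.β ⊗ₜ pElem Q L)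

theorem pl_pElem : pl (onR H (onL A (rinv Q))) (pl (onR H (onL A (lid k H)))
    (onR H (onR H (lid k A)))) L.Φl (Q.S.symm Q.β ⊗ₜ (Q.S.symm Q.β ⊗ₜ 1)) =
    Q.S.symm Q.β ⊗ₜ[k] pElem Q L := by
  rw [pl_onR_eq (onL A (lid k H)) (onR H (lid k A)), pl_onR_eq, onR_tmul, pElem]

/-- Applying $\Delta$ to the first leg of $p$ creates $\Delta(S^{-1}(X^1\beta))$. The inverse twist
moves past it and splits it into two legs, with $\delta$ appearing from $\beta$. The nested
reassociators are then exactly those of `lpentagon_bop`. -/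
theorem pElem_comul : pl (onR H (onL A (rinv Q))) (pl (onL (H ⊗[k] A) (rinv Q))
      ((onL (H ⊗[k] A) (lid k H) ⋆ onR H (onL A (lid k H))) ▷ onR H (onR H (lid k A)))) L.Φl
      (pl (onR H (onL A (rinv Q))) (onL (H ⊗[k] A) (rinv Q)) Q.twistInv
        (onFirst Q.comul A (pElem Q L))) =
    pl (onL (H ⊗[k] A) (lid k H)) (pl (onR H (onL A (lid k H))) (onR H (onR H (lid k A))))
      (↑L.Φl⁻¹ : H ⊗[k] (H ⊗[k] A)) (pElem₂ Q L) := by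
  set f₁ := onR H (onL A (rinv Q)) with hf₁
  set f₂ := onL (H ⊗[k] A) (rinv Q)
  set f₃ := onL (H ⊗[k] A) (lid k H)
  set f₄ := onR H (onL A (lid k H))
  set a := onR H (onR H (lid k A))
  have app {a b : Module.End k (H ⊗[k] (H ⊗[k] A))} (h : a = b) (v) : a v = b v := by rw [h]
  -- `twist_intertwine` at $S^{-1}(x)$. The leg `f₁` acts on the second factor of $H\otimes H\otimes
  -- A$, which accounts for the flip in $\Delta^{\rm cop}$.
  have comm : ∀ x v, pl f₁ f₂ Q.twistInv ((antip Q f₂ ⋆ antip Q f₁) (Q.S.symm x) v) =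
      (f₁ ⋆ f₂) x (pl f₁ f₂ Q.twistInv v) := fun x v => by
    have e := app (twist_intertwine Q f₁ f₂ (Q.S.symm x)) v
    rw [LinearEquiv.apply_symm_apply] at e
    exact e.symm
  have hR : ∀ x v, (onFirst Q.comul A).toLinearMap (onL A (rinv Q) x v) =
      (antip Q f₂ ⋆ antip Q f₁) (Q.S.symm x) ((onFirst Q.comul A).toLinearMap v) := by
    intro x v
    rw [onL_rinv_apply, conv_apply, pl_antip_rinv, ← onFirst_tmul_one]
    exact map_mul (onFirst Q.comul A) _ _
  have h34 : ∀ x v, (onFirst Q.comul A).toLinearMap (onL A (lid k H) x v) =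
      (f₃ ⋆ f₄) x ((onFirst Q.comul A).toLinearMap v) := by
    intro x v
    rw [onL_lid_apply, conv_apply, pl_lid_lid, ← onFirst_tmul_one]
    exact map_mul (onFirst Q.comul A) _ _
  have ha : ∀ x v, (onFirst Q.comul A).toLinearMap (onR H (lid k A) x v) =
      a x ((onFirst Q.comul A).toLinearMap v) := by
    intro x v
    have e := pl_onR_eq (H := H) (onL A (lid k H)) (onR H (lid k A))
    rw [pl_onL_onR_lid] at e
    have e' : a x = onR H (lid k (H ⊗[k] A)) (1 ⊗ₜ x) := by
      rw [← e, pl_one_tmul]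
    rw [e', onR_lid_apply, onR_lid_apply, ← onFirst_one_tmul Q.comul]
    exact map_mul (onFirst Q.comul A) _ _
  have e1 : onFirst Q.comul A (pElem Q L) = pl ((antip Q f₂ ⋆ antip Q f₁) ∘ₗ Q.S.symm.toLinearMap)
      (pl (f₃ ⋆ f₄) a) L.Φl ((antip Q f₂ ⋆ antip Q f₁) (Q.S.symm Q.β) 1) := by
    have e := hR Q.β 1
    have e' := pl_intertwine_end (J := (onFirst Q.comul A).toLinearMap) (f := onL A (rinv Q))
      (f' := (antip Q f₂ ⋆ antip Q f₁) ∘ₗ Q.S.symm.toLinearMap) hR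
      (pl_intertwine_end h34 ha) L.Φl (Q.S.symm Q.β ⊗ₜ 1)
    rw [pElem]
    refine e'.trans ?_
    congr 1
    rw [show (Q.S.symm Q.β ⊗ₜ[k] (1:A)) = onL A (rinv Q) Q.β 1 by
      simp [Algebra.TensorProduct.one_def], e]
    simp
  -- On the vector `1`, right multiplication by $S^{-1}(S(x))$ is left multiplication by $x$, so
  -- `pl_deltaMap_apply` applies.
  have e2 : pl f₁ f₂ Q.δ 1 = bop Q.toQuasiBialgebra f₁ f₂ f₃ f₄
      (Q.S.symm Q.β ⊗ₜ (Q.S.symm Q.β ⊗ₜ 1)) := by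
    rw [QuasiHopfAlgebra.δ, pl_deltaMap_apply Q f₁ f₂ f₃ f₄, pl_B]
    · simp [f₁, f₂, Algebra.TensorProduct.one_def]
    · intro x; simp [f₁, f₄, Algebra.TensorProduct.one_def]
    · intro x; simp [f₂, f₃, Algebra.TensorProduct.one_def]
  rw [e1, pl_intertwine_end (f' := f₁ ⋆ f₂) (g' := pl (f₃ ⋆ f₄) a) comm
    (fun y v => Cmm.apply (f := pl f₁ f₂) (g := pl (f₃ ⋆ f₄) a) _ _ _), comm,
    ← Module.End.mul_apply ((f₁ ⋆ f₂) Q.β), β_mul_twist, e2, lpentagon_bop Q L, pl_pElem]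
  · rfl
  · exact pElem_kill Q _

variable {V : Type*} [AddCommGroup V] [Module k V]

/-- Two applications of `recov_eq`: the inner recovery turns `pElem₂` into
$(\mathrm{id}\otimes\lambda)(p)$, and the outer one turns that into `1`. -/
theorem recov_recov {s₁ s₂ : H →ₗ[k] Module.End k V}
    {e : A →ₗ[k] Module.End k V} [IsRep s₁] [IsRep s₂] [IsRep e] [Cmm s₁ s₂] [Cmm s₁ e] [Cmm s₂ e]
    {χ : H ⊗[k] (H ⊗[k] A) →ₗ[k] V}
    (h₁ : ∀ h t, χ (onL (H ⊗[k] A) (rinv Q) h t) = s₁ h (χ t))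
    (h₂ : ∀ h t, χ (onR H (onL A (rinv Q)) h t) = s₂ h (χ t))
    (he : ∀ u t, χ ((onL (H ⊗[k] A) (lid k H) ▷ (onR H (onL A (lid k H)) ▷
      onR H (onR H (lid k A)))) u t) = e u (χ t)) :
    recov Q L s₁ e (recov Q L s₂ (s₁ ▷ e) (χ (pElem₂ Q L))) = χ 1 := by
  set f₂ := onL (H ⊗[k] A) (rinv Q)
  set f₃ := onL (H ⊗[k] A) (lid k H)
  set f₄ := onR H (onL A (lid k H))
  set a := onR H (onR H (lid k A))
  have app {a b : Module.End k (H ⊗[k] (H ⊗[k] A))} (h : a = b) (v) : a v = b v := by rw [h]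
  have E1 := recov_eq Q L (s := s₂) (e := s₁ ▷ e) (χ := χ ∘ₗ pl f₂ (pl f₃ (f₄ ▷ a)) L.Φl ∘ₗ
    TensorProduct.mk k H _ (Q.S.symm Q.β)) (by
      intro h t
      simp only [LinearMap.comp_apply, TensorProduct.mk_apply]
      rw [← h₂, Cmm.apply (f := onR H (onL A (rinv Q))) (g := pl f₂ (pl f₃ (f₄ ▷ a)))]
      simp) (by
      intro u t
      simp only [LinearMap.comp_apply, TensorProduct.mk_apply]
      rw [← onR_tmul, ← conv_onR]
      have e1 := app (lco_assoc L f₂ f₃ (f₄ ▷ a) u) (Q.S.symm Q.β ⊗ₜ t)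
      simp only [Module.End.mul_apply] at e1
      rw [conv_apply_left_of_kill (pElem_kill Q t), triv_lco] at e1
      rw [← e1]
      exact conv_intertwine_end h₁ he _ _)
  have hJa : ∀ x v, L.lcoact.toLinearMap.lTensor H (onR H (lid k A) x v) =
      (f₄ ▷ a) x (L.lcoact.toLinearMap.lTensor H v) := by
    intro x v
    rw [conv_onR, conv, pl_onL_onR_lid]
    refine LinearMap.congr_fun (show L.lcoact.toLinearMap.lTensor H ∘ₗ onR H (lid k A) x =
      onR H (lid k (H ⊗[k] A) ∘ₗ L.lcoact.toLinearMap) x ∘ₗ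
      L.lcoact.toLinearMap.lTensor H from TensorProduct.ext' fun _ _ => ?_) v
    simp
  have E2 := recov_eq Q L (s := s₁) (e := e) (χ := χ ∘ₗ (L.lcoact.toLinearMap.lTensor H)) (by
      intro h t
      simp only [LinearMap.comp_apply]
      rw [← h₁]
      congr 1
      induction t using TensorProduct.induction_on with
      | zero => simp
      | add s₁ s₂ h₁ h₂ => simp only [map_add, h₁, h₂]
      | tmul z y => simp [f₂]) (by
      intro u t
      simp only [LinearMap.comp_apply]
      rw [← he]
      refine congrArg χ (conv_intertwine_end (f := onL A (lid k H)) (f' := f₃) (fun x v => LinearMap.congr_fun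
        (show L.lcoact.toLinearMap.lTensor H ∘ₗ onL A (lid k H) x = f₃ x ∘ₗ
          L.lcoact.toLinearMap.lTensor H from TensorProduct.ext' fun _ _ => rfl) v) hJa u t))
  have E3 : L.lcoact.toLinearMap.lTensor H (pElem Q L) = pl f₂ (pl f₃ (f₄ ▷ a)) L.Φl
      (Q.S.symm Q.β ⊗ₜ 1) := by
    have e := pl_intertwine_end (J := L.lcoact.toLinearMap.lTensor H) (f := onL A (rinv Q))
      (f' := f₂) (fun x v => LinearMap.congr_fun
        (show L.lcoact.toLinearMap.lTensor H ∘ₗ onL A (rinv Q) x = f₂ x ∘ₗ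
          L.lcoact.toLinearMap.lTensor H from TensorProduct.ext' fun _ _ => rfl) v)
      (pl_intertwine_end (f' := f₃) (fun x v => LinearMap.congr_fun
        (show L.lcoact.toLinearMap.lTensor H ∘ₗ onL A (lid k H) x = f₃ x ∘ₗ
          L.lcoact.toLinearMap.lTensor H from TensorProduct.ext' fun _ _ => rfl) v) hJa) L.Φl
      (Q.S.symm Q.β ⊗ₜ 1)
    refine e.trans ?_
    simp
  have E4 : (L.lcoact.toLinearMap.lTensor H) 1 = 1 := by
    simp [Algebra.TensorProduct.one_def]
  simp only [LinearMap.comp_apply, TensorProduct.mk_apply] at E1 E2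
  rw [E4, E3] at E2
  rw [← E2, ← E1]
  rfl

end Iterated

end Key

/-! ### $\Phi_{\lambda,\rho}$ against $\Phi_\lambda$ on an invariant vector -/

section Bico

variable {k H A : Type*} [Field k] [Ring H] [Algebra k H] [Ring A] [Algebra k A]
  {Q : QuasiBialgebra k H} (R : BicomoduleAlgebra Q A) {V : Type*} [AddCommGroup V]
  [Module k V]

local infixl:75 " ⋆ " => conv (QuasiBialgebra.comul Q)
local infixr:75 " ▷ " => conv (LeftComoduleAlgebra.lcoact (BicomoduleAlgebra.toLeftComoduleAlgebra R))
local infixl:75 " ◁ " => conv (RightComoduleAlgebra.rcoact (BicomoduleAlgebra.toRightComoduleAlgebra R))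

/-- The mixed pentagon with its last factor trivial. It trades the inner $\Phi_{\lambda,\rho}^{-1}$
for an outer $\Phi_{\lambda,\rho}$, which can later be cancelled. -/
theorem pl_Φlr_inv_of_kill (f g h : H →ₗ[k] Module.End k V) (a : A →ₗ[k] Module.End k V)
    [IsRep f] [IsRep g] [IsRep h] [IsRep a] [Cmm f g]
    [Cmm f h] [Cmm f a] [Cmm g h] [Cmm g a] [Cmm a h] {w : V}
    (hw : ∀ x, (f ⋆ g) x w = triv Q (Module.End k V) x w) :
    pl g (pl a h) (↑R.Φlr⁻¹ : H ⊗[k] (A ⊗[k] H)) (pl f (pl g (a ◁ h)) R.Φl w) =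
      pl f (pl (g ▷ a) h) R.Φlr (pl f (pl g a) R.Φl w) := by
  have e := LinearMap.congr_fun (word_mid (pl_pentagon_left R f g h a)
    (IsRep.map_units_inv _ _) (IsRep.map_units _ _)) w
  simp only [Module.End.mul_apply] at e
  rwa [pl_apply_left (f := f ⋆ g) hw, IsRep.inv_eq_one _ (pl_Φlr_left R h a),
    Module.End.one_apply] at e

end Bico

/-! ### Further solved forms of a pentagon -/

section Words

variable {B : Type*} [Monoid B] {a b c d e a' b' c' d' e' : B}

theorem word_inv_all (h : a * b * c = d * e) (ha : a * a' = 1) (hb : b * b' = 1) (hc : c * c' = 1)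
    (hd : d' * d = 1) (he : e' * e = 1) : e' * d' = c' * b' * a' := by
  have h1 : a * b * c * (c' * b' * a') = 1 := by
    calc _ = a * (b * (c * c') * b') * a' := by simp only [mul_assoc]
      _ = 1 := by rw [hc, mul_one, hb, mul_one, ha]
  calc e' * d' = e' * (d' * d) * e * (c' * b' * a') := by
        rw [mul_assoc, mul_assoc, mul_assoc, ← mul_assoc d, ← h, h1, mul_one]
    _ = c' * b' * a' := by rw [hd, mul_one, he, one_mul]

theorem word_right (h : a * b * c = d * e) (ha : a' * a = 1) (hb : b' * b = 1) (he : e * e' = 1) :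
    c * e' = b' * a' * d := by
  calc c * e' = b' * (a' * a) * b * c * e' := by rw [ha, mul_one, hb, one_mul]
    _ = b' * a' * (a * b * c) * e' := by simp only [mul_assoc]
    _ = b' * a' * d := by rw [h]; simp only [mul_assoc, he, mul_one]

end Words

/-! ### The operator behind the comultiplication of the coring -/

section CoringElement

variable {k H A : Type*} [Field k] [Ring H] [Algebra k H] [Ring A] [Algebra k A]
  (Q : QuasiHopfAlgebra k H) (R : BicomoduleAlgebra Q.toQuasiBialgebra A)

local infixl:75 " ⋆ " => conv (QuasiBialgebra.comul (QuasiHopfAlgebra.toQuasiBialgebra Q))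
local infixr:75 " ▷ " => conv (LeftComoduleAlgebra.lcoact (BicomoduleAlgebra.toLeftComoduleAlgebra R))
local infixl:75 " ◁ " => conv (RightComoduleAlgebra.rcoact (BicomoduleAlgebra.toRightComoduleAlgebra R))

section Ring

variable {B : Type*} [Ring B] [Algebra k B]

theorem conv_intertwine {X Y Z : Type*} [Ring X] [Algebra k X] [Ring Y] [Algebra k Y] [Ring Z]
    [Algebra k Z] {φ : Z →ₐ[k] X ⊗[k] Y} {J : B} {f f' : X →ₗ[k] B} {g g' : Y →ₗ[k] B}
    (hf : ∀ x, J * f x = f' x * J) (hg : ∀ y, J * g y = g' y * J) (z : Z) :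
    J * conv φ f g z = conv φ f' g' z * J := pl_intertwine hf hg _

variable (σ₂ σ₁ L₁ L₂ : H →ₗ[k] B) (a : A →ₗ[k] B)

/-- The element of an algebra `B` obtained from the factor
`(X¹ ⊗ θ¹ X²) ⊗ (θ²₀ x¹ X³₀ ⊗ (θ²₁ x² (X³₁)₁ ⊗ θ³ x³ (X³₁)₂))` of `comulElement` by maps of the
five legs to `B`. -/
def coringOp : B :=
  pl σ₁ (pl (a ◁ L₁) L₂) (↑R.Φlr⁻¹ : H ⊗[k] (A ⊗[k] H)) *
    pl a (pl L₁ L₂) (↑R.Φr⁻¹ : A ⊗[k] (H ⊗[k] H)) * pl σ₂ (pl σ₁ (a ◁ (L₁ ⋆ L₂))) R.Φl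

variable [IsRep σ₂] [IsRep σ₁] [IsRep L₁] [IsRep L₂] [IsRep a] [Cmm σ₂ σ₁] [Cmm σ₂ L₁] [Cmm σ₂ L₂]
  [Cmm σ₂ a] [Cmm σ₁ L₁] [Cmm σ₁ L₂] [Cmm σ₁ a] [Cmm L₁ L₂] [Cmm a L₁] [Cmm a L₂]

/-- Separates the twist from the reassociators: the former is governed by `twist_cocycle`, the
latter by `coringOp_assoc`. -/
theorem pl_comulElement : pl (pl σ₂ σ₁) (pl a (pl L₁ L₂)) (comulElement Q R) =
    coringOp Q R σ₂ σ₁ L₁ L₂ a * pl σ₂ σ₁ Q.twistInv := by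
  have h1 : pl σ₂ σ₁ ∘ₗ (Algebra.TensorProduct.includeRight : H →ₐ[k] H ⊗[k] H).toLinearMap =
      σ₁ := by
    ext x
    simp [IsRep.map_one]
  have h2 : pl a (pl L₁ L₂) ∘ₗ ((onSecond A Q.comul).comp R.rcoact).toLinearMap =
      a ◁ (L₁ ⋆ L₂) := by
    rw [AlgHom.comp_toLinearMap, ← LinearMap.comp_assoc, pl_comp_onSecond]; rfl
  have h3 (g : A →ₗ[k] B) (t : H ⊗[k] (H ⊗[k] A)) :
      pl (pl σ₂ σ₁) g ((aassoc k H H A).symm t) = pl σ₂ (pl σ₁ g) t := by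
    induction t using TensorProduct.induction_on with
    | zero => simp
    | add s₁ s₂ h₁ h₂ => simp only [map_add, h₁, h₂]
    | tmul x t =>
      induction t using TensorProduct.induction_on with
      | zero => simp
      | add s₁ s₂ h₁ h₂ => simp only [TensorProduct.tmul_add, map_add, h₁, h₂]
      | tmul y u => simp [mul_assoc]
  have h4 (g : A ⊗[k] (H ⊗[k] H) →ₗ[k] B) [IsRep g] (t : H ⊗[k] H) :
      pl (pl σ₂ σ₁) g (t ⊗ₜ 1) = pl σ₂ σ₁ t := by
    rw [pl_tmul, IsRep.map_one, mul_one]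
  rw [comulElement, IsRep.map_mul, IsRep.map_mul, IsRep.map_mul, pl_map, h1, pl_comp_onFirst,
    pl_one_tmul, pl_onSecond, h2, h3, h4]
  rfl

/-- Three rebracketings, one for each reassociator in `coringOp`. This gives the left `A`-linearity
of the comultiplication. -/
theorem coringOp_mul (u : A) :
    coringOp Q R σ₂ σ₁ L₁ L₂ a * ((σ₂ ⋆ σ₁) ▷ (a ◁ (L₁ ⋆ L₂))) u =
      (σ₂ ▷ ((σ₁ ▷ (a ◁ L₁)) ◁ L₂)) u * coringOp Q R σ₂ σ₁ L₁ L₂ a := by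
  have e1 := lco_assoc R.toLeftComoduleAlgebra σ₂ σ₁ (a ◁ (L₁ ⋆ L₂)) u
  have e2 : pl a (pl L₁ L₂) (↑R.Φr⁻¹ : A ⊗[k] (H ⊗[k] H)) * (σ₂ ▷ (σ₁ ▷ (a ◁ (L₁ ⋆ L₂)))) u =
      (σ₂ ▷ (σ₁ ▷ ((a ◁ L₁) ◁ L₂))) u * pl a (pl L₁ L₂) (↑R.Φr⁻¹ : A ⊗[k] (H ⊗[k] H)) :=
    conv_intertwine (fun x => Cmm.comm (f := pl a (pl L₁ L₂)) _ x)
      (conv_intertwine (fun x => Cmm.comm (f := pl a (pl L₁ L₂)) _ x)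
        (rco_assoc_inv R.toRightComoduleAlgebra L₁ L₂ a)) u
  have e3 : pl σ₁ (pl (a ◁ L₁) L₂) (↑R.Φlr⁻¹ : H ⊗[k] (A ⊗[k] H)) *
      (σ₂ ▷ (σ₁ ▷ ((a ◁ L₁) ◁ L₂))) u = (σ₂ ▷ ((σ₁ ▷ (a ◁ L₁)) ◁ L₂)) u *
        pl σ₁ (pl (a ◁ L₁) L₂) (↑R.Φlr⁻¹ : H ⊗[k] (A ⊗[k] H)) :=
    conv_intertwine (fun x => Cmm.comm (f := pl σ₁ (pl (a ◁ L₁) L₂)) _ x)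
      (bico_comm_inv R σ₁ L₂ (a ◁ L₁)) u
  rw [coringOp, mul_assoc, ← e1, mul_assoc, ← mul_assoc (pl a _ _), e2, ← mul_assoc,
    ← mul_assoc, e3]
  simp only [mul_assoc]

theorem coringOp_triv_right (σ L : H →ₗ[k] B) [IsRep σ] [IsRep L] [Cmm σ L] [Cmm σ a] [Cmm a L] :
    coringOp Q R σ (triv Q.toQuasiBialgebra B) (triv Q.toQuasiBialgebra B) L a = 1 := by
  rw [coringOp, pl_Φl_mid, mul_one, IsRep.inv_eq_one _ (pl_Φr_mid R.toRightComoduleAlgebra L a),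
    IsRep.inv_eq_one _ (pl_Φlr_left R L _), mul_one]

theorem coringOp_triv_left (σ L : H →ₗ[k] B) [IsRep σ] [IsRep L] [Cmm σ L] [Cmm σ a] [Cmm a L] :
    coringOp Q R (triv Q.toQuasiBialgebra B) σ L (triv Q.toQuasiBialgebra B) a = 1 := by
  rw [coringOp, pl_Φl_left, mul_one, IsRep.inv_eq_one _ (pl_Φr_right R.toRightComoduleAlgebra L a),
    IsRep.inv_eq_one _ (pl_Φlr_right R σ _), mul_one]

end Ring

section End

variable {V : Type*} [AddCommGroup V] [Module k V]

/-- Coassociativity of the coring with the twist and $\underline\Delta$ stripped off. The four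
pentagons involving $\Phi_\lambda$, $\Phi_\rho$ and $\Phi_{\lambda,\rho}$ are each used once. The
discrepancy $\Phi^{-1}$ on the `σ`-legs is matched by `twist_cocycle`, and $\Phi$ on the `L`-legs by
coassociativity of `C`. -/
theorem coringOp_assoc (σ₃ σ₂ σ₁ L₁ L₂ L₃ : H →ₗ[k] Module.End k V) (a : A →ₗ[k] Module.End k V)
    [IsRep σ₃] [IsRep σ₂] [IsRep σ₁] [IsRep L₁] [IsRep L₂] [IsRep L₃] [IsRep a]
    [Cmm σ₃ σ₂] [Cmm σ₃ σ₁] [Cmm σ₃ L₁] [Cmm σ₃ L₂] [Cmm σ₃ L₃] [Cmm σ₃ a]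
    [Cmm σ₂ σ₁] [Cmm σ₂ L₁] [Cmm σ₂ L₂] [Cmm σ₂ L₃] [Cmm σ₂ a]
    [Cmm σ₁ L₁] [Cmm σ₁ L₂] [Cmm σ₁ L₃] [Cmm σ₁ a]
    [Cmm L₁ L₂] [Cmm L₁ L₃] [Cmm a L₁] [Cmm L₂ L₃] [Cmm a L₂] [Cmm a L₃] :
    coringOp Q R σ₃ σ₂ L₂ L₃ (σ₁ ▷ (a ◁ L₁)) * coringOp Q R (σ₃ ⋆ σ₂) σ₁ L₁ (L₂ ⋆ L₃) a *
      pl σ₃ (pl σ₂ σ₁) (↑Q.Φ⁻¹ : H ⊗[k] (H ⊗[k] H)) * pl L₁ (pl L₂ L₃) Q.Φ =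
    coringOp Q R σ₂ σ₁ L₁ L₂ a * coringOp Q R σ₃ (σ₂ ⋆ σ₁) (L₁ ⋆ L₂) L₃ a := by
  have app {a b : Module.End k V} (h : a = b) (v : V) : a v = b v := by rw [h]
  set a' := a ◁ L₁ with ha'
  have e1 := app (pl_intertwine (J := pl σ₁ (pl a' (L₂ ⋆ L₃)) (↑R.Φlr⁻¹ : H ⊗[k] (A ⊗[k] H)))
    (fun x => Cmm.comm (g := σ₃) _ x) (pl_intertwine (fun x => Cmm.comm (g := σ₂) _ x)
      (bico_comm_inv R σ₁ (L₂ ⋆ L₃) a')) (R.Φl : H ⊗[k] (H ⊗[k] A)))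
  have e2 := app (pl_intertwine (J := pl a (pl L₁ (L₂ ⋆ L₃)) (↑R.Φr⁻¹ : A ⊗[k] (H ⊗[k] H)))
    (fun x => Cmm.comm (g := σ₃) _ x) (pl_intertwine (fun x => Cmm.comm (g := σ₂) _ x)
      (conv_intertwine (φ := R.lcoact) (fun x => Cmm.comm (g := σ₁) _ x)
        (rco_assoc_inv R.toRightComoduleAlgebra L₁ (L₂ ⋆ L₃) a))) (R.Φl : H ⊗[k] (H ⊗[k] A)))
  have e3 := app (pl_lpentagon R.toLeftComoduleAlgebra σ₃ σ₂ σ₁ (a ◁ (L₁ ⋆ (L₂ ⋆ L₃))))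
  have hΦ := app (IsRep.map_units (pl σ₃ (pl σ₂ σ₁)) Q.Φ)
  have haL : ∀ u, pl L₁ (pl L₂ L₃) (Q.Φ : H ⊗[k] (H ⊗[k] H)) * (a ◁ ((L₁ ⋆ L₂) ⋆ L₃)) u =
      (a ◁ (L₁ ⋆ (L₂ ⋆ L₃))) u * pl L₁ (pl L₂ L₃) Q.Φ :=
    conv_intertwine (fun x => Cmm.comm (g := a) _ x)
      (fun x => (star_assoc Q.toQuasiBialgebra L₁ L₂ L₃ x).symm)
  have e4 (τ₂ τ₁ : H →ₗ[k] Module.End k V) [Cmm τ₂ L₁] [Cmm τ₂ L₂] [Cmm τ₂ L₃] [Cmm τ₁ L₁]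
      [Cmm τ₁ L₂] [Cmm τ₁ L₃] :=
    app (pl_intertwine (J := pl L₁ (pl L₂ L₃) (Q.Φ : H ⊗[k] (H ⊗[k] H)))
      (fun x => Cmm.comm (g := τ₂) _ x) (pl_intertwine (fun x => Cmm.comm (g := τ₁) _ x) haL)
      (R.Φl : H ⊗[k] (H ⊗[k] A)))
  have e5 := app (word_inv_all (pl_pentagon_right R σ₁ L₂ L₃ a') (IsRep.map_units _ R.Φr)
    (IsRep.map_units _ R.Φlr) (IsRep.map_units _ R.Φlr) (IsRep.map_units_inv _ R.Φlr)
    (IsRep.map_units_inv _ R.Φr))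
  have e6 := app (word_inv_all (pl_rpentagon R.toRightComoduleAlgebra L₁ L₂ L₃ a)
    (IsRep.map_units _ Q.Φ)
    (IsRep.map_units _ R.Φr) (IsRep.map_units _ R.Φr) (IsRep.map_units_inv _ R.Φr)
    (IsRep.map_units_inv _ R.Φr))
  have hΦL := app (IsRep.map_units_inv (pl L₁ (pl L₂ L₃)) Q.Φ)
  have e7 := app (pl_intertwine (J := pl σ₁ (pl a' L₂) (↑R.Φlr⁻¹ : H ⊗[k] (A ⊗[k] H)))
    (fun x => Cmm.comm (g := σ₂) _ x) (pl_intertwine (bico_comm_inv R σ₁ L₂ a')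
      (fun x => Cmm.comm (g := L₃) _ x)) (↑R.Φlr⁻¹ : H ⊗[k] (A ⊗[k] H)))
  have e8 := app (word_right (pl_pentagon_left R σ₂ σ₁ L₃ (a ◁ (L₁ ⋆ L₂)))
    (IsRep.map_units_inv _ R.Φlr) (IsRep.map_units_inv _ R.Φlr) (IsRep.map_units _ R.Φlr))
  have hxr := rco_assoc_inv R.toRightComoduleAlgebra L₁ L₂ a
  have e9 := app (pl_intertwine (J := pl a (pl L₁ L₂) (↑R.Φr⁻¹ : A ⊗[k] (H ⊗[k] H)))
    (fun x => Cmm.comm (g := σ₂) _ x) (pl_intertwine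
      (conv_intertwine (φ := R.lcoact) (fun x => Cmm.comm (g := σ₁) _ x) hxr)
      (fun x => Cmm.comm (g := L₃) _ x)) (↑R.Φlr⁻¹ : H ⊗[k] (A ⊗[k] H)))
  have e10 := app (pl_intertwine (J := pl a (pl L₁ L₂) (↑R.Φr⁻¹ : A ⊗[k] (H ⊗[k] H)))
    (fun x => Cmm.comm (g := σ₁) _ x) (pl_intertwine hxr
      (fun x => Cmm.comm (g := L₃) _ x)) (↑R.Φlr⁻¹ : H ⊗[k] (A ⊗[k] H)))
  have e11 := app (pl_intertwine (J := pl a (pl (L₁ ⋆ L₂) L₃) (↑R.Φr⁻¹ : A ⊗[k] (H ⊗[k] H)))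
    (fun x => Cmm.comm (g := σ₂) _ x) (pl_intertwine (fun x => Cmm.comm (g := σ₁) _ x)
      (rco_assoc_inv R.toRightComoduleAlgebra (L₁ ⋆ L₂) L₃ a)) (R.Φl : H ⊗[k] (H ⊗[k] A)))
  simp only [Module.End.mul_apply, Module.End.one_apply] at e1 e2 e3 hΦ e4 e5 e6 hΦL e7 e8 e9 e10 e11
  ext v
  simp only [coringOp, Module.End.mul_apply]
  -- The two copies of $\Phi_\lambda$ are brought together for `pl_lpentagon`, and $\Phi$ on the
  -- `L`-legs is moved inside to meet the pentagons `e5` of $\Phi_{\lambda,\rho}$ and `e6` of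
  -- $\Phi_\rho$. Then `e8` splits $\Phi_\lambda$ against $\Phi_{\lambda,\rho}^{-1}$, and the
  -- remaining steps only reorder factors.
  rw [← e1, ← e2, ← e3, hΦ, ← e4, ← e4, e5, e6, hΦL, ← e7, e8, e9, e10, e11]

end End

end CoringElement

/-! ### Compatible maps versus linear maps -/

section Hat

variable {k H A : Type*} [Field k] [Ring H] [Algebra k H] [Ring A] [Algebra k A]
  (Q : QuasiHopfAlgebra k H) (L : LeftComoduleAlgebra Q.toQuasiBialgebra A)

local infixl:75 " ⋆ " => conv (QuasiBialgebra.comul (QuasiHopfAlgebra.toQuasiBialgebra Q))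
local infixr:75 " ▷ " => conv (LeftComoduleAlgebra.lcoact L)

variable {M V V' X : Type*} [AddCommGroup M] [Module k M] [AddCommGroup V] [Module k V]
  [AddCommGroup V'] [Module k V'] [AddCommGroup X] [Module k X]

/-- The map `h ⊗ x ↦ s(S(h)) ∘ χ(x)`. -/
def hatBy (s : H →ₗ[k] Module.End k V) (χ : X →ₗ[k] M →ₗ[k] V) : H ⊗[k] X →ₗ[k] M →ₗ[k] V :=
  TensorProduct.lift ((LinearMap.llcomp k M V V).compl₂ χ ∘ₗ s ∘ₗ Q.S.toLinearMap)

@[simp] theorem hatBy_tmul (s : H →ₗ[k] Module.End k V) (χ : X →ₗ[k] M →ₗ[k] V) (h : H) (x : X)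
    (m : M) : hatBy Q s χ (h ⊗ₜ x) m = s (Q.S h) (χ x m) := rfl

theorem hatBy_rinv (s : H →ₗ[k] Module.End k V) [IsRep s] (χ : X →ₗ[k] M →ₗ[k] V) (h : H)
    (t : H ⊗[k] X) (m : M) : hatBy Q s χ (onL X (rinv Q) h t) m = s h (hatBy Q s χ t m) := by
  induction t using TensorProduct.induction_on with
  | zero => simp
  | add s₁ s₂ h₁ h₂ => simp only [map_add, LinearMap.add_apply, h₁, h₂]
  | tmul z x => simp [Q.S_mul, IsRep.map_mul]

variable (s : H →ₗ[k] Module.End k V) (l : A →ₗ[k] Module.End k M)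

/-- The map `h ⊗ a ↦ s(S(h)) ∘ F ∘ l(a)`. -/
def hat (F : M →ₗ[k] V) : H ⊗[k] A →ₗ[k] M →ₗ[k] V :=
  hatBy Q s (LinearMap.llcomp k M M V F ∘ₗ l)

@[simp] theorem hat_tmul (F : M →ₗ[k] V) (h : H) (a : A) (m : M) :
    hat Q s l F (h ⊗ₜ a) m = s (Q.S h) (F (l a m)) := rfl

theorem hat_one [IsRep s] [IsRep l] (F : M →ₗ[k] V) (m : M) : hat Q s l F 1 m = F m := by
  simp [Algebra.TensorProduct.one_def, Q.S_one, IsRep.map_one]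

theorem hat_mul_tmul [IsRep s] [IsRep l] (F : M →ₗ[k] V) (y : H ⊗[k] A) (h : H) (a : A) (m : M) :
    hat Q s l F (y * (h ⊗ₜ a)) m = s (Q.S h) (hat Q s l F y (l a m)) := by
  induction y using TensorProduct.induction_on with
  | zero => simp
  | add s₁ s₂ h₁ h₂ => simp only [map_add, add_mul, LinearMap.add_apply, h₁, h₂]
  | tmul z x => simp [Q.S_mul, IsRep.map_mul]

theorem hat_mulRight [IsRep l] (F : M →ₗ[k] V) (y : H ⊗[k] A) (a : A) (m : M) :
    hat Q s l F ((LinearMap.mulRight k a).lTensor H y) m = hat Q s l F y (l a m) := by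
  induction y using TensorProduct.induction_on with
  | zero => simp
  | add s₁ s₂ h₁ h₂ => simp only [map_add, LinearMap.add_apply, h₁, h₂]
  | tmul z x => simp [IsRep.map_mul]

variable (e : A →ₗ[k] Module.End k V) [IsRep s] [IsRep l] [IsRep e] [Cmm s e]

/-- With `hF`, the map `t ↦ hat Q s l F t m` from $H\otimes A$ intertwines left multiplication by
$\lambda(u)$ with `e`. So `recov_eq` can be applied with this map as `χ`. -/
theorem hat_lid {F : M →ₗ[k] V} (hF : ∀ u m, e u (F m) = hat Q s l F (L.lcoact u) m) (u : A)
    (t : H ⊗[k] A) (m : M) :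
    hat Q s l F ((onL A (lid k H) ▷ onR H (lid k A)) u t) m = e u (hat Q s l F t m) := by
  rw [conv, pl_onL_onR_lid]
  change hat Q s l F (L.lcoact u * t) m = _
  induction t using TensorProduct.induction_on with
  | zero => simp
  | add s₁ s₂ h₁ h₂ => simp only [map_add, mul_add, LinearMap.add_apply, h₁, h₂]
  | tmul z x => rw [hat_mul_tmul, ← hF, hat_tmul, Cmm.apply (f := s) (g := e)]

/-- The identity `pElem_intertwine` evaluated through `F`; it gives linearity of the comodule
coaction. -/
theorem hat_pElem_linear {F : M →ₗ[k] V} (hF : ∀ u m, e u (F m) = hat Q s l F (L.lcoact u) m)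
    (u : A) (m : M) : hat Q s l F (pElem Q L) (l u m) = (s ▷ e) u (hat Q s l F (pElem Q L) m) := by
  -- Acting with `u` on `m` amounts to right multiplication of $p$ by $1\otimes u$.
  rw [← hat_mulRight, ← pElem_intertwine]
  exact conv_intertwine_end (J := (hat Q s l F).flip m) (fun x v => hatBy_rinv Q s _ x v m)
    (fun x v => hat_lid Q L s l e hF x v m) _ _

theorem recov_hat {F : M →ₗ[k] V} (hF : ∀ u m, e u (F m) = hat Q s l F (L.lcoact u) m) (m : M) :
    recov Q L s e (hat Q s l F (pElem Q L) m) = F m := by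
  have := recov_eq Q L (s := s) (e := e) (χ := (hat Q s l F).flip m)
    (fun x v => hatBy_rinv Q s _ x v m) (fun x v => hat_lid Q L s l e hF x v m)
  simp only [LinearMap.flip_apply] at this
  rw [this, hat_one]

theorem recovHat_eq_hat {F : M →ₗ[k] V} (hF : ∀ u m, F (l u m) = (s ▷ e) u (F m)) (t : H ⊗[k] A)
    (m : M) : recovHat Q L s e (F m) t = hat Q s l (recov Q L s e ∘ₗ F) t m := by
  induction t using TensorProduct.induction_on with
  | zero => simp
  | add s₁ s₂ h₁ h₂ => simp only [map_add, LinearMap.add_apply, h₁, h₂]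
  | tmul z x => rw [recovHat_tmul, ← hF]; rfl

theorem recov_compat {F : M →ₗ[k] V} (hF : ∀ u m, F (l u m) = (s ▷ e) u (F m)) (u : A) (m : M) :
    e u ((recov Q L s e ∘ₗ F) m) = hat Q s l (recov Q L s e ∘ₗ F) (L.lcoact u) m := by
  rw [← recovHat_eq_hat Q L s l e hF, ← apply_recov_eq, LinearMap.comp_apply]

theorem hat_recov {F : M →ₗ[k] V} (hF : ∀ u m, F (l u m) = (s ▷ e) u (F m)) (m : M) :
    hat Q s l (recov Q L s e ∘ₗ F) (pElem Q L) m = F m := by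
  rw [← recovHat_eq_hat Q L s l e hF, recovHat_pElem]

section Twice

variable (s₁ s₂ : H →ₗ[k] Module.End k V) [IsRep s₁] [IsRep s₂] [Cmm s₁ s₂]

/-- The map `h ⊗ h' ⊗ a ↦ s₁(S(h)) ∘ s₂(S(h')) ∘ F ∘ l(a)`. -/
def hat₂ (F : M →ₗ[k] V) : H ⊗[k] (H ⊗[k] A) →ₗ[k] M →ₗ[k] V := hatBy Q s₁ (hat Q s₂ l F)

@[simp] theorem hat₂_tmul (F : M →ₗ[k] V) (h : H) (t : H ⊗[k] A) (m : M) :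
    hat₂ Q l s₁ s₂ F (h ⊗ₜ t) m = s₁ (Q.S h) (hat Q s₂ l F t m) := rfl

theorem hat₂_one (F : M →ₗ[k] V) (m : M) : hat₂ Q l s₁ s₂ F 1 m = F m := by
  simp [Algebra.TensorProduct.one_def, Q.S_one, IsRep.map_one]

theorem hat₂_mul_tmul (F : M →ₗ[k] V) (y : H ⊗[k] (H ⊗[k] A)) (h h' : H) (a : A) (m : M) :
    hat₂ Q l s₁ s₂ F (y * (h ⊗ₜ (h' ⊗ₜ a))) m =
      s₁ (Q.S h) (s₂ (Q.S h') (hat₂ Q l s₁ s₂ F y (l a m))) := by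
  induction y using TensorProduct.induction_on with
  | zero => simp
  | add s₁ s₂ h₁ h₂ => simp only [map_add, add_mul, LinearMap.add_apply, h₁, h₂]
  | tmul z x =>
    rw [Algebra.TensorProduct.tmul_mul_tmul, hat₂_tmul, hat_mul_tmul, Q.S_mul, IsRep.map_mul,
      Module.End.mul_apply, hat₂_tmul, Cmm.apply (f := s₁) (g := s₂) (Q.S z)]

theorem hat₂_rinv_fst (F : M →ₗ[k] V) (h : H) (t : H ⊗[k] (H ⊗[k] A)) (m : M) :
    hat₂ Q l s₁ s₂ F (onL (H ⊗[k] A) (rinv Q) h t) m = s₁ h (hat₂ Q l s₁ s₂ F t m) :=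
  hatBy_rinv Q s₁ _ h t m

theorem hat₂_rinv_snd (F : M →ₗ[k] V) (h : H) (t : H ⊗[k] (H ⊗[k] A)) (m : M) :
    hat₂ Q l s₁ s₂ F (onR H (onL A (rinv Q)) h t) m = s₂ h (hat₂ Q l s₁ s₂ F t m) := by
  induction t using TensorProduct.induction_on with
  | zero => simp
  | add s₁ s₂ h₁ h₂ => simp only [map_add, LinearMap.add_apply, h₁, h₂]
  | tmul z x =>
    rw [onR_tmul, hat₂_tmul, hat₂_tmul, hat, hatBy_rinv, Cmm.apply (f := s₁) (g := s₂)]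

theorem pl_lid_lid_lid {X Y Z : Type*} [Ring X] [Algebra k X] [Ring Y] [Algebra k Y] [Ring Z]
    [Algebra k Z] (t y : X ⊗[k] (Y ⊗[k] Z)) :
    pl (onL (Y ⊗[k] Z) (lid k X)) (pl (onR X (onL Z (lid k Y))) (onR X (onR Y (lid k Z)))) t y =
      t * y := by
  rw [pl_onR_eq, pl_onL_onR_lid, pl_onL_onR_lid, lop_apply, LinearMap.id_apply]

theorem conv_lid₃ (u : A) (t : H ⊗[k] (H ⊗[k] A)) :
    (onL (H ⊗[k] A) (lid k H) ▷ (onR H (onL A (lid k H)) ▷ onR H (onR H (lid k A)))) u t =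
      onSecond H L.lcoact (L.lcoact u) * t := by
  rw [← pl_lid_lid_lid, pl_onSecond]; rfl

variable [Cmm s₁ e] [Cmm s₂ e]

/-- Makes evaluation at `pElem₂` injective on maps compatible with the iterated coaction, so both
sides of coassociativity may be compared there. -/
theorem recov_recov_hat₂ {F : M →ₗ[k] V}
    (hF : ∀ u m, e u (F m) = hat₂ Q l s₁ s₂ F (onSecond H L.lcoact (L.lcoact u)) m) (m : M) :
    recov Q L s₁ e (recov Q L s₂ (s₁ ▷ e) (hat₂ Q l s₁ s₂ F (pElem₂ Q L) m)) = F m := by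
  have := recov_recov Q L (s₁ := s₁) (s₂ := s₂) (e := e) (χ := (hat₂ Q l s₁ s₂ F).flip m)
    (fun h t => hat₂_rinv_fst Q l s₁ s₂ F h t m) (fun h t => hat₂_rinv_snd Q l s₁ s₂ F h t m) (by
      intro u t
      rw [conv_lid₃]
      simp only [LinearMap.flip_apply]
      induction t using TensorProduct.induction_on with
      | zero => simp
      | add s₁ s₂ h₁ h₂ => simp only [map_add, mul_add, LinearMap.add_apply, h₁, h₂]
      | tmul z x =>
        induction x using TensorProduct.induction_on with
        | zero => simp
        | add s₁ s₂ h₁ h₂ =>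
          simp only [map_add, mul_add, TensorProduct.tmul_add, LinearMap.add_apply, h₁, h₂]
        | tmul y a => rw [hat₂_mul_tmul, ← hF, hat₂_tmul, hat_tmul, Cmm.apply (f := s₂) (g := e),
            Cmm.apply (f := s₁) (g := e)])
  simp only [LinearMap.flip_apply] at this
  rw [this, hat₂_one]

/-- Two compatible maps agree if their iterated contractions agree. -/
theorem eq_iff_hat₂ {F G : M →ₗ[k] V}
    (hF : ∀ u m, e u (F m) = hat₂ Q l s₁ s₂ F (onSecond H L.lcoact (L.lcoact u)) m)
    (hG : ∀ u m, e u (G m) = hat₂ Q l s₁ s₂ G (onSecond H L.lcoact (L.lcoact u)) m) :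
    F = G ↔ hat₂ Q l s₁ s₂ F (pElem₂ Q L) = hat₂ Q l s₁ s₂ G (pElem₂ Q L) := by
  refine ⟨fun h => by rw [h], fun h => LinearMap.ext fun m => ?_⟩
  rw [← recov_recov_hat₂ Q L l e s₁ s₂ hF, h, recov_recov_hat₂ Q L l e s₁ s₂ hG]

end Twice

end Hat

/-! ### The actions on $M$ and $C$ as representations -/

section Representations

variable {k H A C : Type*} [Field k] [Ring H] [Algebra k H] [Ring A] [Algebra k A]
  [AddCommGroup C] [Module k C] [Module H C] [IsScalarTower k H C] [Module Hᵐᵒᵖ C]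
  [IsScalarTower k Hᵐᵒᵖ C] [SMulCommClass H Hᵐᵒᵖ C] (Q : QuasiHopfAlgebra k H)

/-- The left action of `R` on `M` as a map to the endomorphisms of `M`. -/
def lrep (k R M : Type*) [Field k] [Ring R] [Algebra k R] [AddCommGroup M] [Module k M]
    [Module R M] [IsScalarTower k R M] : R →ₗ[k] Module.End k M := lact k R M

@[simp] theorem lrep_apply {R M : Type*} [Ring R] [Algebra k R] [AddCommGroup M] [Module k M]
    [Module R M] [IsScalarTower k R M] (r : R) (m : M) : lrep k R M r m = r • m := rfl

instance {R M : Type*} [Ring R] [Algebra k R] [AddCommGroup M] [Module k M]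
    [Module R M] [IsScalarTower k R M] : IsRep (lrep k R M) :=
  ⟨fun x y => LinearMap.ext fun z => by simp [mul_smul], LinearMap.ext fun z => by simp⟩

/-- The operators `c ↦ c · S⁻¹(h)`. -/
def srep (C : Type*) [AddCommGroup C] [Module k C] [Module Hᵐᵒᵖ C] [IsScalarTower k Hᵐᵒᵖ C] :
    H →ₗ[k] Module.End k C := ractSInv Q C

@[simp] theorem srep_apply (h : H) (c : C) : srep Q C h c = op (Q.S.symm h) • c := rfl

instance : IsRep (srep Q C) :=
  ⟨fun x y => LinearMap.ext fun z => by simp [S_symm_mul, mul_smul],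
    LinearMap.ext fun z => by simp [S_symm_one]⟩

instance : Cmm (srep Q C) (lrep k H C) :=
  ⟨fun x y => LinearMap.ext fun z => by simp [smul_comm]⟩

/-- The right action of $H$ is turned into the left representation $c\mapsto cS^{-1}(h)$ so that it
can be convolved. Composing with $S$ gives the right action back. -/
theorem antip_srep : antip Q (srep Q C) = ract k H C := by
  ext h c
  simp

theorem map₂_eq_pl {X Y V V' : Type*} [Ring X] [Algebra k X] [Ring Y] [Algebra k Y]
    [AddCommGroup V] [Module k V] [AddCommGroup V'] [Module k V'] (f : X →ₗ[k] Module.End k V)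
    (g : Y →ₗ[k] Module.End k V') (t : X ⊗[k] Y) :
    TensorProduct.map₂ f g t = pl (onL V' f) (onR V g) t := by
  induction t using TensorProduct.induction_on with
  | zero => simp
  | add s₁ s₂ h₁ h₂ => simp only [map_add, h₁, h₂]
  | tmul x y => ext v v'; simp

theorem onR_pl {X Y V V' : Type*} [Ring X] [Algebra k X] [Ring Y] [Algebra k Y]
    [AddCommGroup V] [Module k V] [AddCommGroup V'] [Module k V'] (f : X →ₗ[k] Module.End k V')
    (g : Y →ₗ[k] Module.End k V') : onR V (pl f g) = pl (onR V f) (onR V g) :=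
  (LinearMap.ext fun t => TensorProduct.ext' fun v v' => (pl_onR f g t v v')).symm

theorem map₂_map₂_eq_pl {X Y Z V V' V'' : Type*} [Ring X] [Algebra k X] [Ring Y] [Algebra k Y]
    [Ring Z] [Algebra k Z] [AddCommGroup V] [Module k V] [AddCommGroup V'] [Module k V']
    [AddCommGroup V''] [Module k V''] (f : X →ₗ[k] Module.End k V) (g : Y →ₗ[k] Module.End k V')
    (h : Z →ₗ[k] Module.End k V'') (t : X ⊗[k] (Y ⊗[k] Z)) :
    TensorProduct.map₂ f (TensorProduct.map₂ g h) t =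
      pl (onL (V' ⊗[k] V'') f) (pl (onR V (onL V'' g)) (onR V (onR V' h))) t := by
  have : TensorProduct.map₂ g h = pl (onL V'' g) (onR V' h) := LinearMap.ext (map₂_eq_pl g h)
  rw [this, map₂_eq_pl, onR_pl]

end Representations

/-! ### Yetter-Drinfeld coassociativity in terms of $F$ -/

section YD

variable {k H A C : Type*} [Field k] [Ring H] [Algebra k H] [Ring A] [Algebra k A]
  [AddCommGroup C] [Module k C] [Module H C] [IsScalarTower k H C] [Module Hᵐᵒᵖ C]
  [IsScalarTower k Hᵐᵒᵖ C] [SMulCommClass H Hᵐᵒᵖ C] (Q : QuasiHopfAlgebra k H)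
  (R : BicomoduleAlgebra Q.toQuasiBialgebra A) (𝒞 : BimoduleCoalgebra Q.toQuasiBialgebra C)
  {M : Type*} [AddCommGroup M] [Module k M]

local infixl:75 " ⋆ " => conv (QuasiBialgebra.comul (QuasiHopfAlgebra.toQuasiBialgebra Q))
local infixr:75 " ▷ " => conv (LeftComoduleAlgebra.lcoact (BicomoduleAlgebra.toLeftComoduleAlgebra R))
local infixl:75 " ◁ " => conv (RightComoduleAlgebra.rcoact (BicomoduleAlgebra.toRightComoduleAlgebra R))

/-- `H` acting on the left on the factor `C` of `M ⊗ C`. -/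
abbrev lC (k H M C : Type*) [Field k] [Ring H] [Algebra k H] [AddCommGroup M] [Module k M]
    [AddCommGroup C] [Module k C] [Module H C] [IsScalarTower k H C] :
    H →ₗ[k] Module.End k (M ⊗[k] C) := onR M (lrep k H C)

/-- `H` acting through `S⁻¹` on the right on the factor `C` of `M ⊗ C`. -/
abbrev sC (M C : Type*) [AddCommGroup M] [Module k M]
    [AddCommGroup C] [Module k C] [Module Hᵐᵒᵖ C] [IsScalarTower k Hᵐᵒᵖ C] :
    H →ₗ[k] Module.End k (M ⊗[k] C) := onR M (srep Q C)

/-- `H` acting on the left on the first factor `C` of `M ⊗ (C ⊗ C)`. -/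
abbrev lC₁ (k H M C : Type*) [Field k] [Ring H] [Algebra k H] [AddCommGroup M] [Module k M]
    [AddCommGroup C] [Module k C] [Module H C] [IsScalarTower k H C] :
    H →ₗ[k] Module.End k (M ⊗[k] (C ⊗[k] C)) := onR M (onL C (lrep k H C))

/-- `H` acting on the left on the second factor `C` of `M ⊗ (C ⊗ C)`. -/
abbrev lC₂ (k H M C : Type*) [Field k] [Ring H] [Algebra k H] [AddCommGroup M] [Module k M]
    [AddCommGroup C] [Module k C] [Module H C] [IsScalarTower k H C] :
    H →ₗ[k] Module.End k (M ⊗[k] (C ⊗[k] C)) := onR M (onR C (lrep k H C))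

/-- `H` acting through `S⁻¹` on the right on the first factor `C` of `M ⊗ (C ⊗ C)`. -/
abbrev sC₁ (M C : Type*) [AddCommGroup M] [Module k M]
    [AddCommGroup C] [Module k C] [Module Hᵐᵒᵖ C] [IsScalarTower k Hᵐᵒᵖ C] :
    H →ₗ[k] Module.End k (M ⊗[k] (C ⊗[k] C)) := onR M (onL C (srep Q C))

/-- `H` acting through `S⁻¹` on the right on the second factor `C` of `M ⊗ (C ⊗ C)`. -/
abbrev sC₂ (M C : Type*) [AddCommGroup M] [Module k M]
    [AddCommGroup C] [Module k C] [Module Hᵐᵒᵖ C] [IsScalarTower k Hᵐᵒᵖ C] :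
    H →ₗ[k] Module.End k (M ⊗[k] (C ⊗[k] C)) := onR M (onR C (srep Q C))

theorem comul_lrep (h : H) (v : M ⊗[k] C) : 𝒞.comul.lTensor M (lC k H M C h v) =
    (lC₁ k H M C ⋆ lC₂ k H M C) h (𝒞.comul.lTensor M v) := by
  induction v using TensorProduct.induction_on with
  | zero => simp
  | add s₁ s₂ h₁ h₂ => simp only [map_add, h₁, h₂]
  | tmul m c =>
    rw [conv_apply, LinearMap.lTensor_tmul, pl_onR, ← map₂_eq_pl, onR_tmul, LinearMap.lTensor_tmul,
      lrep_apply, 𝒞.comul_smul]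
    rfl

/-- $\underline\Delta$ turns the action through $S^{-1}$ into $\Delta(S^{-1}(h))$, which is not a
convolution of actions through $S^{-1}$. The twist repairs this, which is why $f^{-1}$ occurs in the
coring. -/
theorem comul_srep (h : H) (v : M ⊗[k] C) : 𝒞.comul.lTensor M (sC Q M C h v) =
    (antip Q (sC₁ Q M C) ⋆ antip Q (sC₂ Q M C)) (Q.S.symm h) (𝒞.comul.lTensor M v) := by
  induction v using TensorProduct.induction_on with
  | zero => simp
  | add s₁ s₂ h₁ h₂ => simp only [map_add, h₁, h₂]
  | tmul m c =>
    have e := pl_onR (antip Q (onL C (srep Q C))) (antip Q (onR C (srep Q C)))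
      (Q.comul (Q.S.symm h)) m (𝒞.comul c)
    rw [onR_tmul, LinearMap.lTensor_tmul, srep_apply, 𝒞.comul_op_smul, ← antip_srep Q,
      map₂_eq_pl]
    exact e.symm

variable (l : A →ₗ[k] Module.End k M) (r : M →ₗ[k] M ⊗[k] C)

/-- The map `r ⊗ id : M ⊗ C → M ⊗ C ⊗ C`. -/
def onFst : M ⊗[k] C →ₗ[k] M ⊗[k] (C ⊗[k] C) :=
  (TensorProduct.assoc k M C C).toLinearMap ∘ₗ r.rTensor C

theorem onFst_tmul (m : M) (c : C) :
    onFst r (m ⊗ₜ c) = TensorProduct.assoc k M C C (r m ⊗ₜ c) := rfl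

theorem assoc_onL (f : A →ₗ[k] Module.End k M) (u : A) (v : M ⊗[k] C) (c : C) :
    TensorProduct.assoc k M C C (onL C f u v ⊗ₜ c) =
      onL (C ⊗[k] C) f u (TensorProduct.assoc k M C C (v ⊗ₜ c)) := by
  induction v using TensorProduct.induction_on with
  | zero => simp
  | add s₁ s₂ h₁ h₂ => simp only [map_add, TensorProduct.add_tmul, h₁, h₂]
  | tmul m c => simp

theorem assoc_onR {X : Type*} [Ring X] [Algebra k X] (f : X →ₗ[k] Module.End k C) (u : X)
    (v : M ⊗[k] C) (c : C) : TensorProduct.assoc k M C C (onR M f u v ⊗ₜ c) =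
      onR M (onL C f) u (TensorProduct.assoc k M C C (v ⊗ₜ c)) := by
  induction v using TensorProduct.induction_on with
  | zero => simp
  | add s₁ s₂ h₁ h₂ => simp only [map_add, TensorProduct.add_tmul, h₁, h₂]
  | tmul m c => simp

theorem onFst_onR {X : Type*} [Ring X] [Algebra k X] (f : X →ₗ[k] Module.End k C) (x : X)
    (v : M ⊗[k] C) : onFst r (onR M f x v) = onR M (onR C f) x (onFst r v) := by
  induction v using TensorProduct.induction_on with
  | zero => simp
  | add s₁ s₂ h₁ h₂ => simp only [map_add, h₁, h₂]
  | tmul m c =>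
    rw [onR_tmul, onFst_tmul, onFst_tmul]
    induction r m using TensorProduct.induction_on with
    | zero => simp
    | add s₁ s₂ h₁ h₂ => simp only [map_add, TensorProduct.add_tmul, h₁, h₂]
    | tmul m c => simp

theorem hat_onFst (t : H ⊗[k] A) (v : M ⊗[k] C) :
    hat Q (sC₁ Q M C) (onL C l) (onFst r) t v = onFst (hat Q (sC Q M C) l r t) v := by
  induction t using TensorProduct.induction_on with
  | zero => simp [onFst]
  | add s₁ s₂ h₁ h₂ =>
    rw [map_add, LinearMap.add_apply, h₁, h₂, map_add]
    simp [onFst, LinearMap.rTensor_add]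
  | tmul h a =>
    induction v using TensorProduct.induction_on with
    | zero => simp
    | add s₁ s₂ h₁ h₂ => simp only [map_add, h₁, h₂]
    | tmul m c => rw [hat_tmul, onL_tmul, onFst_tmul, onFst_tmul, hat_tmul, assoc_onR]

variable {r} [IsRep l]

/-- The compatibility of `r`, with a spectator factor `C` carried along. -/
theorem onFst_compat
    (hr : ∀ u m, (onL C l ◁ lC k H M C) u (r m) = hat Q (sC Q M C) l r (R.lcoact u) m)
    (u : A) (v : M ⊗[k] C) : (onL (C ⊗[k] C) l ◁ lC₁ k H M C) u (onFst r v) =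
      hat Q (sC₁ Q M C) (onL C l) (onFst r) (R.lcoact u) v := by
  rw [hat_onFst]
  induction v using TensorProduct.induction_on with
  | zero => simp
  | add s₁ s₂ h₁ h₂ => simp only [map_add, h₁, h₂]
  | tmul m c =>
    rw [onFst_tmul, onFst_tmul, ← hr]
    exact (conv_intertwine_end
      (J := (TensorProduct.assoc k M C C).toLinearMap ∘ₗ (TensorProduct.mk k (M ⊗[k] C) C).flip c)
      (fun x v => assoc_onL l x v c) (fun x v => assoc_onR (lrep k H C) x v c) u (r m)).symm

theorem hat₂_comul (t : H ⊗[k] A) (m : M) :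
    hat₂ Q l (sC₁ Q M C) (sC₂ Q M C) (𝒞.comul.lTensor M ∘ₗ r) (onFirst Q.comul A t) m =
      𝒞.comul.lTensor M (hat Q (sC Q M C) l r t m) := by
  induction t using TensorProduct.induction_on with
  | zero => simp
  | add s₁ s₂ h₁ h₂ => simp only [map_add, LinearMap.add_apply, h₁, h₂]
  | tmul h a =>
    rw [hat_tmul, comul_srep, LinearEquiv.symm_apply_apply, conv_apply]
    change hat₂ Q l (sC₁ Q M C) (sC₂ Q M C) (𝒞.comul.lTensor M ∘ₗ r)
      (aassoc k H H A (Q.comul h ⊗ₜ a)) m = _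
    induction Q.comul h using TensorProduct.induction_on with
    | zero => simp
    | add s₁ s₂ h₁ h₂ =>
      simp only [map_add, LinearMap.add_apply, TensorProduct.add_tmul, h₁, h₂]
    | tmul x y => simp

theorem hat₂_comul_mul
    (hr : ∀ u m, (onL C l ◁ lC k H M C) u (r m) = hat Q (sC Q M C) l r (R.lcoact u) m)
    (u : A) (t : H ⊗[k] (H ⊗[k] A)) (m : M) :
    hat₂ Q l (sC₁ Q M C) (sC₂ Q M C) (𝒞.comul.lTensor M ∘ₗ r)
      (onFirst Q.comul A (R.lcoact u) * t) m =
    (onL (C ⊗[k] C) l ◁ (lC₁ k H M C ⋆ lC₂ k H M C)) u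
      (hat₂ Q l (sC₁ Q M C) (sC₂ Q M C) (𝒞.comul.lTensor M ∘ₗ r) t m) := by
  have h0 : ∀ m, hat₂ Q l (sC₁ Q M C) (sC₂ Q M C) (𝒞.comul.lTensor M ∘ₗ r)
      (onFirst Q.comul A (R.lcoact u)) m =
      (onL (C ⊗[k] C) l ◁ (lC₁ k H M C ⋆ lC₂ k H M C)) u (𝒞.comul.lTensor M (r m)) := by
    intro m
    rw [hat₂_comul, ← hr]
    refine conv_intertwine_end (fun x v => ?_) (comul_lrep Q 𝒞) u (r m)
    exact LinearMap.congr_fun (show 𝒞.comul.lTensor M ∘ₗ onL C l x =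
      onL (C ⊗[k] C) l x ∘ₗ 𝒞.comul.lTensor M from TensorProduct.ext' fun _ _ => rfl) v
  induction t using TensorProduct.induction_on with
  | zero => simp
  | add s₁ s₂ h₁ h₂ => simp only [map_add, mul_add, LinearMap.add_apply, h₁, h₂]
  | tmul z x =>
    induction x using TensorProduct.induction_on with
    | zero => simp
    | add s₁ s₂ h₁ h₂ =>
      simp only [map_add, mul_add, TensorProduct.tmul_add, LinearMap.add_apply, h₁, h₂]
    | tmul y a =>
      rw [hat₂_mul_tmul, h0, hat₂_tmul, hat_tmul, Cmm.apply (f := sC₂ Q M C),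
        Cmm.apply (f := sC₁ Q M C)]
      rfl

/-- The right hand side of the coassociativity of a Yetter-Drinfeld module. -/
def coassocRight (r : M →ₗ[k] M ⊗[k] C) : M →ₗ[k] M ⊗[k] (C ⊗[k] C) :=
  pl (onL (C ⊗[k] C) l) (pl (lC₁ k H M C) (lC₂ k H M C)) (↑R.Φr⁻¹ : A ⊗[k] (H ⊗[k] H)) ∘ₗ
    hat₂ Q l (sC₁ Q M C) (sC₂ Q M C) (𝒞.comul.lTensor M ∘ₗ r) (↑R.Φl⁻¹ : H ⊗[k] (H ⊗[k] A))

theorem hat₂_coassocRight (y : H ⊗[k] (H ⊗[k] A)) (m : M) :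
    hat₂ Q l (sC₁ Q M C) (sC₂ Q M C) (coassocRight Q R 𝒞 l r) y m =
      pl (onL (C ⊗[k] C) l) (pl (lC₁ k H M C) (lC₂ k H M C)) (↑R.Φr⁻¹ : A ⊗[k] (H ⊗[k] H))
        (hat₂ Q l (sC₁ Q M C) (sC₂ Q M C) (𝒞.comul.lTensor M ∘ₗ r)
          ((↑R.Φl⁻¹ : H ⊗[k] (H ⊗[k] A)) * y) m) := by
  induction y using TensorProduct.induction_on with
  | zero => simp
  | add s₁ s₂ h₁ h₂ => simp only [map_add, mul_add, LinearMap.add_apply, h₁, h₂]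
  | tmul z x =>
    induction x using TensorProduct.induction_on with
    | zero => simp
    | add s₁ s₂ h₁ h₂ =>
      simp only [map_add, mul_add, TensorProduct.tmul_add, LinearMap.add_apply, h₁, h₂]
    | tmul y a =>
      rw [hat₂_mul_tmul, hat₂_tmul, hat_tmul, coassocRight, LinearMap.comp_apply,
        Cmm.apply (f := sC₂ Q M C), Cmm.apply (f := sC₁ Q M C)]

/-- $\Phi_\lambda^{-1}$ changes the iterated $\lambda$ into $(\Delta\otimes\mathrm{id})\lambda$, the
compatibility of `r` turns this into $\rho$ followed by $\Delta$, and $\Phi_\rho^{-1}$ produces the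
iterated $\rho$. -/
theorem coassocRight_compat
    (hr : ∀ u m, (onL C l ◁ lC k H M C) u (r m) = hat Q (sC Q M C) l r (R.lcoact u) m)
    (u : A) (m : M) :
    ((onL (C ⊗[k] C) l ◁ lC₁ k H M C) ◁ lC₂ k H M C) u (coassocRight Q R 𝒞 l r m) =
      hat₂ Q l (sC₁ Q M C) (sC₂ Q M C) (coassocRight Q R 𝒞 l r)
        (onSecond H R.lcoact (R.lcoact u)) m := by
  have e := LinearMap.congr_fun (rco_assoc_inv R.toRightComoduleAlgebra (lC₁ k H M C)
    (lC₂ k H M C) (onL (C ⊗[k] C) l) u) (hat₂ Q l (sC₁ Q M C) (sC₂ Q M C)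
      (𝒞.comul.lTensor M ∘ₗ r) (↑R.Φl⁻¹ : H ⊗[k] (H ⊗[k] A)) m)
  have e2 : (↑R.Φl⁻¹ : H ⊗[k] (H ⊗[k] A)) * onSecond H R.lcoact (R.lcoact u) =
      onFirst Q.comul A (R.lcoact u) * (↑R.Φl⁻¹ : H ⊗[k] (H ⊗[k] A)) := by
    rw [Units.inv_mul_eq_iff_eq_mul, ← mul_assoc, ← R.lcoassoc, Units.mul_inv_cancel_right]
  rw [hat₂_coassocRight, e2, hat₂_comul_mul Q R 𝒞 l hr, coassocRight]
  exact e.symm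

/-- The place where `pElem_comul` is used: it rewrites $\Phi_\lambda^{-1}$ times `pElem₂` so that
only $\underline\Delta$ of $F(m)$ remains. -/
theorem hat₂_coassocRight_pElem₂
    (hr : ∀ u m, (onL C l ◁ lC k H M C) u (r m) = hat Q (sC Q M C) l r (R.lcoact u) m) (m : M) :
    hat₂ Q l (sC₁ Q M C) (sC₂ Q M C) (coassocRight Q R 𝒞 l r)
      (pElem₂ Q R.toLeftComoduleAlgebra) m =
    pl (onL (C ⊗[k] C) l) (pl (lC₁ k H M C) (lC₂ k H M C)) (↑R.Φr⁻¹ : A ⊗[k] (H ⊗[k] H))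
      (pl (sC₂ Q M C) (pl (sC₁ Q M C) (onL (C ⊗[k] C) l ◁ (lC₁ k H M C ⋆ lC₂ k H M C))) R.Φl
        (pl (sC₂ Q M C) (sC₁ Q M C) Q.twistInv (𝒞.comul.lTensor M
          (hat Q (sC Q M C) l r (pElem Q R.toLeftComoduleAlgebra) m)))) := by
  rw [hat₂_coassocRight, ← hat₂_comul, ← pl_lid_lid_lid, ← pElem_comul]
  congr 1
  have i1 := fun x v => hat₂_rinv_snd Q l (sC₁ Q M C) (sC₂ Q M C) (𝒞.comul.lTensor M ∘ₗ r) x v m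
  have i2 := fun x v => hat₂_rinv_fst Q l (sC₁ Q M C) (sC₂ Q M C) (𝒞.comul.lTensor M ∘ₗ r) x v m
  have i3 : ∀ u v, hat₂ Q l (sC₁ Q M C) (sC₂ Q M C) (𝒞.comul.lTensor M ∘ₗ r)
      (((onL (H ⊗[k] A) (lid k H) ⋆ onR H (onL A (lid k H))) ▷ onR H (onR H (lid k A))) u v) m =
      (onL (C ⊗[k] C) l ◁ (lC₁ k H M C ⋆ lC₂ k H M C)) u
        (hat₂ Q l (sC₁ Q M C) (sC₂ Q M C) (𝒞.comul.lTensor M ∘ₗ r) v m) := fun u v => by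
    rw [← hat₂_comul_mul Q R 𝒞 l hr, conv_apply, ← pl_onFirst, pl_lid_lid_lid]
  refine (pl_intertwine_end (J := (hat₂ Q l (sC₁ Q M C) (sC₂ Q M C)
    (𝒞.comul.lTensor M ∘ₗ r)).flip m) i1 (pl_intertwine_end i2 i3) _ _).trans ?_
  congr 1
  exact pl_intertwine_end (J := (hat₂ Q l (sC₁ Q M C) (sC₂ Q M C)
    (𝒞.comul.lTensor M ∘ₗ r)).flip m) i1 i2 _ _

/-- The map `h ⊗ t ↦ s₁(S(h)) ∘ (r ⊗ id) ∘ t`. -/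
def onFstHat (r : M →ₗ[k] M ⊗[k] C) :
    H ⊗[k] (A ⊗[k] H) →ₗ[k] M ⊗[k] C →ₗ[k] M ⊗[k] (C ⊗[k] C) :=
  hatBy Q (sC₁ Q M C) (LinearMap.llcomp k _ _ _ (onFst r) ∘ₗ pl (onL C l) (lC k H M C))

@[simp] theorem onFstHat_tmul (h : H) (t : A ⊗[k] H) (v : M ⊗[k] C) :
    onFstHat Q l r (h ⊗ₜ t) v =
      sC₁ Q M C (Q.S h) (onFst r (pl (onL C l) (lC k H M C) t v)) := rfl

theorem onFstHat_mul_tmul (y : H ⊗[k] (A ⊗[k] H)) (h : H) (t : A ⊗[k] H) (v : M ⊗[k] C) :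
    onFstHat Q l r (y * (h ⊗ₜ t)) v =
      sC₁ Q M C (Q.S h) (onFstHat Q l r y (pl (onL C l) (lC k H M C) t v)) := by
  induction y using TensorProduct.induction_on with
  | zero => simp
  | add s₁ s₂ h₁ h₂ => simp only [map_add, add_mul, LinearMap.add_apply, h₁, h₂]
  | tmul z x =>
    rw [Algebra.TensorProduct.tmul_mul_tmul, onFstHat_tmul, onFstHat_tmul, Q.S_mul, IsRep.map_mul,
      IsRep.map_mul]
    rfl

theorem onFstHat_rinv (h : H) (t : H ⊗[k] (A ⊗[k] H)) (v : M ⊗[k] C) :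
    onFstHat Q l r (onL (A ⊗[k] H) (rinv Q) h t) v = sC₁ Q M C h (onFstHat Q l r t v) :=
  hatBy_rinv Q _ _ h t v

theorem onFstHat_sC (h : H) (t : H ⊗[k] (A ⊗[k] H)) (v : M ⊗[k] C) :
    onFstHat Q l r t (sC Q M C h v) = sC₂ Q M C h (onFstHat Q l r t v) := by
  induction t using TensorProduct.induction_on with
  | zero => simp
  | add s₁ s₂ h₁ h₂ => simp only [map_add, LinearMap.add_apply, h₁, h₂]
  | tmul z x =>
    rw [onFstHat_tmul, onFstHat_tmul, Cmm.apply (f := pl (onL C l) (lC k H M C)) (g := sC Q M C),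
      onFst_onR, Cmm.apply (f := sC₁ Q M C)]

theorem onFstHat_lC (h : H) (t : H ⊗[k] (A ⊗[k] H)) (v : M ⊗[k] C) :
    onFstHat Q l r (onR H (onR A (lid k H)) h t) v = lC₂ k H M C h (onFstHat Q l r t v) := by
  induction t using TensorProduct.induction_on with
  | zero => simp
  | add s₁ s₂ h₁ h₂ => simp only [map_add, LinearMap.add_apply, h₁, h₂]
  | tmul z x =>
    rw [onR_tmul, onR_lid_apply, onFstHat_tmul, onFstHat_tmul, IsRep.map_mul, pl_one_tmul,
      Module.End.mul_apply, onFst_onR, Cmm.apply (f := sC₁ Q M C)]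

/-- The compatibility of `r` lets $\lambda(u)$, acting on the parameter, come out as an action
through $\rho$ on the first factor `C`. -/
theorem onFstHat_lco
    (hr : ∀ u m, (onL C l ◁ lC k H M C) u (r m) = hat Q (sC Q M C) l r (R.lcoact u) m)
    (u : A) (t : H ⊗[k] (A ⊗[k] H)) (v : M ⊗[k] C) :
    onFstHat Q l r ((onL (A ⊗[k] H) (lid k H) ▷ onR H (onL H (lid k A))) u t) v =
      (onL (C ⊗[k] C) l ◁ lC₁ k H M C) u (onFstHat Q l r t v) := by
  have h0 (y : H ⊗[k] A) (h : H) (t : A ⊗[k] H) :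
      onFstHat Q l r (pl (onL (A ⊗[k] H) (lid k H)) (onR H (onL H (lid k A))) y (h ⊗ₜ t)) v =
      sC₁ Q M C (Q.S h) (hat Q (sC₁ Q M C) (onL C l) (onFst r) y
        (pl (onL C l) (lC k H M C) t v)) := by
    induction y using TensorProduct.induction_on with
    | zero => simp
    | add s₁ s₂ h₁ h₂ => simp only [map_add, LinearMap.add_apply, h₁, h₂]
    | tmul z a =>
      rw [pl_tmul, Module.End.mul_apply, onR_tmul, onL_tmul, onL_lid_apply, onFstHat_tmul,
        hat_tmul, IsRep.map_mul, lop_apply, LinearMap.id_apply, Q.S_mul,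
        IsRep.map_mul, pl_tmul, IsRep.map_one, mul_one]
      rfl
  induction t using TensorProduct.induction_on with
  | zero => simp
  | add s₁ s₂ h₁ h₂ => simp only [map_add, LinearMap.add_apply, h₁, h₂]
  | tmul z x =>
    rw [conv_apply, h0, ← onFst_compat Q R l hr, onFstHat_tmul,
      Cmm.apply (f := sC₁ Q M C)]

/-- The left hand side of the coassociativity of a Yetter-Drinfeld module. -/
def coassocLeft (r : M →ₗ[k] M ⊗[k] C) : M →ₗ[k] M ⊗[k] (C ⊗[k] C) :=
  onFstHat Q l r (↑R.Φlr⁻¹ : H ⊗[k] (A ⊗[k] H)) ∘ₗ r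

theorem hat₂_coassocLeft_tmul (h : H) (t : H ⊗[k] A) (m : M) :
    hat₂ Q l (sC₁ Q M C) (sC₂ Q M C) (coassocLeft Q R l r) (h ⊗ₜ t) m =
      sC₁ Q M C (Q.S h) (onFstHat Q l r (↑R.Φlr⁻¹ : H ⊗[k] (A ⊗[k] H))
        (hat Q (sC Q M C) l r t m)) := by
  rw [hat₂_tmul]
  congr 1
  induction t using TensorProduct.induction_on with
  | zero => simp
  | add s₁ s₂ h₁ h₂ => simp only [map_add, LinearMap.add_apply, h₁, h₂]
  | tmul z a => rw [hat_tmul, hat_tmul, onFstHat_sC]; rfl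

/-- Used twice: with `t = 1` it gives the compatibility of the left side, and with `y` and `t` both
equal to $p$ it gives its value at `pElem₂`. -/
theorem hat₂_coassocLeft
    (hr : ∀ u m, (onL C l ◁ lC k H M C) u (r m) = hat Q (sC Q M C) l r (R.lcoact u) m)
    (y t : H ⊗[k] A) (m : M) :
    hat₂ Q l (sC₁ Q M C) (sC₂ Q M C) (coassocLeft Q R l r)
      ((LinearMap.mulRight k t ∘ₗ R.lcoact.toLinearMap).lTensor H y) m =
    onFstHat Q l r ((↑R.Φlr⁻¹ : H ⊗[k] (A ⊗[k] H)) * onSecond H R.rcoact y)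
      (hat Q (sC Q M C) l r t m) := by
  induction y using TensorProduct.induction_on with
  | zero => simp
  | add s₁ s₂ h₁ h₂ => simp only [map_add, mul_add, LinearMap.add_apply, h₁, h₂]
  | tmul h u =>
    have e := hat_lid Q R.toLeftComoduleAlgebra (sC Q M C) l (onL C l ◁ lC k H M C) hr u t m
    rw [conv, pl_onL_onR_lid] at e
    change hat Q (sC Q M C) l r (R.lcoact u * t) m = _ at e
    rw [LinearMap.lTensor_tmul, hat₂_coassocLeft_tmul]
    change sC₁ Q M C (Q.S h) (onFstHat Q l r (↑R.Φlr⁻¹ : H ⊗[k] (A ⊗[k] H))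
        (hat Q (sC Q M C) l r (R.lcoact u * t) m)) =
      onFstHat Q l r ((↑R.Φlr⁻¹ : H ⊗[k] (A ⊗[k] H)) * (h ⊗ₜ R.rcoact u)) _
    rw [e, onFstHat_mul_tmul]
    rfl

theorem coassocLeft_compat
    (hr : ∀ u m, (onL C l ◁ lC k H M C) u (r m) = hat Q (sC Q M C) l r (R.lcoact u) m)
    (u : A) (m : M) :
    ((onL (C ⊗[k] C) l ◁ lC₁ k H M C) ◁ lC₂ k H M C) u (coassocLeft Q R l r m) =
      hat₂ Q l (sC₁ Q M C) (sC₂ Q M C) (coassocLeft Q R l r)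
        (onSecond H R.lcoact (R.lcoact u)) m := by
  have e := hat₂_coassocLeft Q R l hr (R.lcoact u) 1 m
  have e2 : (↑R.Φlr⁻¹ : H ⊗[k] (A ⊗[k] H)) * onSecond H R.rcoact (R.lcoact u) =
      onFirst R.lcoact H (R.rcoact u) * (↑R.Φlr⁻¹ : H ⊗[k] (A ⊗[k] H)) := by
    rw [Units.inv_mul_eq_iff_eq_mul, ← mul_assoc, R.quasi_comm, Units.mul_inv_cancel_right]
  have e3 : LinearMap.mulRight k (1 : H ⊗[k] A) ∘ₗ R.lcoact.toLinearMap =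
    R.lcoact.toLinearMap := by ext; simp
  rw [e2, e3, hat_one, ← pl_lid_lid_lid, pl_onFirst] at e
  refine Eq.trans ?_ e.symm
  exact (conv_intertwine_end (J := (onFstHat Q l r).flip (r m))
    (fun u t => onFstHat_lco Q R l hr u t (r m)) (fun h t => onFstHat_lC Q l h t (r m)) u
      (↑R.Φlr⁻¹ : H ⊗[k] (A ⊗[k] H))).symm

theorem onSecond_pElem : onSecond H R.rcoact (pElem Q R.toLeftComoduleAlgebra) =
    pl (onL (A ⊗[k] H) (rinv Q)) (pl (onL (A ⊗[k] H) (lid k H))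
      (onR H (onL H (lid k A)) ◁ onR H (onR A (lid k H)))) R.Φl (Q.S.symm Q.β ⊗ₜ 1) := by
  have e := pl_intertwine_end (J := R.rcoact.toLinearMap.lTensor H) (f := onL A (rinv Q))
      (f' := onL (A ⊗[k] H) (rinv Q)) (g := pl (onL A (lid k H)) (onR H (lid k A)))
      (g' := pl (onL (A ⊗[k] H) (lid k H))
        (onR H (onL H (lid k A)) ◁ onR H (onR A (lid k H)))) (fun x v => LinearMap.congr_fun
        (show R.rcoact.toLinearMap.lTensor H ∘ₗ onL A (rinv Q) x = onL (A ⊗[k] H) (rinv Q) x ∘ₗ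
          R.rcoact.toLinearMap.lTensor H from TensorProduct.ext' fun _ _ => rfl) v)
      (pl_intertwine_end (fun x v => LinearMap.congr_fun
        (show R.rcoact.toLinearMap.lTensor H ∘ₗ onL A (lid k H) x = onL (A ⊗[k] H) (lid k H) x ∘ₗ
          R.rcoact.toLinearMap.lTensor H from TensorProduct.ext' fun _ _ => rfl) v)
        (fun x v => by
          rw [conv, ← onR_pl, pl_onL_onR_lid]
          exact LinearMap.congr_fun (show R.rcoact.toLinearMap.lTensor H ∘ₗ onR H (lid k A) x =
            onR H (lid k (A ⊗[k] H) ∘ₗ R.rcoact.toLinearMap) x ∘ₗ R.rcoact.toLinearMap.lTensor H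
            from TensorProduct.ext' fun _ _ => by simp) v)) R.Φl (Q.S.symm Q.β ⊗ₜ 1)
  refine e.trans ?_
  simp

/-- `pl_Φlr_inv_of_kill`, applied to the invariant vector $S^{-1}(\beta)\otimes1$, brings
$\Phi_{\lambda,\rho}$ to the outside; what is left inside is $F$ on the first factor. -/
theorem onFstHat_onSecond_pElem
    (hr : ∀ u m, (onL C l ◁ lC k H M C) u (r m) = hat Q (sC Q M C) l r (R.lcoact u) m)
    (v : M ⊗[k] C) :
    onFstHat Q l r ((↑R.Φlr⁻¹ : H ⊗[k] (A ⊗[k] H)) *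
      onSecond H R.rcoact (pElem Q R.toLeftComoduleAlgebra)) v =
    pl (sC₁ Q M C) (pl (onL (C ⊗[k] C) l ◁ lC₁ k H M C) (lC₂ k H M C)) R.Φlr
      (onFst (hat Q (sC Q M C) l r (pElem Q R.toLeftComoduleAlgebra)) v) := by
  rw [← pl_lid_lid_lid, onSecond_pElem, pl_Φlr_inv_of_kill]
  · refine (pl_intertwine_end (J := (onFstHat Q l r).flip v)
      (fun x t => onFstHat_rinv Q l x t v) (pl_intertwine_end
      (fun u t => onFstHat_lco Q R l hr u t v) (fun h t => onFstHat_lC Q l h t v)) _ _).trans ?_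
    congr 1
    rw [← hat_onFst]
    have e := pl_intertwine_end (J := ((TensorProduct.mk k A H).flip 1).lTensor H)
      (f := onL A (rinv Q))
      (f' := onL (A ⊗[k] H) (rinv Q)) (g := pl (onL A (lid k H)) (onR H (lid k A)))
      (g' := pl (onL (A ⊗[k] H) (lid k H)) (onR H (onL H (lid k A))))
      (fun x v => LinearMap.congr_fun
        (show ((TensorProduct.mk k A H).flip 1).lTensor H ∘ₗ onL A (rinv Q) x =
          onL (A ⊗[k] H) (rinv Q) x ∘ₗ
          ((TensorProduct.mk k A H).flip 1).lTensor H from TensorProduct.ext' fun _ _ => rfl) v)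
      (pl_intertwine_end (fun x v => LinearMap.congr_fun
        (show ((TensorProduct.mk k A H).flip 1).lTensor H ∘ₗ onL A (lid k H) x =
          onL (A ⊗[k] H) (lid k H) x ∘ₗ
          ((TensorProduct.mk k A H).flip 1).lTensor H from TensorProduct.ext' fun _ _ => rfl) v)
        (fun x v => LinearMap.congr_fun
        (show ((TensorProduct.mk k A H).flip 1).lTensor H ∘ₗ onR H (lid k A) x =
          onR H (onL H (lid k A)) x ∘ₗ
          ((TensorProduct.mk k A H).flip 1).lTensor H from TensorProduct.ext' fun _ _ => rfl) v))
      R.Φl (Q.S.symm Q.β ⊗ₜ 1)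
    rw [LinearMap.lTensor_tmul] at e
    change _ = pl (onL (A ⊗[k] H) (rinv Q)) (pl (onL (A ⊗[k] H) (lid k H))
      (onR H (onL H (lid k A)))) R.Φl (Q.S.symm Q.β ⊗ₜ 1) at e
    rw [LinearMap.flip_apply, ← e]
    change onFstHat Q l r (((TensorProduct.mk k A H).flip 1).lTensor H
      (pElem Q R.toLeftComoduleAlgebra)) v = _
    induction pElem Q R.toLeftComoduleAlgebra using TensorProduct.induction_on with
    | zero => simp
    | add s₁ s₂ h₁ h₂ => simp only [map_add, LinearMap.add_apply, h₁, h₂]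
    | tmul h a => simp [IsRep.map_one]
  · exact pElem_kill Q _

theorem pElem₂_eq (L : LeftComoduleAlgebra Q.toQuasiBialgebra A) : pElem₂ Q L =
    (LinearMap.mulRight k (pElem Q L) ∘ₗ L.lcoact.toLinearMap).lTensor H (pElem Q L) := by
  set J := (LinearMap.mulRight k (pElem Q L) ∘ₗ L.lcoact.toLinearMap).lTensor H with hJ
  have e := pl_intertwine_end (J := J) (f := onL A (rinv Q)) (f' := onL (H ⊗[k] A) (rinv Q))
    (g := pl (onL A (lid k H)) (onR H (lid k A)))
    (g' := pl (onL (H ⊗[k] A) (lid k H))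
      (conv L.lcoact (onR H (onL A (lid k H))) (onR H (onR H (lid k A)))))
    (fun x v => LinearMap.congr_fun (show J ∘ₗ onL A (rinv Q) x = onL (H ⊗[k] A) (rinv Q) x ∘ₗ J
      from TensorProduct.ext' fun _ _ => rfl) v)
    (pl_intertwine_end (fun x v => LinearMap.congr_fun
      (show J ∘ₗ onL A (lid k H) x = onL (H ⊗[k] A) (lid k H) x ∘ₗ J
        from TensorProduct.ext' fun _ _ => rfl) v)
      (fun x v => by
        rw [conv_onR, conv, pl_onL_onR_lid]
        exact LinearMap.congr_fun (show J ∘ₗ onR H (lid k A) x =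
          onR H (lid k (H ⊗[k] A) ∘ₗ L.lcoact.toLinearMap) x ∘ₗ J
          from TensorProduct.ext' fun _ _ => by simp [hJ, mul_assoc]) v)) L.Φl
    (Q.S.symm Q.β ⊗ₜ 1)
  refine Eq.trans ?_ e.symm
  rw [pElem₂, hJ]
  simp

theorem hat₂_coassocLeft_pElem₂
    (hr : ∀ u m, (onL C l ◁ lC k H M C) u (r m) = hat Q (sC Q M C) l r (R.lcoact u) m) (m : M) :
    hat₂ Q l (sC₁ Q M C) (sC₂ Q M C) (coassocLeft Q R l r)
      (pElem₂ Q R.toLeftComoduleAlgebra) m =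
    pl (sC₁ Q M C) (pl (onL (C ⊗[k] C) l ◁ lC₁ k H M C) (lC₂ k H M C)) R.Φlr
      (onFst (hat Q (sC Q M C) l r (pElem Q R.toLeftComoduleAlgebra))
        (hat Q (sC Q M C) l r (pElem Q R.toLeftComoduleAlgebra) m)) := by
  rw [pElem₂_eq, hat₂_coassocLeft Q R l hr, onFstHat_onSecond_pElem Q R l hr]

/-- The coassociativity of a Yetter-Drinfeld module in terms of `m ↦ (p² · m)₀ ⊗ (p² · m)₁ · p¹`. -/
theorem coassocLeft_eq_iff
    (hr : ∀ u m, (onL C l ◁ lC k H M C) u (r m) = hat Q (sC Q M C) l r (R.lcoact u) m) :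
    (∀ m, coassocLeft Q R l r m = coassocRight Q R 𝒞 l r m) ↔
    ∀ m, onFst (hat Q (sC Q M C) l r (pElem Q R.toLeftComoduleAlgebra))
        (hat Q (sC Q M C) l r (pElem Q R.toLeftComoduleAlgebra) m) =
      (coringOp Q R (sC₂ Q M C) (sC₁ Q M C) (lC₁ k H M C) (lC₂ k H M C) (onL (C ⊗[k] C) l) *
        pl (sC₂ Q M C) (sC₁ Q M C) Q.twistInv)
      (𝒞.comul.lTensor M (hat Q (sC Q M C) l r (pElem Q R.toLeftComoduleAlgebra) m)) := by
  -- Both sides are compatible with the iterated coaction, so they agree if and only if their values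
  -- at `pElem₂` do.
  rw [← LinearMap.ext_iff, eq_iff_hat₂ Q R.toLeftComoduleAlgebra l
    ((onL (C ⊗[k] C) l ◁ lC₁ k H M C) ◁ lC₂ k H M C) (sC₁ Q M C) (sC₂ Q M C)
    (coassocLeft_compat Q R l hr) (coassocRight_compat Q R 𝒞 l hr), LinearMap.ext_iff]
  refine forall_congr' fun m => ?_
  rw [hat₂_coassocLeft_pElem₂ Q R l hr, hat₂_coassocRight_pElem₂ Q R 𝒞 l hr]
  have e1 := LinearMap.congr_fun (IsRep.map_units (pl (sC₁ Q M C)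
    (pl (onL (C ⊗[k] C) l ◁ lC₁ k H M C) (lC₂ k H M C))) R.Φlr)
  have e2 := LinearMap.congr_fun (IsRep.map_units_inv (pl (sC₁ Q M C)
    (pl (onL (C ⊗[k] C) l ◁ lC₁ k H M C) (lC₂ k H M C))) R.Φlr)
  simp only [Module.End.mul_apply, Module.End.one_apply] at e1 e2
  simp only [coringOp, Module.End.mul_apply]
  -- The two conditions differ by the invertible operator $\Phi_{\lambda,\rho}$.
  constructor
  · intro h
    rw [← h, e2]
  · intro h
    rw [h, e1]

end YD

/-! ### The isomorphism $(C\otimes A)\otimes_AN\cong N\otimes C$ -/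

section Untensor

variable {k A C N N' : Type*} [Field k] [Ring A] [Algebra k A] [AddCommGroup C] [Module k C]
  [AddCommGroup N] [Module k N] [AddCommGroup N'] [Module k N']

/-- The operators of right multiplication on the factor `A` of `C ⊗ A`. -/
def rmul (k A C : Type*) [Field k] [Ring A] [Algebra k A] [AddCommGroup C] [Module k C] :
    A →ₗ[k] Module.End k (C ⊗[k] A) := onR C (LinearMap.mul k A).flip

@[simp] theorem rmul_tmul (a : A) (c : C) (u : A) :
    rmul k A C a (c ⊗ₜ u) = c ⊗ₜ (u * a) := rfl

theorem BTensor.add_tmul {M : Type*} [AddCommGroup M] [Module k M] (r : A → Module.End k M)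
    (l : A → Module.End k N) (x y : M) (n : N) :
    BTensor.tmul r l (x + y) n = BTensor.tmul r l x n + BTensor.tmul r l y n := by
  rw [BTensor.tmul, TensorProduct.add_tmul, map_add]

theorem BTensor.zero_tmul {M : Type*} [AddCommGroup M] [Module k M] (r : A → Module.End k M)
    (l : A → Module.End k N) (n : N) : BTensor.tmul r l 0 n = 0 := by
  rw [BTensor.tmul, TensorProduct.zero_tmul, map_zero]

variable (l : A →ₗ[k] Module.End k N) [IsRep l]

/-- The map `(c ⊗ u) ⊗ n ↦ l(u) n ⊗ c`. -/
def contractMap : (C ⊗[k] A) ⊗[k] N →ₗ[k] N ⊗[k] C :=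
  (TensorProduct.comm k C N).toLinearMap ∘ₗ (TensorProduct.lift l).lTensor C ∘ₗ
    (TensorProduct.assoc k C A N).toLinearMap

@[simp] theorem contractMap_tmul (c : C) (u : A) (n : N) :
    contractMap l ((c ⊗ₜ u) ⊗ₜ n) = l u n ⊗ₜ c := rfl

theorem contractMap_balanced (x : C ⊗[k] A) (a : A) (n : N) :
    contractMap l (rmul k A C a x ⊗ₜ n) = contractMap l (x ⊗ₜ l a n) := by
  induction x using TensorProduct.induction_on with
  | zero => simp
  | add s₁ s₂ h₁ h₂ => simp only [map_add, TensorProduct.add_tmul, h₁, h₂]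
  | tmul c u => simp [IsRep.map_mul]

/-- The isomorphism `(C ⊗ A) ⊗_A N → N ⊗ C`, `(c ⊗ u) ⊗ n ↦ l(u) n ⊗ c`. -/
def untensor : BTensor (fun a : A => rmul k A C a) (fun a => l a) ≃ₗ[k] N ⊗[k] C :=
  LinearEquiv.ofLinearMap (BTensor.lift (contractMap l) (contractMap_balanced l))
    (BTensor.mk _ _ ∘ₗ ((TensorProduct.mk k C A).flip 1).rTensor N ∘ₗ
      (TensorProduct.comm k N C).toLinearMap)
    (TensorProduct.ext' fun n c => by
      change contractMap l ((c ⊗ₜ 1) ⊗ₜ n) = _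
      rw [contractMap_tmul, IsRep.map_one]; rfl)
    (BTensor.hom_ext fun x n => by
      change BTensor.mk _ _ (((TensorProduct.mk k C A).flip 1).rTensor N
        (TensorProduct.comm k N C (contractMap l (x ⊗ₜ n)))) = BTensor.tmul _ _ x n
      induction x using TensorProduct.induction_on with
      | zero => rw [BTensor.zero_tmul]; simp
      | add s₁ s₂ h₁ h₂ =>
        rw [TensorProduct.add_tmul, map_add, map_add, map_add, map_add, h₁, h₂,
          BTensor.add_tmul]
      | tmul c u =>
        change BTensor.tmul (fun a : A => rmul k A C a) (fun a => l a) (c ⊗ₜ 1) (l u n) = _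
        rw [← BTensor.tmul_balanced, rmul_tmul, one_mul])

theorem untensor_tmul (x : C ⊗[k] A) (n : N) :
    untensor l (BTensor.tmul _ _ x n) = contractMap l (x ⊗ₜ n) := rfl

theorem untensor_mk (x : (C ⊗[k] A) ⊗[k] N) :
    untensor l (BTensor.mk _ _ x) = contractMap l x := rfl

/-- Induction principle for `(C ⊗ A) ⊗_A N`. -/
theorem untensor_induction {p : BTensor (fun a : A => rmul k A C a) (fun a => l a) → Prop}
    (y : BTensor (fun a : A => rmul k A C a) (fun a => l a)) (h0 : p 0)
    (hadd : ∀ y z, p y → p z → p (y + z))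
    (h : ∀ c n, p (BTensor.tmul _ _ (c ⊗ₜ 1) n)) : p y := by
  rw [← (untensor l).symm_apply_apply y]
  induction untensor l y using TensorProduct.induction_on with
  | zero => rwa [map_zero]
  | add s₁ s₂ h₁ h₂ => rw [map_add]; exact hadd _ _ h₁ h₂
  | tmul n c => exact h c n

theorem untensor_mapRight (l' : A →ₗ[k] Module.End k N') [IsRep l'] (g : N →ₗ[k] N')
    (hg : ∀ a n, g (l a n) = l' a (g n))
    (y : BTensor (fun a : A => rmul k A C a) (fun a => l a)) :
    untensor l' (BTensor.mapRight _ g hg y) = g.rTensor C (untensor l y) := by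
  induction y using untensor_induction with
  | h0 => simp
  | hadd y z hy hz => simp only [map_add, hy, hz]
  | h c n =>
    change contractMap l' ((c ⊗ₜ 1) ⊗ₜ g n) = _
    rw [untensor_tmul, contractMap_tmul, contractMap_tmul, IsRep.map_one, IsRep.map_one]
    rfl

end Untensor

/-! ### The bimodule $C\otimes A$ and iterated tensor products over $A$ -/

section LeftAction

variable {k H A C : Type*} [Field k] [Ring H] [Algebra k H] [Ring A] [Algebra k A]
  [AddCommGroup C] [Module k C] [Module H C] [IsScalarTower k H C] [Module Hᵐᵒᵖ C]
  [IsScalarTower k Hᵐᵒᵖ C] [SMulCommClass H Hᵐᵒᵖ C] (Q : QuasiHopfAlgebra k H)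
  (R : BicomoduleAlgebra Q.toQuasiBialgebra A)

local infixl:75 " ⋆ " => conv (QuasiBialgebra.comul (QuasiHopfAlgebra.toQuasiBialgebra Q))
local infixr:75 " ▷ " => conv (LeftComoduleAlgebra.lcoact (BicomoduleAlgebra.toLeftComoduleAlgebra R))
local infixl:75 " ◁ " => conv (RightComoduleAlgebra.rcoact (BicomoduleAlgebra.toRightComoduleAlgebra R))

/-- `H` acting on the left on the factor `C` of `C ⊗ A`. -/
abbrev lX (k H A C : Type*) [Field k] [Ring H] [Algebra k H] [Ring A] [Algebra k A]
    [AddCommGroup C] [Module k C] [Module H C] [IsScalarTower k H C] :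
    H →ₗ[k] Module.End k (C ⊗[k] A) := onL A (lrep k H C)

/-- `H` acting through `S⁻¹` on the right on the factor `C` of `C ⊗ A`. -/
abbrev sX (A C : Type*) [Ring A] [Algebra k A] [AddCommGroup C] [Module k C] [Module Hᵐᵒᵖ C]
    [IsScalarTower k Hᵐᵒᵖ C] : H →ₗ[k] Module.End k (C ⊗[k] A) := onL A (srep Q C)

/-- `A` acting by left multiplication on the factor `A` of `C ⊗ A`. -/
abbrev aX (k A C : Type*) [Field k] [Ring A] [Algebra k A] [AddCommGroup C] [Module k C] :
    A →ₗ[k] Module.End k (C ⊗[k] A) := onR C (lid k A)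

instance : Cmm (rmul k A C) (aX k A C) :=
  ⟨fun x y => TensorProduct.ext' fun c u => by simp [mul_assoc]⟩

instance {X : Type*} [Ring X] [Algebra k X] (f : X →ₗ[k] Module.End k C) :
    Cmm (rmul k A C) (onL A f) :=
  ⟨fun x y => TensorProduct.ext' fun c u => by simp⟩

/-- The left action of `A` on `C ⊗ A`. -/
def leftX (C : Type*) [AddCommGroup C] [Module k C] [Module H C] [IsScalarTower k H C]
    [Module Hᵐᵒᵖ C] [IsScalarTower k Hᵐᵒᵖ C] [SMulCommClass H Hᵐᵒᵖ C] :
    A →ₗ[k] Module.End k (C ⊗[k] A) := sX Q A C ▷ (aX k A C ◁ lX k H A C)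

instance : IsRep (leftX Q R C) := inferInstanceAs (IsRep (sX Q A C ▷ (aX k A C ◁ lX k H A C)))

instance : Cmm (rmul k A C) (leftX Q R C) :=
  inferInstanceAs (Cmm (rmul k A C) (sX Q A C ▷ (aX k A C ◁ lX k H A C)))

theorem leftX_rmul (a b : A) (x : C ⊗[k] A) :
    leftX Q R C a (rmul k A C b x) = rmul k A C b (leftX Q R C a x) := Cmm.apply _ _ _

theorem leftActMap_eq (c : C) (v : A) (t : H ⊗[k] (A ⊗[k] H)) :
    leftActMap Q c v t = pl (sX Q A C) (pl (aX k A C) (lX k H A C)) t (c ⊗ₜ v) := by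
  induction t using TensorProduct.induction_on with
  | zero => simp
  | add s₁ s₂ h₁ h₂ => simp only [map_add, LinearMap.add_apply, h₁, h₂]
  | tmul h t =>
    induction t using TensorProduct.induction_on with
    | zero => simp
    | add s₁ s₂ h₁ h₂ => simp only [map_add, LinearMap.add_apply, TensorProduct.tmul_add, h₁, h₂]
    | tmul a h' => rw [leftActMap_tmul]; simp

theorem leftX_tmul (u : A) (c : C) (v : A) :
    leftX Q R C u (c ⊗ₜ v) = leftActMap Q c v (onSecond H R.rcoact (R.lcoact u)) := by
  rw [leftActMap_eq, pl_onSecond]; rfl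

variable {N : Type*} [AddCommGroup N] [Module k N] (l : A →ₗ[k] Module.End k N) [IsRep l]

/-- The left action of `A` on `N ⊗ C`. -/
def leftC (C : Type*) [AddCommGroup C] [Module k C] [Module H C] [IsScalarTower k H C]
    [Module Hᵐᵒᵖ C] [IsScalarTower k Hᵐᵒᵖ C] [SMulCommClass H Hᵐᵒᵖ C] :
    A →ₗ[k] Module.End k (N ⊗[k] C) := sC Q N C ▷ (onL C l ◁ lC k H N C)

instance : IsRep (leftC Q R l C) := inferInstanceAs (IsRep (sC Q N C ▷ (onL C l ◁ lC k H N C)))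

theorem contractMap_onL {X : Type*} [Ring X] [Algebra k X] (f : X →ₗ[k] Module.End k C) (h : X)
    (x : C ⊗[k] A) (n : N) : contractMap l (onL A f h x ⊗ₜ n) =
      onR N f h (contractMap l (x ⊗ₜ n)) := by
  induction x using TensorProduct.induction_on with
  | zero => simp
  | add s₁ s₂ h₁ h₂ => simp only [map_add, TensorProduct.add_tmul, h₁, h₂]
  | tmul c u => simp

theorem contractMap_aX (a : A) (x : C ⊗[k] A) (n : N) : contractMap l (aX k A C a x ⊗ₜ n) =
      onL C l a (contractMap l (x ⊗ₜ n)) := by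
  induction x using TensorProduct.induction_on with
  | zero => simp
  | add s₁ s₂ h₁ h₂ => simp only [map_add, TensorProduct.add_tmul, h₁, h₂]
  | tmul c u => simp [IsRep.map_mul]

theorem contractMap_leftX (u : A) (x : C ⊗[k] A) (n : N) :
    contractMap l (leftX Q R C u x ⊗ₜ n) = leftC Q R l C u (contractMap l (x ⊗ₜ n)) :=
  conv_intertwine_end (J := contractMap l ∘ₗ (TensorProduct.mk k (C ⊗[k] A) N).flip n)
    (fun h x => contractMap_onL l (srep Q C) h x n) (fun u x => conv_intertwine_end
      (J := contractMap l ∘ₗ (TensorProduct.mk k (C ⊗[k] A) N).flip n)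
      (fun a x => contractMap_aX l a x n) (fun h x => contractMap_onL l (lrep k H C) h x n) u x) u x

theorem untensor_leftAct (u : A) (y : BTensor (fun a : A => rmul k A C a) (fun a => l a)) :
    untensor l (BTensor.leftAct (fun a => l a) (fun a => leftX Q R C a) (leftX_rmul Q R) u y) =
      leftC Q R l C u (untensor l y) := by
  induction y using untensor_induction with
  | h0 => simp
  | hadd y z hy hz => simp only [map_add, hy, hz]
  | h c n => exact contractMap_leftX Q R l u _ n

theorem untensor_rightAct (b : A)
    (y : BTensor (fun a : A => rmul k A C a) (fun a => leftX Q R C a)) :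
    untensor (leftX Q R C) (BTensor.rightAct (fun a => rmul k A C a) (fun a => rmul k A C a)
      (leftX_rmul Q R) b y) = onL C (rmul k A C) b (untensor (leftX Q R C) y) := by
  induction y using untensor_induction with
  | h0 => simp
  | hadd y z hy hz => simp only [map_add, hy, hz]
  | h c n =>
    change contractMap (leftX Q R C) ((c ⊗ₜ 1) ⊗ₜ rmul k A C b n) = _
    rw [untensor_tmul, contractMap_tmul, contractMap_tmul, leftX_rmul, onL_tmul]

/-- The isomorphism `(C ⊗ A) ⊗_A ((C ⊗ A) ⊗_A N) → N ⊗ C ⊗ C`. -/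
def untensor₂ : BTensor (fun a : A => rmul k A C a)
    (BTensor.leftAct (fun a => l a) (fun a => leftX Q R C a) (leftX_rmul Q R)) →ₗ[k]
      N ⊗[k] (C ⊗[k] C) :=
  (TensorProduct.assoc k N C C).toLinearMap ∘ₗ (untensor (leftC Q R l C)).toLinearMap ∘ₗ
    BTensor.mapRight _ (untensor l).toLinearMap (untensor_leftAct Q R l)

/-- Allows coassociativity, an equation in a double tensor product over `A`, to be checked in
$N\otimes C\otimes C$. -/
theorem untensor₂_injective : Function.Injective (untensor₂ Q R l (C := C)) := by
  have hinv : ∀ a z, (untensor l).symm (leftC Q R l C a z) =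
      BTensor.leftAct (fun a => l a) (fun a => leftX Q R C a) (leftX_rmul Q R) a
        ((untensor l).symm z) := fun a z => by
    rw [LinearEquiv.symm_apply_eq, untensor_leftAct, LinearEquiv.apply_symm_apply]
  refine ((TensorProduct.assoc k N C C).injective.comp
    (untensor (leftC Q R l C)).injective).comp (Function.LeftInverse.injective (g :=
      BTensor.mapRight (fun a : A => rmul k A C a) (l := fun a => leftC Q R l C a)
        (untensor l).symm.toLinearMap hinv) fun y => ?_)
  refine LinearMap.congr_fun (f := BTensor.mapRight (fun a : A => rmul k A C a)
    (l := fun a => leftC Q R l C a)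
        (untensor l).symm.toLinearMap hinv ∘ₗ BTensor.mapRight _ (untensor l).toLinearMap
          (untensor_leftAct Q R l)) (g := LinearMap.id) (BTensor.hom_ext fun x n => ?_) y
  change BTensor.tmul _ _ x ((untensor l).symm (untensor l n)) = BTensor.tmul _ _ x n
  rw [LinearEquiv.symm_apply_apply]

theorem untensor₂_mapRight (ρ : N →ₗ[k] BTensor (fun a : A => rmul k A C a) (fun a => l a))
    (hρ : ∀ a n, ρ (l a n) = BTensor.leftAct (fun a => l a) (fun a => leftX Q R C a)
      (leftX_rmul Q R) a (ρ n)) (y : BTensor (fun a : A => rmul k A C a) (fun a => l a)) :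
    untensor₂ Q R l (BTensor.mapRight _ ρ hρ y) =
      onFst ((untensor l).toLinearMap ∘ₗ ρ) (untensor l y) := by
  induction y using untensor_induction with
  | h0 => simp
  | hadd y z hy hz => simp only [map_add, hy, hz]
  | h c n =>
    change TensorProduct.assoc k N C C (contractMap (leftC Q R l C)
      ((c ⊗ₜ 1) ⊗ₜ untensor l (ρ n))) = _
    rw [untensor_tmul, contractMap_tmul, contractMap_tmul, IsRep.map_one, IsRep.map_one]
    rfl

/-- The map `((c ⊗ u) ⊗ c') ↦ l(u) n ⊗ (c ⊗ c')`. -/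
def contractFst (n : N) : (C ⊗[k] A) ⊗[k] C →ₗ[k] N ⊗[k] (C ⊗[k] C) :=
  (TensorProduct.assoc k N C C).toLinearMap ∘ₗ
    (contractMap l ∘ₗ (TensorProduct.mk k (C ⊗[k] A) N).flip n).rTensor C

theorem contractFst_tmul (n : N) (x : C ⊗[k] A) (c : C) : contractFst l n (x ⊗ₜ c) =
    TensorProduct.assoc k N C C (contractMap l (x ⊗ₜ n) ⊗ₜ c) := rfl

/-- Rebracketing becomes the contraction of the inner factor $C\otimes A$ against `n`, which
commutes with the operators that build the comultiplication. -/
theorem untensor₂_assoc (z : BTensor (fun a : A => rmul k A C a) (fun a => leftX Q R C a)) (n : N) :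
    untensor₂ Q R l (BTensor.assoc (fun a => rmul k A C a) (fun a => leftX Q R C a)
      (fun a => rmul k A C a) (leftX_rmul Q R) (fun a => l a)
      (BTensor.tmul (BTensor.rightAct (fun a => rmul k A C a) (fun a => rmul k A C a)
        (leftX_rmul Q R)) (fun a => l a) z n)) = contractFst l n (untensor (leftX Q R C) z) := by
  induction z using untensor_induction with
  | h0 => rw [BTensor.zero_tmul]; simp
  | hadd y z hy hz => rw [BTensor.add_tmul, map_add, map_add, map_add, map_add, hy, hz]
  | h c x =>
    rw [BTensor.assoc_tmul, untensor_tmul, contractMap_tmul, contractFst_tmul, IsRep.map_one]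
    change TensorProduct.assoc k N C C (contractMap (leftC Q R l C)
      ((c ⊗ₜ 1) ⊗ₜ contractMap l (x ⊗ₜ n))) = _
    rw [contractMap_tmul, IsRep.map_one]
    rfl

theorem contractFst_onL_onL {X : Type*} [Ring X] [Algebra k X] (f : X →ₗ[k] Module.End k C) (h : X)
    (y : (C ⊗[k] A) ⊗[k] C) (n : N) : contractFst l n (onL C (onL A f) h y) =
      onR N (onL C f) h (contractFst l n y) := by
  induction y using TensorProduct.induction_on with
  | zero => simp
  | add s₁ s₂ h₁ h₂ => simp only [map_add, h₁, h₂]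
  | tmul x c => rw [onL_tmul, contractFst_tmul, contractFst_tmul, contractMap_onL, assoc_onR]

theorem contractFst_aX (a : A) (y : (C ⊗[k] A) ⊗[k] C) (n : N) :
    contractFst l n (onL C (aX k A C) a y) = onL (C ⊗[k] C) l a (contractFst l n y) := by
  induction y using TensorProduct.induction_on with
  | zero => simp
  | add s₁ s₂ h₁ h₂ => simp only [map_add, h₁, h₂]
  | tmul x c => rw [onL_tmul, contractFst_tmul, contractFst_tmul, contractMap_aX, assoc_onL]

theorem contractFst_onR {X : Type*} [Ring X] [Algebra k X] (f : X →ₗ[k] Module.End k C) (h : X)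
    (y : (C ⊗[k] A) ⊗[k] C) (n : N) : contractFst l n (onR (C ⊗[k] A) f h y) =
      onR N (onR C f) h (contractFst l n y) := by
  induction y using TensorProduct.induction_on with
  | zero => simp
  | add s₁ s₂ h₁ h₂ => simp only [map_add, h₁, h₂]
  | tmul x c =>
    rw [onR_tmul, contractFst_tmul, contractFst_tmul]
    induction contractMap l (x ⊗ₜ n) using TensorProduct.induction_on with
    | zero => simp
    | add s₁ s₂ h₁ h₂ => simp only [map_add, TensorProduct.add_tmul, h₁, h₂]
    | tmul m c => simp

end LeftAction

/-! ### Naturality of the coring operator -/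

section CoringOp

variable {k H A : Type*} [Field k] [Ring H] [Algebra k H] [Ring A] [Algebra k A]
  (Q : QuasiHopfAlgebra k H) (R : BicomoduleAlgebra Q.toQuasiBialgebra A)

theorem coringOp_intertwine_end {V V' : Type*} [AddCommGroup V] [Module k V] [AddCommGroup V']
    [Module k V'] {J : V →ₗ[k] V'} {σ₂ σ₁ L₁ L₂ : H →ₗ[k] Module.End k V}
    {a : A →ₗ[k] Module.End k V} {σ₂' σ₁' L₁' L₂' : H →ₗ[k] Module.End k V'}
    {a' : A →ₗ[k] Module.End k V'}
    (h₂ : ∀ x v, J (σ₂ x v) = σ₂' x (J v)) (h₁ : ∀ x v, J (σ₁ x v) = σ₁' x (J v))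
    (hL₁ : ∀ x v, J (L₁ x v) = L₁' x (J v)) (hL₂ : ∀ x v, J (L₂ x v) = L₂' x (J v))
    (ha : ∀ x v, J (a x v) = a' x (J v)) (v : V) :
    J (coringOp Q R σ₂ σ₁ L₁ L₂ a v) = coringOp Q R σ₂' σ₁' L₁' L₂' a' (J v) := by
  simp only [coringOp, Module.End.mul_apply]
  rw [pl_intertwine_end h₁ (pl_intertwine_end (conv_intertwine_end ha hL₁) hL₂),
    pl_intertwine_end ha (pl_intertwine_end hL₁ hL₂),
    pl_intertwine_end h₂ (pl_intertwine_end h₁ (conv_intertwine_end ha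
      (conv_intertwine_end hL₁ hL₂)))]

theorem conv_onL {X Y Z V V' : Type*} [Ring X] [Algebra k X] [Ring Y] [Algebra k Y] [Ring Z]
    [Algebra k Z] [AddCommGroup V] [Module k V] [AddCommGroup V'] [Module k V']
    (φ : Z →ₐ[k] X ⊗[k] Y) (f : X →ₗ[k] Module.End k V) (g : Y →ₗ[k] Module.End k V) :
    conv φ (onL V' f) (onL V' g) = onL V' (conv φ f g) :=
  LinearMap.ext fun _ => TensorProduct.ext' fun _ _ => pl_onL _ _ _ _ _

end CoringOp

/-! ### The comultiplication of the coring and its coassociativity -/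

section Comultiplication

variable {k H A C : Type*} [Field k] [Ring H] [Algebra k H] [Ring A] [Algebra k A]
  [AddCommGroup C] [Module k C] [Module H C] [IsScalarTower k H C] [Module Hᵐᵒᵖ C]
  [IsScalarTower k Hᵐᵒᵖ C] [SMulCommClass H Hᵐᵒᵖ C] (Q : QuasiHopfAlgebra k H)
  (R : BicomoduleAlgebra Q.toQuasiBialgebra A) (𝒞 : BimoduleCoalgebra Q.toQuasiBialgebra C)

local infixl:75 " ⋆ " => conv (QuasiBialgebra.comul (QuasiHopfAlgebra.toQuasiBialgebra Q))
local infixr:75 " ▷ " => conv (LeftComoduleAlgebra.lcoact (BicomoduleAlgebra.toLeftComoduleAlgebra R))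
local infixl:75 " ◁ " => conv (RightComoduleAlgebra.rcoact (BicomoduleAlgebra.toRightComoduleAlgebra R))

theorem twist_symm_intertwine {V : Type*} [AddCommGroup V] [Module k V]
    (f g : H →ₗ[k] Module.End k V) [IsRep f] [IsRep g] [Cmm f g] (h : H) (v : V) :
    pl f g Q.twistInv ((antip Q g ⋆ antip Q f) (Q.S.symm h) v) =
      (f ⋆ g) h (pl f g Q.twistInv v) := by
  have e := LinearMap.congr_fun (twist_intertwine Q f g (Q.S.symm h)) v
  rw [LinearEquiv.apply_symm_apply] at e
  exact e.symm

/-- The map `c ⊗ u ↦ (c₁ ⊗ u) ⊗ c₂`. -/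
def splitX (A : Type*) [Ring A] [Algebra k A] : C ⊗[k] A →ₗ[k] (C ⊗[k] A) ⊗[k] C :=
  (TensorProduct.rightComm k C C A).toLinearMap ∘ₗ 𝒞.comul.rTensor A

theorem splitX_tmul (c : C) (u : A) :
    splitX Q 𝒞 A (c ⊗ₜ u) = TensorProduct.rightComm k C C A (𝒞.comul c ⊗ₜ u) := rfl

theorem rightComm_pl (f g : H →ₗ[k] Module.End k C) (t : H ⊗[k] H) (d : C ⊗[k] C) (u : A) :
    TensorProduct.rightComm k C C A (pl (onL C f) (onR C g) t d ⊗ₜ u) =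
      pl (onL C (onL A f)) (onR (C ⊗[k] A) g) t (TensorProduct.rightComm k C C A (d ⊗ₜ u)) :=
  pl_intertwine_end (J := (TensorProduct.rightComm k C C A).toLinearMap ∘ₗ
      (TensorProduct.mk k (C ⊗[k] C) A).flip u)
    (fun x d => LinearMap.congr_fun (show ((TensorProduct.rightComm k C C A).toLinearMap ∘ₗ
      (TensorProduct.mk k (C ⊗[k] C) A).flip u) ∘ₗ onL C f x = onL C (onL A f) x ∘ₗ
      ((TensorProduct.rightComm k C C A).toLinearMap ∘ₗ
      (TensorProduct.mk k (C ⊗[k] C) A).flip u) from TensorProduct.ext' fun _ _ => rfl) d)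
    (fun x d => LinearMap.congr_fun (show ((TensorProduct.rightComm k C C A).toLinearMap ∘ₗ
      (TensorProduct.mk k (C ⊗[k] C) A).flip u) ∘ₗ onR C g x = onR (C ⊗[k] A) g x ∘ₗ
      ((TensorProduct.rightComm k C C A).toLinearMap ∘ₗ
      (TensorProduct.mk k (C ⊗[k] C) A).flip u) from TensorProduct.ext' fun _ _ => rfl) d) t d

theorem splitX_lX (h : H) (x : C ⊗[k] A) : splitX Q 𝒞 A (lX k H A C h x) =
    (onL C (lX k H A C) ⋆ lC k H (C ⊗[k] A) C) h (splitX Q 𝒞 A x) := by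
  induction x using TensorProduct.induction_on with
  | zero => simp
  | add s₁ s₂ h₁ h₂ => simp only [map_add, h₁, h₂]
  | tmul c u =>
    rw [conv_apply, splitX_tmul, ← rightComm_pl, onL_tmul, splitX_tmul, lrep_apply, 𝒞.comul_smul,
      ← map₂_eq_pl]
    rfl

theorem splitX_sX (h : H) (x : C ⊗[k] A) : splitX Q 𝒞 A (sX Q A C h x) =
    (antip Q (onL C (sX Q A C)) ⋆ antip Q (sC Q (C ⊗[k] A) C)) (Q.S.symm h)
      (splitX Q 𝒞 A x) := by
  induction x using TensorProduct.induction_on with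
  | zero => simp
  | add s₁ s₂ h₁ h₂ => simp only [map_add, h₁, h₂]
  | tmul c u =>
    have e := rightComm_pl (antip Q (srep Q C)) (antip Q (srep Q C)) (Q.comul (Q.S.symm h))
      (𝒞.comul c) u
    rw [splitX_tmul, onL_tmul, splitX_tmul, srep_apply, 𝒞.comul_op_smul, ← antip_srep Q,
      map₂_eq_pl]
    exact e

theorem splitX_onR {X : Type*} [Ring X] [Algebra k X] (f : X →ₗ[k] Module.End k A) (a : X)
    (x : C ⊗[k] A) : splitX Q 𝒞 A (onR C f a x) = onL C (onR C f) a (splitX Q 𝒞 A x) := by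
  induction x using TensorProduct.induction_on with
  | zero => simp
  | add s₁ s₂ h₁ h₂ => simp only [map_add, h₁, h₂]
  | tmul c u =>
    rw [onR_tmul, splitX_tmul, splitX_tmul]
    induction 𝒞.comul c using TensorProduct.induction_on with
    | zero => simp
    | add s₁ s₂ h₁ h₂ => simp only [map_add, TensorProduct.add_tmul, h₁, h₂]
    | tmul c d => simp

/-- The comultiplication of `C ⊗ A` as a map to `(C ⊗ A) ⊗ C`. -/
def coactX : C ⊗[k] A →ₗ[k] (C ⊗[k] A) ⊗[k] C :=
  (coringOp Q R (sC Q (C ⊗[k] A) C) (onL C (sX Q A C)) (onL C (lX k H A C))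
      (lC k H (C ⊗[k] A) C) (onL C (aX k A C)) *
    pl (sC Q (C ⊗[k] A) C) (onL C (sX Q A C)) Q.twistInv) ∘ₗ splitX Q 𝒞 A

theorem coactX_apply (x : C ⊗[k] A) : coactX Q R 𝒞 x =
    coringOp Q R (sC Q (C ⊗[k] A) C) (onL C (sX Q A C)) (onL C (lX k H A C))
      (lC k H (C ⊗[k] A) C) (onL C (aX k A C))
    (pl (sC Q (C ⊗[k] A) C) (onL C (sX Q A C)) Q.twistInv (splitX Q 𝒞 A x)) := rfl

theorem onL_leftX (V' : Type*) [AddCommGroup V'] [Module k V'] : onL V' (leftX Q R C) =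
    onL V' (sX Q A C) ▷ (onL V' (aX k A C) ◁ onL V' (lX k H A C)) := by
  rw [leftX, ← conv_onL, ← conv_onL]

/-- The twist makes the split left action a convolution in all legs, and `coringOp_mul` rebrackets
it into the action on $(C\otimes A)\otimes C$. -/
theorem coactX_leftX (u : A) (x : C ⊗[k] A) : coactX Q R 𝒞 (leftX Q R C u x) =
    leftC Q R (leftX Q R C) C u (coactX Q R 𝒞 x) := by
  have e : (pl (sC Q (C ⊗[k] A) C) (onL C (sX Q A C)) Q.twistInv ∘ₗ splitX Q 𝒞 A)
      (leftX Q R C u x) =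
      ((sC Q (C ⊗[k] A) C ⋆ onL C (sX Q A C)) ▷ (onL C (aX k A C) ◁
        (onL C (lX k H A C) ⋆ lC k H (C ⊗[k] A) C))) u
      ((pl (sC Q (C ⊗[k] A) C) (onL C (sX Q A C)) Q.twistInv ∘ₗ splitX Q 𝒞 A) x) := by
    refine conv_intertwine_end (fun h v => ?_) (conv_intertwine_end (fun a v => ?_)
      (fun h v => ?_)) u x
    · rw [LinearMap.comp_apply, splitX_sX, twist_symm_intertwine]; rfl
    · rw [LinearMap.comp_apply, splitX_onR,
        Cmm.apply (f := pl (sC Q (C ⊗[k] A) C) (onL C (sX Q A C)))]; rfl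
    · rw [LinearMap.comp_apply, splitX_lX,
        Cmm.apply (f := pl (sC Q (C ⊗[k] A) C) (onL C (sX Q A C)))]; rfl
  rw [coactX_apply]
  refine (congrArg _ e).trans ?_
  rw [← Module.End.mul_apply, coringOp_mul, leftC, onL_leftX]
  rfl

theorem coactX_rmul (b : A) (x : C ⊗[k] A) : coactX Q R 𝒞 (rmul k A C b x) =
    onL C (rmul k A C) b (coactX Q R 𝒞 x) := by
  have e : splitX Q 𝒞 A (rmul k A C b x) = onL C (rmul k A C) b (splitX Q 𝒞 A x) :=
    splitX_onR Q 𝒞 _ b x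
  rw [coactX_apply, e,
    Cmm.apply (f := pl (sC Q (C ⊗[k] A) C) (onL C (sX Q A C))) (g := onL C (rmul k A C))]
  refine (coringOp_intertwine_end Q R (J := onL C (rmul k A C) b) (fun x v => ?_) (fun x v => ?_)
    (fun x v => ?_) (fun x v => ?_) (fun x v => ?_) _).symm
  all_goals exact Cmm.apply _ _ _

/-- Coassociativity of `C` carrying the factor `A` along, with the right action written through
`antip` so that it matches the $\Phi^{-1}$ in `twist_cocycle`. -/
theorem coassoc_splitX (x : C ⊗[k] A) :
    pl (onL (C ⊗[k] C) (lX k H A C)) (pl (lC₁ k H (C ⊗[k] A) C) (lC₂ k H (C ⊗[k] A) C)) Q.Φ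
      (pl (antip Q (onL (C ⊗[k] C) (sX Q A C))) (pl (antip Q (sC₁ Q (C ⊗[k] A) C))
        (antip Q (sC₂ Q (C ⊗[k] A) C))) (↑Q.Φ⁻¹ : H ⊗[k] (H ⊗[k] H))
        (onFst (splitX Q 𝒞 A) (splitX Q 𝒞 A x))) =
    𝒞.comul.lTensor (C ⊗[k] A) (splitX Q 𝒞 A x) := by
  induction x using TensorProduct.induction_on with
  | zero => simp
  | add s₁ s₂ h₁ h₂ => simp only [map_add, h₁, h₂]
  | tmul c u =>
    set J := ((TensorProduct.mk k C A).flip u).rTensor (C ⊗[k] C) with hJ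
    have jL (f : H →ₗ[k] Module.End k C) (x v) : J (onL (C ⊗[k] C) f x v) =
        onL (C ⊗[k] C) (onL A f) x (J v) :=
      LinearMap.congr_fun (show J ∘ₗ onL (C ⊗[k] C) f x = onL (C ⊗[k] C) (onL A f) x ∘ₗ J
        from TensorProduct.ext' fun _ _ => rfl) v
    have jR (f : H →ₗ[k] Module.End k (C ⊗[k] C)) (x v) : J (onR C f x v) =
        onR (C ⊗[k] A) f x (J v) :=
      LinearMap.congr_fun (show J ∘ₗ onR C f x = onR (C ⊗[k] A) f x ∘ₗ J
        from TensorProduct.ext' fun _ _ => rfl) v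
    have e := congrArg J (𝒞.coassoc c)
    have e1 : J (𝒞.comul.lTensor C (𝒞.comul c)) =
        𝒞.comul.lTensor (C ⊗[k] A) (splitX Q 𝒞 A (c ⊗ₜ u)) := by
      rw [splitX_tmul]
      induction 𝒞.comul c using TensorProduct.induction_on with
      | zero => simp
      | add s₁ s₂ h₁ h₂ => simp only [map_add, TensorProduct.add_tmul, h₁, h₂]
      | tmul c d => rfl
    have e2 : J (TensorProduct.assoc k C C C (𝒞.comul.rTensor C (𝒞.comul c))) =
        onFst (splitX Q 𝒞 A) (splitX Q 𝒞 A (c ⊗ₜ u)) := by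
      rw [splitX_tmul]
      induction 𝒞.comul c using TensorProduct.induction_on with
      | zero => simp
      | add s₁ s₂ h₁ h₂ => simp only [map_add, TensorProduct.add_tmul, h₁, h₂]
      | tmul c d =>
        rw [LinearMap.rTensor_tmul, TensorProduct.rightComm_tmul, onFst_tmul, splitX_tmul]
        induction 𝒞.comul c using TensorProduct.induction_on with
        | zero => simp
        | add s₁ s₂ h₁ h₂ => simp only [map_add, TensorProduct.add_tmul, h₁, h₂]
        | tmul c d => rfl
    rw [← antip_srep Q] at e
    have e3 := map₂_map₂_eq_pl (lrep k H C) (lrep k H C) (lrep k H C)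
      (Q.Φ : H ⊗[k] (H ⊗[k] H))
    have e4 := map₂_map₂_eq_pl (antip Q (srep Q C)) (antip Q (srep Q C)) (antip Q (srep Q C))
      (↑Q.Φ⁻¹ : H ⊗[k] (H ⊗[k] H))
    rw [e4] at e
    refine Eq.trans ?_ (e.trans e1)
    refine Eq.trans ?_ (congrArg J (LinearMap.congr_fun e3 _)).symm
    rw [pl_intertwine_end (jL _) (pl_intertwine_end (jR _) (jR _)),
      pl_intertwine_end (jL _) (pl_intertwine_end (jR _) (jR _)), e2]
    rfl

theorem onFst_coactX (v : (C ⊗[k] A) ⊗[k] C) : onFst (coactX Q R 𝒞) v =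
    coringOp Q R (sC₁ Q (C ⊗[k] A) C) (onL (C ⊗[k] C) (sX Q A C)) (onL (C ⊗[k] C) (lX k H A C))
      (lC₁ k H (C ⊗[k] A) C) (onL (C ⊗[k] C) (aX k A C))
    (pl (sC₁ Q (C ⊗[k] A) C) (onL (C ⊗[k] C) (sX Q A C)) Q.twistInv
      (onFst (splitX Q 𝒞 A) v)) := by
  induction v using TensorProduct.induction_on with
  | zero => simp
  | add s₁ s₂ h₁ h₂ => simp only [map_add, h₁, h₂]
  | tmul x c =>
    set J := (TensorProduct.assoc k (C ⊗[k] A) C C).toLinearMap ∘ₗ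
      (TensorProduct.mk k ((C ⊗[k] A) ⊗[k] C) C).flip c
    have jL (f : H →ₗ[k] Module.End k (C ⊗[k] A)) (x v) :
        J (onL C f x v) = onL (C ⊗[k] C) f x (J v) := assoc_onL f x v c
    have ja (f : A →ₗ[k] Module.End k (C ⊗[k] A)) (x v) :
        J (onL C f x v) = onL (C ⊗[k] C) f x (J v) := assoc_onL f x v c
    have jR (f : H →ₗ[k] Module.End k C) (x v) : J (onR (C ⊗[k] A) f x v) =
        onR (C ⊗[k] A) (onL C f) x (J v) := assoc_onR f x v c
    rw [onFst_tmul, onFst_tmul]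
    refine (coringOp_intertwine_end Q R (J := J) (jR _) (jL _) (jL _) (jR _) (ja _) _).trans ?_
    rw [pl_intertwine_end (J := J) (jR _) (jL _)]
    rfl

theorem onFst_splitX_onL {X : Type*} [Ring X] [Algebra k X] {f : X →ₗ[k] Module.End k (C ⊗[k] A)}
    {g : X →ₗ[k] Module.End k ((C ⊗[k] A) ⊗[k] (C ⊗[k] C))} (h : X)
    (hf : ∀ x c, TensorProduct.assoc k (C ⊗[k] A) C C (splitX Q 𝒞 A (f h x) ⊗ₜ c) =
      g h (TensorProduct.assoc k (C ⊗[k] A) C C (splitX Q 𝒞 A x ⊗ₜ c)))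
    (v : (C ⊗[k] A) ⊗[k] C) :
    onFst (splitX Q 𝒞 A) (onL C f h v) = g h (onFst (splitX Q 𝒞 A) v) := by
  induction v using TensorProduct.induction_on with
  | zero => simp
  | add s₁ s₂ h₁ h₂ => simp only [map_add, h₁, h₂]
  | tmul x c => exact hf x c

/-- Each iterate is a product of two coring operators and two twists applied to an iterated
`splitX`. The operators are compared by `coringOp_assoc`, the twists by `twist_cocycle`, and the
split vectors by `coassoc_splitX`. -/
theorem coactX_coassoc (x : C ⊗[k] A) :
    onFst (coactX Q R 𝒞) (coactX Q R 𝒞 x) =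
      (coringOp Q R (sC₂ Q (C ⊗[k] A) C) (sC₁ Q (C ⊗[k] A) C) (lC₁ k H (C ⊗[k] A) C)
          (lC₂ k H (C ⊗[k] A) C) (onL (C ⊗[k] C) (leftX Q R C)) *
        pl (sC₂ Q (C ⊗[k] A) C) (sC₁ Q (C ⊗[k] A) C) Q.twistInv)
      (𝒞.comul.lTensor (C ⊗[k] A) (coactX Q R 𝒞 x)) := by
  set τ₁ := onL (C ⊗[k] C) (sX Q A C)
  set τ₂ := sC₁ Q (C ⊗[k] A) C
  set τ₃ := sC₂ Q (C ⊗[k] A) C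
  set M₁ := onL (C ⊗[k] C) (lX k H A C)
  set M₂ := lC₁ k H (C ⊗[k] A) C
  set M₃ := lC₂ k H (C ⊗[k] A) C
  set b := onL (C ⊗[k] C) (aX k A C)
  have app {a b : Module.End k ((C ⊗[k] A) ⊗[k] (C ⊗[k] C))} (h : a = b) (v) : a v = b v := by rw [h]
  -- `J` pulls the inner coring operator through the outer split, which doubles the legs of the
  -- first factor `C`. The operator `I` below does the same for $\underline\Delta$ on the second
  -- factor.
  set J := pl τ₂ τ₁ Q.twistInv ∘ₗ onFst (splitX Q 𝒞 A)
  have j2 (h v) : J (sC Q (C ⊗[k] A) C h v) = τ₃ h (J v) := by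
    change pl τ₂ τ₁ Q.twistInv (onFst _ _) = _
    rw [onFst_onR, Cmm.apply (f := pl τ₂ τ₁)]; rfl
  have jL2 (h v) : J (lC k H (C ⊗[k] A) C h v) = M₃ h (J v) := by
    change pl τ₂ τ₁ Q.twistInv (onFst _ _) = _
    rw [onFst_onR, Cmm.apply (f := pl τ₂ τ₁)]; rfl
  have j1 (h v) : J (onL C (sX Q A C) h v) = (τ₂ ⋆ τ₁) h (J v) := by
    change pl τ₂ τ₁ Q.twistInv (onFst _ _) = _
    rw [onFst_splitX_onL Q 𝒞 (g := (antip Q τ₁ ⋆ antip Q τ₂) ∘ₗ Q.S.symm.toLinearMap) h]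
    · exact twist_symm_intertwine Q τ₂ τ₁ h _
    · intro x c
      rw [splitX_sX]
      exact pl_intertwine_end (J := (TensorProduct.assoc k (C ⊗[k] A) C C).toLinearMap ∘ₗ
        (TensorProduct.mk k ((C ⊗[k] A) ⊗[k] C) C).flip c) (fun y v => assoc_onL (sX Q A C) (Q.S y) v c)
          (fun y v => assoc_onR (srep Q C) (Q.S y) v c) _ _
  have jL1 (h v) : J (onL C (lX k H A C) h v) = (M₁ ⋆ M₂) h (J v) := by
    change pl τ₂ τ₁ Q.twistInv (onFst _ _) = _
    rw [onFst_splitX_onL Q 𝒞 (g := M₁ ⋆ M₂) h, Cmm.apply (f := pl τ₂ τ₁)]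
    · rfl
    · intro x c
      rw [splitX_lX]
      exact pl_intertwine_end (J := (TensorProduct.assoc k (C ⊗[k] A) C C).toLinearMap ∘ₗ
        (TensorProduct.mk k ((C ⊗[k] A) ⊗[k] C) C).flip c) (fun y v => assoc_onL (lX k H A C) y v c)
          (fun y v => assoc_onR (lrep k H C) y v c) _ _
  have ja (h v) : J (onL C (aX k A C) h v) = b h (J v) := by
    change pl τ₂ τ₁ Q.twistInv (onFst _ _) = _
    rw [onFst_splitX_onL Q 𝒞 (g := b) h, Cmm.apply (f := pl τ₂ τ₁)]
    · rfl
    · intro x c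
      rw [splitX_onR]
      exact assoc_onL (aX k A C) h _ c
  set I := pl τ₃ τ₂ Q.twistInv ∘ₗ 𝒞.comul.lTensor (C ⊗[k] A)
  have i2 (h v) : I (sC Q (C ⊗[k] A) C h v) = (τ₃ ⋆ τ₂) h (I v) := by
    change pl τ₃ τ₂ Q.twistInv (𝒞.comul.lTensor (C ⊗[k] A) _) = _
    rw [comul_srep]
    exact twist_symm_intertwine Q τ₃ τ₂ h _
  have iL2 (h v) : I (lC k H (C ⊗[k] A) C h v) = (M₂ ⋆ M₃) h (I v) := by
    change pl τ₃ τ₂ Q.twistInv (𝒞.comul.lTensor (C ⊗[k] A) _) = _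
    rw [comul_lrep, Cmm.apply (f := pl τ₃ τ₂)]
    rfl
  have iL (f : H →ₗ[k] Module.End k (C ⊗[k] A)) (h v) :
      I (onL C f h v) = onL (C ⊗[k] C) f h (I v) := by
    change pl τ₃ τ₂ Q.twistInv (𝒞.comul.lTensor (C ⊗[k] A) _) = _
    rw [show 𝒞.comul.lTensor (C ⊗[k] A) (onL C f h v) = onL (C ⊗[k] C) f h (𝒞.comul.lTensor (C ⊗[k] A) v) from
      LinearMap.congr_fun (show 𝒞.comul.lTensor (C ⊗[k] A) ∘ₗ onL C f h =
        onL (C ⊗[k] C) f h ∘ₗ 𝒞.comul.lTensor (C ⊗[k] A) from TensorProduct.ext' fun _ _ => rfl) v,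
      Cmm.apply (f := pl τ₃ τ₂)]
    rfl
  have ia (f : A →ₗ[k] Module.End k (C ⊗[k] A)) (h v) :
      I (onL C f h v) = onL (C ⊗[k] C) f h (I v) := by
    change pl τ₃ τ₂ Q.twistInv (𝒞.comul.lTensor (C ⊗[k] A) _) = _
    rw [show 𝒞.comul.lTensor (C ⊗[k] A) (onL C f h v) = onL (C ⊗[k] C) f h (𝒞.comul.lTensor (C ⊗[k] A) v) from
      LinearMap.congr_fun (show 𝒞.comul.lTensor (C ⊗[k] A) ∘ₗ onL C f h =
        onL (C ⊗[k] C) f h ∘ₗ 𝒞.comul.lTensor (C ⊗[k] A) from TensorProduct.ext' fun _ _ => rfl) v,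
      Cmm.apply (f := pl τ₃ τ₂)]
    rfl
  have eP := app (coringOp_assoc Q R τ₃ τ₂ τ₁ M₁ M₂ M₃ b)
  have eT := app (twist_cocycle Q τ₃ τ₂ τ₁)
  have hΦ := app (IsRep.map_units_inv (pl τ₃ (pl τ₂ τ₁)) Q.Φ)
  simp only [Module.End.mul_apply, Module.End.one_apply] at eP eT hΦ
  rw [onFst_coactX]
  change coringOp Q R τ₂ τ₁ M₁ M₂ b (J (coactX Q R 𝒞 x)) =
    coringOp Q R τ₃ τ₂ M₂ M₃ (onL (C ⊗[k] C) (leftX Q R C)) (I (coactX Q R 𝒞 x))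
  rw [coactX_apply,
    coringOp_intertwine_end Q R j2 j1 jL1 jL2 ja, pl_intertwine_end j2 j1,
    coringOp_intertwine_end Q R i2 (iL _) (iL _) iL2 (ia _), pl_intertwine_end i2 (iL _),
    onL_leftX]
  change _ = coringOp Q R τ₃ τ₂ M₂ M₃ (τ₁ ▷ (b ◁ M₁)) (coringOp Q R (τ₃ ⋆ τ₂) τ₁ M₁ (M₂ ⋆ M₃) b
    (pl (τ₃ ⋆ τ₂) τ₁ Q.twistInv (pl τ₃ τ₂ Q.twistInv
      (𝒞.comul.lTensor (C ⊗[k] A) (splitX Q 𝒞 A x)))))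
  rw [← coassoc_splitX, ← eP]
  congr 2
  change _ = pl (τ₃ ⋆ τ₂) τ₁ Q.twistInv (pl τ₃ τ₂ Q.twistInv
    (pl M₁ (pl M₂ M₃) Q.Φ (pl (antip Q τ₁) (pl (antip Q τ₂) (antip Q τ₃))
      (↑Q.Φ⁻¹ : H ⊗[k] (H ⊗[k] H)) (onFst (splitX Q 𝒞 A) (splitX Q 𝒞 A x)))))
  -- $\Phi$ on the left actions commutes with everything placed on the right actions. Once it is in
  -- front, only the cocycle identity is left.
  rw [Cmm.apply (f := pl τ₃ τ₂) (g := pl M₁ (pl M₂ M₃)),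
    Cmm.apply (f := pl (τ₃ ⋆ τ₂) τ₁) (g := pl M₁ (pl M₂ M₃)),
    Cmm.apply (f := pl τ₃ (pl τ₂ τ₁)) (g := pl M₁ (pl M₂ M₃))]
  congr 1
  change pl τ₃ (pl τ₂ τ₁) (↑Q.Φ⁻¹ : H ⊗[k] (H ⊗[k] H)) (pl τ₃ (τ₂ ⋆ τ₁) Q.twistInv
    (pl τ₂ τ₁ Q.twistInv (onFst (splitX Q 𝒞 A) (splitX Q 𝒞 A x)))) = _
  rw [← eT, hΦ]

end Comultiplication

/-! ### The counit of the coring -/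

section Counit

variable {k H A C : Type*} [Field k] [Ring H] [Algebra k H] [Ring A] [Algebra k A]
  [AddCommGroup C] [Module k C] [Module H C] [IsScalarTower k H C] [Module Hᵐᵒᵖ C]
  [IsScalarTower k Hᵐᵒᵖ C] [SMulCommClass H Hᵐᵒᵖ C] (Q : QuasiHopfAlgebra k H)
  (R : BicomoduleAlgebra Q.toQuasiBialgebra A) (𝒞 : BimoduleCoalgebra Q.toQuasiBialgebra C)

local infixr:75 " ▷ " => conv (LeftComoduleAlgebra.lcoact (BicomoduleAlgebra.toLeftComoduleAlgebra R))
local infixl:75 " ◁ " => conv (RightComoduleAlgebra.rcoact (BicomoduleAlgebra.toRightComoduleAlgebra R))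

theorem counit_S_symm (h : H) : Q.counit (Q.S.symm h) = Q.counit h := by
  rw [← counit_S, LinearEquiv.apply_symm_apply]

/-- The counit `c ⊗ u ↦ ε(c) u` of `C ⊗ A`. -/
def counitX (A : Type*) [Ring A] [Algebra k A] : C ⊗[k] A →ₗ[k] A :=
  (TensorProduct.lid k A).toLinearMap ∘ₗ 𝒞.counit.rTensor A

@[simp] theorem counitX_tmul (c : C) (u : A) : counitX Q 𝒞 A (c ⊗ₜ u) = 𝒞.counit c • u := by
  simp [counitX]

theorem counitX_rmul (x : C ⊗[k] A) (a : A) :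
    counitX Q 𝒞 A (rmul k A C a x) = counitX Q 𝒞 A x * a := by
  induction x using TensorProduct.induction_on with
  | zero => simp
  | add s₁ s₂ h₁ h₂ => simp only [map_add, add_mul, h₁, h₂]
  | tmul c u => simp

theorem counitX_lX (h : H) (x : C ⊗[k] A) : counitX Q 𝒞 A (lX k H A C h x) =
    triv Q.toQuasiBialgebra (Module.End k A) h (counitX Q 𝒞 A x) := by
  rw [triv_apply_apply]
  induction x using TensorProduct.induction_on with
  | zero => simp
  | add s₁ s₂ h₁ h₂ => simp only [map_add, smul_add, h₁, h₂]
  | tmul c u => simp [𝒞.counit_smul, mul_smul]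

theorem counitX_sX (h : H) (x : C ⊗[k] A) : counitX Q 𝒞 A (sX Q A C h x) =
    triv Q.toQuasiBialgebra (Module.End k A) h (counitX Q 𝒞 A x) := by
  rw [triv_apply_apply]
  induction x using TensorProduct.induction_on with
  | zero => simp
  | add s₁ s₂ h₁ h₂ => simp only [map_add, smul_add, h₁, h₂]
  | tmul c u => simp [𝒞.counit_op_smul, mul_smul, counit_S_symm, smul_comm (𝒞.counit c)]

theorem counitX_aX (a : A) (x : C ⊗[k] A) : counitX Q 𝒞 A (aX k A C a x) =
    lid k A a (counitX Q 𝒞 A x) := by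
  induction x using TensorProduct.induction_on with
  | zero => simp
  | add s₁ s₂ h₁ h₂ => simp only [map_add, h₁, h₂]
  | tmul c u => simp

theorem counitX_leftX (a : A) (x : C ⊗[k] A) :
    counitX Q 𝒞 A (leftX Q R C a x) = a * counitX Q 𝒞 A x := by
  have e := conv_intertwine_end (φ := R.lcoact) (counitX_sX Q 𝒞) (conv_intertwine_end
    (φ := R.rcoact) (counitX_aX Q 𝒞) (counitX_lX Q 𝒞)) a x
  rw [rco_triv, triv_lco] at e
  exact e

variable {N : Type*} [AddCommGroup N] [Module k N]

/-- The map `n ⊗ c ↦ ε(c) n`. -/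
def counitC (N : Type*) [AddCommGroup N] [Module k N] : N ⊗[k] C →ₗ[k] N :=
  (TensorProduct.rid k N).toLinearMap ∘ₗ 𝒞.counit.lTensor N

@[simp] theorem counitC_tmul (n : N) (c : C) : counitC Q 𝒞 N (n ⊗ₜ c) = 𝒞.counit c • n := by
  simp [counitC]

theorem counitC_sC (h : H) (x : N ⊗[k] C) : counitC Q 𝒞 N (sC Q N C h x) =
    triv Q.toQuasiBialgebra (Module.End k N) h (counitC Q 𝒞 N x) := by
  rw [triv_apply_apply]
  induction x using TensorProduct.induction_on with
  | zero => simp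
  | add s₁ s₂ h₁ h₂ => simp only [map_add, smul_add, h₁, h₂]
  | tmul n c => simp [𝒞.counit_op_smul, mul_smul, counit_S_symm, smul_comm (𝒞.counit c)]

theorem counitC_lC (h : H) (x : N ⊗[k] C) : counitC Q 𝒞 N (lC k H N C h x) =
    triv Q.toQuasiBialgebra (Module.End k N) h (counitC Q 𝒞 N x) := by
  rw [triv_apply_apply]
  induction x using TensorProduct.induction_on with
  | zero => simp
  | add s₁ s₂ h₁ h₂ => simp only [map_add, smul_add, h₁, h₂]
  | tmul n c => simp [𝒞.counit_smul, mul_smul]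

theorem counitC_onL {X : Type*} [Ring X] [Algebra k X] (f : X →ₗ[k] Module.End k N) (a : X)
    (x : N ⊗[k] C) : counitC Q 𝒞 N (onL C f a x) = f a (counitC Q 𝒞 N x) := by
  induction x using TensorProduct.induction_on with
  | zero => simp
  | add s₁ s₂ h₁ h₂ => simp only [map_add, h₁, h₂]
  | tmul n c => simp

theorem counitC_splitX (x : C ⊗[k] A) : counitC Q 𝒞 (C ⊗[k] A) (splitX Q 𝒞 A x) = x := by
  induction x using TensorProduct.induction_on with
  | zero => simp
  | add s₁ s₂ h₁ h₂ => simp only [map_add, h₁, h₂]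
  | tmul c u =>
    have e : ∀ d : C ⊗[k] C, counitC Q 𝒞 (C ⊗[k] A) (TensorProduct.rightComm k C C A (d ⊗ₜ u)) =
        TensorProduct.rid k C (𝒞.counit.lTensor C d) ⊗ₜ u := by
      intro d
      induction d using TensorProduct.induction_on with
      | zero => simp
      | add s₁ s₂ h₁ h₂ => simp only [map_add, TensorProduct.add_tmul, h₁, h₂]
      | tmul c d => simp [TensorProduct.smul_tmul']
    rw [splitX_tmul, e, 𝒞.comul_counit]

/-- The counit on the second factor makes the first `σ`-leg and the last `L`-leg trivial, so
`coringOp` and the twist become $1$. In `counitFst_coactX` the other pair of legs is trivial. -/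
theorem counitC_coactX (x : C ⊗[k] A) : counitC Q 𝒞 (C ⊗[k] A) (coactX Q R 𝒞 x) = x := by
  rw [coactX_apply, coringOp_intertwine_end Q R (counitC_sC Q 𝒞) (counitC_onL Q 𝒞 _)
    (counitC_onL Q 𝒞 _) (counitC_lC Q 𝒞) (counitC_onL Q 𝒞 _),
    pl_intertwine_end (counitC_sC Q 𝒞) (counitC_onL Q 𝒞 _), coringOp_triv_left, pl_triv_twist,
    counitC_splitX]
  rfl

/-- The map `x ⊗ c ↦ c ⊗ ε(x)`. -/
def counitFst (A : Type*) [Ring A] [Algebra k A] : (C ⊗[k] A) ⊗[k] C →ₗ[k] C ⊗[k] A :=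
  (TensorProduct.comm k A C).toLinearMap ∘ₗ (counitX Q 𝒞 A).rTensor C

@[simp] theorem counitFst_tmul (x : C ⊗[k] A) (c : C) :
    counitFst Q 𝒞 A (x ⊗ₜ c) = c ⊗ₜ counitX Q 𝒞 A x := rfl

theorem counitFst_onL {X : Type*} [Ring X] [Algebra k X] {f : X →ₗ[k] Module.End k (C ⊗[k] A)}
    {g : X →ₗ[k] Module.End k A}
    (hf : ∀ h x, counitX Q 𝒞 A (f h x) = g h (counitX Q 𝒞 A x)) (h : X)
    (y : (C ⊗[k] A) ⊗[k] C) :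
    counitFst Q 𝒞 A (onL C f h y) = onR C g h (counitFst Q 𝒞 A y) := by
  induction y using TensorProduct.induction_on with
  | zero => simp
  | add s₁ s₂ h₁ h₂ => simp only [map_add, h₁, h₂]
  | tmul x c => simp [hf]

theorem onR_triv : onR C (triv Q.toQuasiBialgebra (Module.End k A)) =
    triv Q.toQuasiBialgebra (Module.End k (C ⊗[k] A)) :=
  LinearMap.ext fun h => TensorProduct.ext' fun c u => by
    rw [onR_tmul, triv_apply_apply, triv_apply_apply, TensorProduct.tmul_smul]

theorem counitFst_onR {X : Type*} [Ring X] [Algebra k X] (f : X →ₗ[k] Module.End k C) (h : X)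
    (y : (C ⊗[k] A) ⊗[k] C) :
    counitFst Q 𝒞 A (onR (C ⊗[k] A) f h y) = onL A f h (counitFst Q 𝒞 A y) := by
  induction y using TensorProduct.induction_on with
  | zero => simp
  | add s₁ s₂ h₁ h₂ => simp only [map_add, h₁, h₂]
  | tmul x c => simp

theorem counitFst_splitX (x : C ⊗[k] A) : counitFst Q 𝒞 A (splitX Q 𝒞 A x) = x := by
  induction x using TensorProduct.induction_on with
  | zero => simp
  | add s₁ s₂ h₁ h₂ => simp only [map_add, h₁, h₂]
  | tmul c u =>
    have e : ∀ d : C ⊗[k] C, counitFst Q 𝒞 A (TensorProduct.rightComm k C C A (d ⊗ₜ u)) =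
        TensorProduct.lid k C (𝒞.counit.rTensor C d) ⊗ₜ u := by
      intro d
      induction d using TensorProduct.induction_on with
      | zero => simp
      | add s₁ s₂ h₁ h₂ => simp only [map_add, TensorProduct.add_tmul, h₁, h₂]
      | tmul c d => simp [TensorProduct.smul_tmul]
    rw [splitX_tmul, e, 𝒞.counit_comul]

theorem counitFst_coactX (x : C ⊗[k] A) : counitFst Q 𝒞 A (coactX Q R 𝒞 x) = x := by
  have h1 : ∀ h y, counitFst Q 𝒞 A (onL C (sX Q A C) h y) =
      triv Q.toQuasiBialgebra (Module.End k (C ⊗[k] A)) h (counitFst Q 𝒞 A y) := by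
    rw [← onR_triv]
    exact counitFst_onL Q 𝒞 (counitX_sX Q 𝒞)
  have h2 : ∀ h y, counitFst Q 𝒞 A (onL C (lX k H A C) h y) =
      triv Q.toQuasiBialgebra (Module.End k (C ⊗[k] A)) h (counitFst Q 𝒞 A y) := by
    rw [← onR_triv]
    exact counitFst_onL Q 𝒞 (counitX_lX Q 𝒞)
  have h3 := coringOp_intertwine_end Q R (counitFst_onR Q 𝒞 (srep Q C) (A := A)) h1 h2
    (counitFst_onR Q 𝒞 (lrep k H C)) (counitFst_onL Q 𝒞 (counitX_aX Q 𝒞))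
  have h4 := pl_intertwine_end (counitFst_onR Q 𝒞 (srep Q C) (A := A)) h1 Q.twistInv
  rw [coactX_apply, h3, h4, counitFst_splitX, coringOp_triv_right, pl_twist_triv]
  rfl

end Counit

/-! ### Assembling the coring -/

section TheCoring

variable {k H A C : Type*} [Field k] [Ring H] [Algebra k H] [Ring A] [Algebra k A]
  [AddCommGroup C] [Module k C] [Module H C] [IsScalarTower k H C] [Module Hᵐᵒᵖ C]
  [IsScalarTower k Hᵐᵒᵖ C] [SMulCommClass H Hᵐᵒᵖ C] (Q : QuasiHopfAlgebra k H)
  (R : BicomoduleAlgebra Q.toQuasiBialgebra A) (𝒞 : BimoduleCoalgebra Q.toQuasiBialgebra C)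

/-- The comultiplication of the coring `C ⊗ A`. -/
def comulX : C ⊗[k] A →ₗ[k] BTensor (fun a : A => rmul k A C a) (fun a => leftX Q R C a) :=
  (untensor (leftX Q R C)).symm.toLinearMap ∘ₗ coactX Q R 𝒞

theorem untensor_comulX (x : C ⊗[k] A) :
    untensor (leftX Q R C) (comulX Q R 𝒞 x) = coactX Q R 𝒞 x :=
  LinearEquiv.apply_symm_apply _ _

theorem comulX_leftX (a : A) (x : C ⊗[k] A) : comulX Q R 𝒞 (leftX Q R C a x) =
    BTensor.leftAct (fun a => leftX Q R C a) (fun a => leftX Q R C a) (leftX_rmul Q R) a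
      (comulX Q R 𝒞 x) := by
  apply (untensor (leftX Q R C)).injective
  rw [untensor_leftAct, untensor_comulX, untensor_comulX, coactX_leftX]

theorem comulX_rmul (a : A) (x : C ⊗[k] A) : comulX Q R 𝒞 (rmul k A C a x) =
    BTensor.rightAct (fun a => rmul k A C a) (fun a => rmul k A C a) (leftX_rmul Q R) a
      (comulX Q R 𝒞 x) := by
  apply (untensor (leftX Q R C)).injective
  rw [untensor_rightAct, untensor_comulX, untensor_comulX, coactX_rmul]

variable {N : Type*} [AddCommGroup N] [Module k N] (l : A →ₗ[k] Module.End k N) [IsRep l]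

/-- For any left `A`-module `N`, applying the comultiplication to the coring factor acts on
$N\otimes C\otimes C$ by the same operator. With `N` the coring it gives coassociativity of the
coring, with `N = M` that of comodules. -/
theorem untensor₂_comulX (y : BTensor (fun a : A => rmul k A C a) (fun a => l a)) :
    untensor₂ Q R l (BTensor.assoc (fun a => rmul k A C a) (fun a => leftX Q R C a)
      (fun a => rmul k A C a) (leftX_rmul Q R) (fun a => l a)
      (BTensor.mapLeft (fun a => l a) (comulX Q R 𝒞) (comulX_rmul Q R 𝒞) y)) =
    (coringOp Q R (sC₂ Q N C) (sC₁ Q N C) (lC₁ k H N C) (lC₂ k H N C) (onL (C ⊗[k] C) l) *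
        pl (sC₂ Q N C) (sC₁ Q N C) Q.twistInv) (𝒞.comul.lTensor N (untensor l y)) := by
  induction y using untensor_induction with
  | h0 => simp
  | hadd y z hy hz => simp only [map_add, hy, hz]
  | h c n =>
    have e := untensor₂_assoc Q R l (comulX Q R 𝒞 (c ⊗ₜ 1)) n
    have e2 : contractFst l n (splitX Q 𝒞 A (c ⊗ₜ 1)) = n ⊗ₜ 𝒞.comul c := by
      rw [splitX_tmul]
      induction 𝒞.comul c using TensorProduct.induction_on with
      | zero => simp
      | add s₁ s₂ h₁ h₂ =>
        simp only [map_add, TensorProduct.add_tmul, TensorProduct.tmul_add, h₁, h₂]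
      | tmul c d => simp [contractFst_tmul, IsRep.map_one]
    refine e.trans ?_
    rw [untensor_comulX, coactX_apply, coringOp_intertwine_end Q R
      (fun h v => contractFst_onR l (srep Q C) h v n) (fun h v => contractFst_onL_onL l _ h v n)
      (fun h v => contractFst_onL_onL l _ h v n) (fun h v => contractFst_onR l _ h v n)
      (fun a v => contractFst_aX l a v n), pl_intertwine_end
      (fun h v => contractFst_onR l (srep Q C) h v n) (fun h v => contractFst_onL_onL l _ h v n),
      e2, untensor_tmul, contractMap_tmul, IsRep.map_one]
    rfl

theorem lift_counitX (hf : ∀ m (a : A) n,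
      TensorProduct.lift (l ∘ₗ counitX Q 𝒞 A) (rmul k A C a m ⊗ₜ n) =
      TensorProduct.lift (l ∘ₗ counitX Q 𝒞 A) (m ⊗ₜ l a n))
    (y : BTensor (fun a : A => rmul k A C a) (fun a => l a)) :
    BTensor.lift (TensorProduct.lift (l ∘ₗ counitX Q 𝒞 A)) hf y =
      counitC Q 𝒞 N (untensor l y) := by
  induction y using untensor_induction with
  | h0 => simp
  | hadd y z hy hz => simp only [map_add, hy, hz]
  | h c n =>
    rw [BTensor.lift_mk, untensor_tmul, contractMap_tmul, IsRep.map_one]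
    simp [IsRep.map_one]

theorem lift_rmul_counitX (hf : ∀ m (a : A) n,
      TensorProduct.lift ((rmul k A C ∘ₗ counitX Q 𝒞 A).flip) (rmul k A C a m ⊗ₜ n) =
      TensorProduct.lift ((rmul k A C ∘ₗ counitX Q 𝒞 A).flip) (m ⊗ₜ leftX Q R C a n))
    (y : BTensor (fun a : A => rmul k A C a) (fun a => leftX Q R C a)) :
    BTensor.lift (TensorProduct.lift ((rmul k A C ∘ₗ counitX Q 𝒞 A).flip)) hf y =
      counitFst Q 𝒞 A (untensor (leftX Q R C) y) := by
  induction y using untensor_induction with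
  | h0 => simp
  | hadd y z hy hz => simp only [map_add, hy, hz]
  | h c n =>
    rw [BTensor.lift_mk, untensor_tmul, contractMap_tmul, IsRep.map_one]
    simp

/-- The coring `C ⊗ A`. -/
def theCoring : Coring k A (C ⊗[k] A) where
  left := AlgHom.ofLinearMap (leftX Q R C) IsRep.map_one IsRep.map_mul
  right := AlgHom.ofLinearMap (rmul k A C ∘ₗ (opLinearEquiv k : A ≃ₗ[k] Aᵐᵒᵖ).symm.toLinearMap)
    (TensorProduct.ext' fun c u => by simp) fun a b => TensorProduct.ext' fun c u => by
      simp [mul_assoc]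
  left_right a b x := leftX_rmul Q R a b x
  comul := comulX Q R 𝒞
  counit := counitX Q 𝒞 A
  comul_left a x := comulX_leftX Q R 𝒞 a x
  comul_right a x := comulX_rmul Q R 𝒞 a x
  counit_left a x := counitX_leftX Q R 𝒞 a x
  counit_right a x := counitX_rmul Q 𝒞 x a
  coassoc x := by
    apply untensor₂_injective Q R (leftX Q R C)
    refine (untensor₂_comulX Q R 𝒞 (leftX Q R C) (comulX Q R 𝒞 x)).trans
      (Eq.trans ?_ (untensor₂_mapRight Q R (leftX Q R C) (comulX Q R 𝒞) (comulX_leftX Q R 𝒞)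
        (comulX Q R 𝒞 x)).symm)
    have e : (untensor (leftX Q R C)).toLinearMap ∘ₗ comulX Q R 𝒞 = coactX Q R 𝒞 :=
      LinearMap.ext (untensor_comulX Q R 𝒞)
    rw [e, untensor_comulX, coactX_coassoc]
  counit_comul x := by
    refine (lift_counitX Q 𝒞 (leftX Q R C) _ (comulX Q R 𝒞 x)).trans ?_
    rw [untensor_comulX, counitC_coactX]
  comul_counit x := by
    refine (lift_rmul_counitX Q R 𝒞 _ (comulX Q R 𝒞 x)).trans ?_
    rw [untensor_comulX, counitFst_coactX]

theorem contractMap_comulMap (d : C ⊗[k] C) (v : A)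
    (z : (H ⊗[k] H) ⊗[k] (A ⊗[k] (H ⊗[k] H))) :
    contractMap (leftX Q R C) (comulMap Q d v z) =
      pl (pl (sC Q (C ⊗[k] A) C) (onL C (sX Q A C))) (pl (onL C (aX k A C))
        (pl (onL C (lX k H A C)) (lC k H (C ⊗[k] A) C))) z
        (TensorProduct.rightComm k C C A (d ⊗ₜ v)) := by
  have hc : ∀ (d : C ⊗[k] C) (h₁ h₂ : H) (a : A) (h₃ h₄ : H),
      comulMap Q d v ((h₁ ⊗ₜ h₂) ⊗ₜ (a ⊗ₜ (h₃ ⊗ₜ h₄))) =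
        insertMap C v a (swapActMap Q d (h₁ ⊗ₜ h₂) (h₃ ⊗ₜ h₄)) := fun _ _ _ _ _ _ => rfl
  -- `comulMap` takes `d` as a parameter rather than as a linear argument, so additivity in `d` is
  -- established separately before the induction.
  have hd : ∀ (d₁ d₂ : C ⊗[k] C) (z : (H ⊗[k] H) ⊗[k] (A ⊗[k] (H ⊗[k] H))),
      comulMap Q (d₁ + d₂) v z = comulMap Q d₁ v z + comulMap Q d₂ v z := fun d₁ d₂ z =>
    LinearMap.congr_fun (f := comulMap Q (d₁ + d₂) v) (g := comulMap Q d₁ v + comulMap Q d₂ v)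
      (by
        ext h₁ h₂ a h₃ h₄
        simp only [TensorProduct.AlgebraTensorModule.curry_apply, TensorProduct.curry_apply,
          LinearMap.coe_restrictScalars, LinearMap.add_apply, hc]
        simp [swapActMap]) z
  have h0 : ∀ z : (H ⊗[k] H) ⊗[k] (A ⊗[k] (H ⊗[k] H)), comulMap Q (0 : C ⊗[k] C) v z = 0 :=
    fun z => by simpa using hd 0 0 z
  induction d using TensorProduct.induction_on with
  | zero => simp [h0]
  | add s₁ s₂ h₁ h₂ => simp only [hd, map_add, TensorProduct.add_tmul, h₁, h₂]
  | tmul c c' =>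
    refine LinearMap.congr_fun (f := contractMap (leftX Q R C) ∘ₗ comulMap Q (c ⊗ₜ c') v)
      (g := LinearMap.applyₗ (TensorProduct.rightComm k C C A ((c ⊗ₜ c') ⊗ₜ v)) ∘ₗ
        pl (pl (sC Q (C ⊗[k] A) C) (onL C (sX Q A C))) (pl (onL C (aX k A C))
        (pl (onL C (lX k H A C)) (lC k H (C ⊗[k] A) C)))) ?_ z
    ext h₁ h₂ a h₃ h₄
    simp only [TensorProduct.AlgebraTensorModule.curry_apply, TensorProduct.curry_apply,
      LinearMap.coe_restrictScalars, LinearMap.comp_apply, comulMap_tmul]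
    simp [IsRep.map_one]

theorem comulX_tmul (c : C) (u : A) : comulX Q R 𝒞 (c ⊗ₜ u) =
    BTensor.mk _ _ (comulMap Q (𝒞.comul c) u (comulElement Q R)) := by
  apply (untensor (leftX Q R C)).injective
  rw [untensor_comulX, untensor_mk, contractMap_comulMap, pl_comulElement]
  rfl

end TheCoring

/-! ### Counit of $p$ -/

section Counital

variable {k H A : Type*} [Field k] [Ring H] [Algebra k H] [Ring A] [Algebra k A]
  (Q : QuasiHopfAlgebra k H) (L : LeftComoduleAlgebra Q.toQuasiBialgebra A)

/-- The counit makes the first two legs of $\Phi_\lambda$ trivial, and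
$\varepsilon(S^{-1}(\beta))=1$ by the normalization of $\beta$. -/
theorem counit_pElem : TensorProduct.lid k A (Q.counit.toLinearMap.rTensor A (pElem Q L)) = 1 := by
  set J : H ⊗[k] A →ₗ[k] A :=
    (TensorProduct.lid k A).toLinearMap ∘ₗ Q.counit.toLinearMap.rTensor A with hJ
  have h1 : ∀ h t, J (onL A (rinv Q) h t) = triv Q.toQuasiBialgebra (Module.End k A) h (J t) := by
    intro h t
    rw [triv_apply_apply]
    induction t using TensorProduct.induction_on with
    | zero => simp
    | add s₁ s₂ h₁ h₂ => simp only [map_add, smul_add, h₁, h₂]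
    | tmul z a => simp [hJ, counit_S_symm, mul_smul, smul_comm (Q.counit z)]
  have h2 : ∀ h t, J (onL A (lid k H) h t) = triv Q.toQuasiBialgebra (Module.End k A) h (J t) := by
    intro h t
    rw [triv_apply_apply]
    induction t using TensorProduct.induction_on with
    | zero => simp
    | add s₁ s₂ h₁ h₂ => simp only [map_add, smul_add, h₁, h₂]
    | tmul z a => simp [hJ, mul_smul]
  have h3 : ∀ a t, J (onR H (lid k A) a t) = lid k A a (J t) := by
    intro h t
    induction t using TensorProduct.induction_on with
    | zero => simp
    | add s₁ s₂ h₁ h₂ => simp only [map_add, h₁, h₂]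
    | tmul z a => simp [hJ]
  change J (pElem Q L) = 1
  rw [pElem, pl_intertwine_end h1 (pl_intertwine_end h2 h3), pl_Φl_left, Module.End.one_apply]
  simp [hJ, counit_S_symm, Q.counit_β]

end Counital

/-! ### Yetter-Drinfeld and comodule axioms in operator form -/

section Comodules

variable {k H A C : Type*} [Field k] [Ring H] [Algebra k H] [Ring A] [Algebra k A]
  [AddCommGroup C] [Module k C] [Module H C] [IsScalarTower k H C] [Module Hᵐᵒᵖ C]
  [IsScalarTower k Hᵐᵒᵖ C] [SMulCommClass H Hᵐᵒᵖ C] (Q : QuasiHopfAlgebra k H)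
  (R : BicomoduleAlgebra Q.toQuasiBialgebra A) (𝒞 : BimoduleCoalgebra Q.toQuasiBialgebra C)
  {M : Type*} [AddCommGroup M] [Module k M] [Module A M] [IsScalarTower k A M]
  {N : Type*} [AddCommGroup N] [Module k N] [Module A N] [IsScalarTower k A N]

local infixl:75 " ◁ " => conv (RightComoduleAlgebra.rcoact (BicomoduleAlgebra.toRightComoduleAlgebra R))

theorem srep_S (h : H) : srep Q C (Q.S h) = ract k H C h := by
  ext c
  simp

theorem smulCoact_eq_hat (r : M →ₗ[k] M ⊗[k] C) (m : M) (t : H ⊗[k] A) :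
    smulCoact r m t = hat Q (sC Q M C) (lrep k A M) r t m := by
  induction t using TensorProduct.induction_on with
  | zero => simp
  | add s₁ s₂ h₁ h₂ => simp only [map_add, LinearMap.add_apply, h₁, h₂]
  | tmul h a =>
    rw [smulCoact_tmul, hat_tmul, ← srep_S]
    rfl

theorem coactTwice_eq_onFstHat (r : M →ₗ[k] M ⊗[k] C) (m : M) (t : H ⊗[k] (A ⊗[k] H)) :
    coactTwice r m t = onFstHat Q (lrep k A M) r t (r m) := by
  induction t using TensorProduct.induction_on with
  | zero => simp
  | add s₁ s₂ h₁ h₂ => simp only [map_add, LinearMap.add_apply, h₁, h₂]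
  | tmul h t =>
    rw [coactTwice_tmul, onFstHat_tmul, ← srep_S, ← map₂_eq_pl]
    rfl

theorem coactComul_eq_hat₂ (r : M →ₗ[k] M ⊗[k] C) (d : C →ₗ[k] C ⊗[k] C) (m : M)
    (t : H ⊗[k] (H ⊗[k] A)) :
    coactComul r d m t =
      hat₂ Q (lrep k A M) (sC₁ Q M C) (sC₂ Q M C) (d.lTensor M ∘ₗ r) t m := by
  induction t using TensorProduct.induction_on with
  | zero => simp
  | add s₁ s₂ h₁ h₂ => simp only [map_add, LinearMap.add_apply, h₁, h₂]
  | tmul h t =>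
    induction t using TensorProduct.induction_on with
    | zero => simp
    | add s₁ s₂ h₁ h₂ => simp only [map_add, TensorProduct.tmul_add, LinearMap.add_apply, h₁, h₂]
    | tmul h' a =>
      rw [coactComul_tmul, hat₂_tmul, hat_tmul, ← srep_S, ← srep_S,
        ← LinearMap.rTensor_comp_lTensor, LinearMap.lTensor_comp]
      rfl

theorem smulCoact_compat_iff (r : M →ₗ[k] M ⊗[k] C) :
    (∀ (u : A) (m : M), TensorProduct.map₂ (lact k A M) (lact k H C) (R.rcoact u) (r m) =
      smulCoact r m (R.lcoact u)) ↔ ∀ u m, (onL C (lrep k A M) ◁ lC k H M C) u (r m) =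
        hat Q (sC Q M C) (lrep k A M) r (R.lcoact u) m := by
  refine forall₂_congr fun u m => ?_
  rw [smulCoact_eq_hat Q]
  have e := map₂_eq_pl (lrep k A M) (lrep k H C) (R.rcoact u)
  exact ⟨fun h => (LinearMap.congr_fun e (r m)).symm.trans h,
    fun h => (LinearMap.congr_fun e (r m)).trans h⟩

theorem coactTwice_eq_iff (r : M →ₗ[k] M ⊗[k] C) :
    (∀ m : M, coactTwice r m (↑R.Φlr⁻¹ : H ⊗[k] (A ⊗[k] H)) =
      TensorProduct.map₂ (lact k A M) (TensorProduct.map₂ (lact k H C) (lact k H C))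
        (↑R.Φr⁻¹ : A ⊗[k] (H ⊗[k] H))
        (coactComul r 𝒞.comul m (↑R.Φl⁻¹ : H ⊗[k] (H ⊗[k] A)))) ↔
    ∀ m, coassocLeft Q R (lrep k A M) r m = coassocRight Q R 𝒞 (lrep k A M) r m := by
  refine forall_congr' fun m => ?_
  rw [coactTwice_eq_onFstHat Q, coactComul_eq_hat₂ Q]
  have e := LinearMap.congr_fun (map₂_map₂_eq_pl (lrep k A M) (lrep k H C) (lrep k H C)
    (↑R.Φr⁻¹ : A ⊗[k] (H ⊗[k] H)))
  exact ⟨fun h => h.trans (e _), fun h => h.trans (e _).symm⟩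

/-- Since $(\varepsilon\otimes\mathrm{id})(p)=1$, passing from $r$ to $F$ does not alter the counit
condition. -/
theorem counitC_hat (r : M →ₗ[k] M ⊗[k] C) (m : M) :
    counitC Q 𝒞 M (hat Q (sC Q M C) (lrep k A M) r (pElem Q R.toLeftComoduleAlgebra) m) =
      counitC Q 𝒞 M (r m) := by
  have e : ∀ t : H ⊗[k] A, counitC Q 𝒞 M (hat Q (sC Q M C) (lrep k A M) r t m) =
      counitC Q 𝒞 M (r (TensorProduct.lid k A (Q.counit.toLinearMap.rTensor A t) • m)) := by
    intro t
    induction t using TensorProduct.induction_on with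
    | zero => simp
    | add s₁ s₂ h₁ h₂ => simp only [map_add, LinearMap.add_apply, add_smul, h₁, h₂]
    | tmul h a => rw [hat_tmul, counitC_sC, triv_apply_apply, counit_S]; simp
  rw [e, counit_pElem, one_smul]

theorem rTensor_hat (r : M →ₗ[k] M ⊗[k] C) (r' : N →ₗ[k] N ⊗[k] C) (f : M →ₗ[A] N)
    (hf : ∀ m, (f.restrictScalars k).rTensor C (r m) = r' (f m)) (t : H ⊗[k] A) (m : M) :
    (f.restrictScalars k).rTensor C (hat Q (sC Q M C) (lrep k A M) r t m) =
      hat Q (sC Q N C) (lrep k A N) r' t (f m) := by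
  induction t using TensorProduct.induction_on with
  | zero => simp
  | add s₁ s₂ h₁ h₂ => simp only [map_add, LinearMap.add_apply, h₁, h₂]
  | tmul h a =>
    rw [hat_tmul, hat_tmul, lrep_apply, lrep_apply, ← f.map_smul, ← hf]
    exact LinearMap.congr_fun (show (f.restrictScalars k).rTensor C ∘ₗ sC Q M C (Q.S h) =
      sC Q N C (Q.S h) ∘ₗ (f.restrictScalars k).rTensor C from TensorProduct.ext' fun _ _ => rfl) _

/-- The operator on `M ⊗ C` that recovers the coaction of a Yetter-Drinfeld module from that of
the comodule. -/
abbrev recovC (M : Type*) [AddCommGroup M] [Module k M] [Module A M] [IsScalarTower k A M] :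
    M ⊗[k] C →ₗ[k] M ⊗[k] C :=
  recov Q R.toLeftComoduleAlgebra (sC Q M C) (onL C (lrep k A M) ◁ lC k H M C)

theorem rTensor_recov (f : M →ₗ[A] N) (v : M ⊗[k] C) :
    (f.restrictScalars k).rTensor C (recovC Q R M v) =
      recovC Q R N ((f.restrictScalars k).rTensor C v) := by
  refine (recov_natural Q R.toLeftComoduleAlgebra _ _ _ _ (fun h v => ?_) (fun u v => ?_) v).symm
  · exact LinearMap.congr_fun (show (f.restrictScalars k).rTensor C ∘ₗ sC Q M C h =
      sC Q N C h ∘ₗ (f.restrictScalars k).rTensor C from TensorProduct.ext' fun _ _ => rfl) v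
  · refine conv_intertwine_end (fun a v => ?_) (fun h v => ?_) u v
    · exact LinearMap.congr_fun (show (f.restrictScalars k).rTensor C ∘ₗ onL C (lrep k A M) a =
        onL C (lrep k A N) a ∘ₗ (f.restrictScalars k).rTensor C from
          TensorProduct.ext' fun _ _ => by simp) v
    · exact LinearMap.congr_fun (show (f.restrictScalars k).rTensor C ∘ₗ lC k H M C h =
        lC k H N C h ∘ₗ (f.restrictScalars k).rTensor C from
          TensorProduct.ext' fun _ _ => rfl) v

/-- The isomorphism `(C ⊗ A) ⊗_A M → M ⊗ C`. -/
def toTensor (M : Type*) [AddCommGroup M] [Module k M] [Module A M] [IsScalarTower k A M] :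
    BTensor (fun a : A => (theCoring Q R 𝒞).right (op a)) (Coring.act k M) ≃ₗ[k] M ⊗[k] C :=
  untensor (lrep k A M)

theorem toTensor_mapRight (f : M →ₗ[A] N)
    (y : BTensor (fun a : A => (theCoring Q R 𝒞).right (op a)) (Coring.act k M)) :
    toTensor Q R 𝒞 N (Coring.LeftComodule.mapRight (theCoring Q R 𝒞) f y) =
      (f.restrictScalars k).rTensor C (toTensor Q R 𝒞 M y) :=
  untensor_mapRight (lrep k A M) (lrep k A N) (f.restrictScalars k) (fun a n => f.map_smul a n) y

variable (ρ : M →ₗ[k] BTensor (fun a : A => (theCoring Q R 𝒞).right (op a)) (Coring.act k M))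

theorem toTensor_leftAct (a : A)
    (y : BTensor (fun a : A => (theCoring Q R 𝒞).right (op a)) (Coring.act k M)) :
    toTensor Q R 𝒞 M (BTensor.leftAct (Coring.act k M) (fun a => (theCoring Q R 𝒞).left a)
      (theCoring Q R 𝒞).left_right a y) = leftC Q R (lrep k A M) C a (toTensor Q R 𝒞 M y) :=
  untensor_leftAct Q R (lrep k A M) a y

theorem coring_smul_iff :
    (∀ (a : A) (m : M), ρ (a • m) = BTensor.leftAct (Coring.act k M)
      (fun a => (theCoring Q R 𝒞).left a) (theCoring Q R 𝒞).left_right a (ρ m)) ↔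
    ∀ (a : A) (m : M), toTensor Q R 𝒞 M (ρ (a • m)) =
      leftC Q R (lrep k A M) C a (toTensor Q R 𝒞 M (ρ m)) := by
  refine forall₂_congr fun a m => ?_
  rw [← toTensor_leftAct, (toTensor Q R 𝒞 M).injective.eq_iff]

/-- The right side is the condition of `coassocLeft_eq_iff` on $F$, so the two coassociativity
axioms meet here. -/
theorem coring_coassoc_iff (hρ : ∀ (a : A) (m : M), ρ (a • m) = BTensor.leftAct (Coring.act k M)
      (fun a => (theCoring Q R 𝒞).left a) (theCoring Q R 𝒞).left_right a (ρ m)) (m : M) :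
    BTensor.assoc (fun a => (theCoring Q R 𝒞).right (op a)) (fun a => (theCoring Q R 𝒞).left a)
      (fun a => (theCoring Q R 𝒞).right (op a)) (theCoring Q R 𝒞).left_right (Coring.act k M)
      (BTensor.mapLeft (Coring.act k M) (theCoring Q R 𝒞).comul (theCoring Q R 𝒞).comul_right
        (ρ m)) =
    BTensor.mapRight (fun a : A => (theCoring Q R 𝒞).right (op a)) ρ hρ (ρ m) ↔
    onFst ((toTensor Q R 𝒞 M).toLinearMap ∘ₗ ρ) (toTensor Q R 𝒞 M (ρ m)) =
      (coringOp Q R (sC₂ Q M C) (sC₁ Q M C) (lC₁ k H M C) (lC₂ k H M C)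
        (onL (C ⊗[k] C) (lrep k A M)) * pl (sC₂ Q M C) (sC₁ Q M C) Q.twistInv)
      (𝒞.comul.lTensor M (toTensor Q R 𝒞 M (ρ m))) := by
  have e1 := untensor₂_comulX Q R 𝒞 (lrep k A M) (ρ m)
  have e2 := untensor₂_mapRight Q R (lrep k A M) ρ hρ (ρ m)
  refine (untensor₂_injective Q R (lrep k A M)).eq_iff.symm.trans ?_
  exact ⟨fun h => e2.symm.trans (h.symm.trans e1), fun h => e1.trans (h.symm.trans e2.symm)⟩

end Comodules

/-! ### The isomorphism of categories -/

section Isomorphism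

variable {k H A C : Type*} [Field k] [Ring H] [Algebra k H] [Ring A] [Algebra k A]
  [AddCommGroup C] [Module k C] [Module H C] [IsScalarTower k H C] [Module Hᵐᵒᵖ C]
  [IsScalarTower k Hᵐᵒᵖ C] [SMulCommClass H Hᵐᵒᵖ C] {Q : QuasiHopfAlgebra k H}
  {R : BicomoduleAlgebra Q.toQuasiBialgebra A} {𝒞 : BimoduleCoalgebra Q.toQuasiBialgebra C}

local infixl:75 " ◁ " => conv (RightComoduleAlgebra.rcoact (BicomoduleAlgebra.toRightComoduleAlgebra R))

namespace YDModule

theorem coact_compat (M : YDModule.{w} R 𝒞) (u : A) (m : M.carrier) :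
    (onL C (lrep k A M.carrier) ◁ lC k H M.carrier C) u (M.coact m) =
      hat Q (sC Q M.carrier C) (lrep k A M.carrier) M.coact (R.lcoact u) m :=
  (smulCoact_compat_iff Q R M.coact).1 M.compat u m

/-- The map `m ↦ (p² · m)₀ ⊗ (p² · m)₁ · p¹`. -/
def hatCoact (M : YDModule.{w} R 𝒞) : M.carrier →ₗ[k] M.carrier ⊗[k] C :=
  hat Q (sC Q M.carrier C) (lrep k A M.carrier) M.coact (pElem Q R.toLeftComoduleAlgebra)

/-- The coaction of the coring `C ⊗ A` on a Yetter-Drinfeld module. -/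
def coringCoact (M : YDModule.{w} R 𝒞) : M.carrier →ₗ[k]
    BTensor (fun a : A => (theCoring Q R 𝒞).right (op a)) (Coring.act k M.carrier) :=
  (toTensor Q R 𝒞 M.carrier).symm.toLinearMap ∘ₗ M.hatCoact

theorem toTensor_coringCoact (M : YDModule.{w} R 𝒞) (m : M.carrier) :
    toTensor Q R 𝒞 M.carrier (M.coringCoact m) = M.hatCoact m :=
  LinearEquiv.apply_symm_apply _ _

theorem coringCoact_smul (M : YDModule.{w} R 𝒞) (a : A) (m : M.carrier) :
    M.coringCoact (a • m) = BTensor.leftAct (Coring.act k M.carrier)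
      (fun a => (theCoring Q R 𝒞).left a) (theCoring Q R 𝒞).left_right a (M.coringCoact m) := by
  refine (coring_smul_iff Q R 𝒞 M.coringCoact).2 (fun a m => ?_) a m
  rw [toTensor_coringCoact, toTensor_coringCoact]
  exact hat_pElem_linear Q R.toLeftComoduleAlgebra (sC Q M.carrier C) (lrep k A M.carrier)
    (onL C (lrep k A M.carrier) ◁ lC k H M.carrier C) M.coact_compat a m

/-- The comodule over the coring `C ⊗ A` of a Yetter-Drinfeld module. -/
def toComodule (M : YDModule.{w} R 𝒞) : Coring.LeftComodule.{w} (theCoring Q R 𝒞) where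
  carrier := M.carrier
  coact := M.coringCoact
  coact_smul := M.coringCoact_smul
  coassoc m := by
    refine (coring_coassoc_iff Q R 𝒞 M.coringCoact M.coringCoact_smul m).2 ?_
    have e : (toTensor Q R 𝒞 M.carrier).toLinearMap ∘ₗ M.coringCoact = M.hatCoact :=
      LinearMap.ext M.toTensor_coringCoact
    rw [e, toTensor_coringCoact]
    exact (coassocLeft_eq_iff Q R 𝒞 _ M.coact_compat).1
      ((coactTwice_eq_iff Q R 𝒞 M.coact).1 M.coassoc) m
  counit_coact m := by
    refine (lift_counitX Q 𝒞 (lrep k A M.carrier) _ (M.coringCoact m)).trans ?_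
    refine (congrArg (counitC Q 𝒞 M.carrier) (M.toTensor_coringCoact m)).trans ?_
    exact (counitC_hat Q R 𝒞 M.coact m).trans (M.counit_coact m)

/-- The Yetter-Drinfeld module `M` with its coaction replaced by an equal one. -/
def withCoact (M : YDModule.{w} R 𝒞) (c : M.carrier →ₗ[k] M.carrier ⊗[k] C)
    (hc : c = M.coact) : YDModule.{w} R 𝒞 where
  carrier := M.carrier
  coact := c
  counit_coact := by subst hc; exact M.counit_coact
  coassoc := by subst hc; exact M.coassoc
  compat := by subst hc; exact M.compat

theorem withCoact_eq (M : YDModule.{w} R 𝒞) (c : M.carrier →ₗ[k] M.carrier ⊗[k] C)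
    (hc : c = M.coact) : M.withCoact c hc = M := by subst hc; rfl

/-- A round trip returns a module whose coaction is only propositionally the original one.
Substituting that equality reduces the heterogeneous equality of morphisms to equality of linear
maps. -/
theorem heq_of_withCoact {M N : YDModule.{w} R 𝒞} {c : M.carrier →ₗ[k] M.carrier ⊗[k] C}
    {d : N.carrier →ₗ[k] N.carrier ⊗[k] C} (hc : c = M.coact) (hd : d = N.coact)
    (g : M.withCoact c hc ⟶ N.withCoact d hd) (f : M ⟶ N)
    (h : Hom.toLinearMap g = Hom.toLinearMap f) : HEq g f := by
  subst hc hd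
  exact heq_of_eq (Hom.ext h)

end YDModule

namespace Coring.LeftComodule

/-- The coaction of a comodule over the coring `C ⊗ A`, as a map to `M ⊗ C`. -/
def tensorCoact (M : LeftComodule.{w} (theCoring Q R 𝒞)) : M.carrier →ₗ[k] M.carrier ⊗[k] C :=
  (toTensor Q R 𝒞 M.carrier).toLinearMap ∘ₗ M.coact

theorem tensorCoact_linear (M : LeftComodule.{w} (theCoring Q R 𝒞)) (a : A) (m : M.carrier) :
    M.tensorCoact (lrep k A M.carrier a m) =
      conv R.lcoact (sC Q M.carrier C) (onL C (lrep k A M.carrier) ◁ lC k H M.carrier C) a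
        (M.tensorCoact m) :=
  (coring_smul_iff Q R 𝒞 M.coact).1 M.coact_smul a m

/-- The Yetter-Drinfeld coaction on a comodule over the coring `C ⊗ A`. -/
def ydCoact (M : LeftComodule.{w} (theCoring Q R 𝒞)) : M.carrier →ₗ[k] M.carrier ⊗[k] C :=
  recovC Q R M.carrier ∘ₗ M.tensorCoact

theorem ydCoact_compat (M : LeftComodule.{w} (theCoring Q R 𝒞)) (u : A) (m : M.carrier) :
    (onL C (lrep k A M.carrier) ◁ lC k H M.carrier C) u (M.ydCoact m) =
      hat Q (sC Q M.carrier C) (lrep k A M.carrier) M.ydCoact (R.lcoact u) m :=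
  recov_compat Q R.toLeftComoduleAlgebra (sC Q M.carrier C) (lrep k A M.carrier)
    (onL C (lrep k A M.carrier) ◁ lC k H M.carrier C) M.tensorCoact_linear u m

theorem hat_ydCoact (M : LeftComodule.{w} (theCoring Q R 𝒞)) :
    hat Q (sC Q M.carrier C) (lrep k A M.carrier) M.ydCoact (pElem Q R.toLeftComoduleAlgebra) =
      M.tensorCoact :=
  LinearMap.ext (hat_recov Q R.toLeftComoduleAlgebra (sC Q M.carrier C) (lrep k A M.carrier)
    (onL C (lrep k A M.carrier) ◁ lC k H M.carrier C) M.tensorCoact_linear)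

/-- The Yetter-Drinfeld module of a comodule over the coring `C ⊗ A`. -/
def toYDModule (M : LeftComodule.{w} (theCoring Q R 𝒞)) : YDModule.{w} R 𝒞 where
  carrier := M.carrier
  coact := M.ydCoact
  counit_coact m := by
    have e := counitC_hat Q R 𝒞 M.ydCoact m
    rw [hat_ydCoact] at e
    refine e.symm.trans (Eq.trans ?_ (M.counit_coact m))
    exact (lift_counitX Q 𝒞 (lrep k A M.carrier) _ (M.coact m)).symm
  coassoc := by
    refine (coactTwice_eq_iff Q R 𝒞 M.ydCoact).2
      ((coassocLeft_eq_iff Q R 𝒞 _ M.ydCoact_compat).2 fun m => ?_)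
    rw [hat_ydCoact]
    exact (coring_coassoc_iff Q R 𝒞 M.coact M.coact_smul m).1 (M.coassoc m)
  compat := (smulCoact_compat_iff Q R M.ydCoact).2 M.ydCoact_compat

/-- The comodule `M` with its coaction replaced by an equal one. -/
def withCoact {X : Type*} [AddCommGroup X] [Module k X] {𝒦 : Coring k A X}
    (M : LeftComodule.{w} 𝒦)
    (c : M.carrier →ₗ[k] BTensor (fun a : A => 𝒦.right (op a)) (act k M.carrier))
    (hc : c = M.coact) : LeftComodule.{w} 𝒦 where
  carrier := M.carrier
  coact := c
  coact_smul := by subst hc; exact M.coact_smul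
  coassoc := by subst hc; exact M.coassoc
  counit_coact := by subst hc; exact M.counit_coact

theorem withCoact_eq {X : Type*} [AddCommGroup X] [Module k X] {𝒦 : Coring k A X}
    (M : LeftComodule.{w} 𝒦)
    (c : M.carrier →ₗ[k] BTensor (fun a : A => 𝒦.right (op a)) (act k M.carrier))
    (hc : c = M.coact) : M.withCoact c hc = M := by subst hc; rfl

theorem heq_of_withCoact {X : Type*} [AddCommGroup X] [Module k X] {𝒦 : Coring k A X}
    {M N : LeftComodule.{w} 𝒦}
    {c : M.carrier →ₗ[k] BTensor (fun a : A => 𝒦.right (op a)) (act k M.carrier)}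
    {d : N.carrier →ₗ[k] BTensor (fun a : A => 𝒦.right (op a)) (act k N.carrier)}
    (hc : c = M.coact) (hd : d = N.coact)
    (g : M.withCoact c hc ⟶ N.withCoact d hd) (f : M ⟶ N)
    (h : Hom.toLinearMap g = Hom.toLinearMap f) : HEq g f := by
  subst hc hd
  exact heq_of_eq (Hom.ext h)

end Coring.LeftComodule

variable (Q R 𝒞)

/-- The functor from Yetter-Drinfeld modules to comodules over the coring `C ⊗ A`. -/
def ydToComodule : YDModule.{w} R 𝒞 ⥤ Coring.LeftComodule.{w} (theCoring Q R 𝒞) where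
  obj M := M.toComodule
  map {M N} f := ⟨YDModule.Hom.toLinearMap f, fun m => by
    apply (toTensor Q R 𝒞 N.carrier).injective
    refine (toTensor_mapRight Q R 𝒞 (YDModule.Hom.toLinearMap f) (M.coringCoact m)).trans ?_
    refine Eq.trans ?_ (N.toTensor_coringCoact _).symm
    exact (congrArg (((YDModule.Hom.toLinearMap f).restrictScalars k).rTensor C)
      (M.toTensor_coringCoact m)).trans
        (rTensor_hat Q M.coact N.coact _ (YDModule.Hom.colinear f) _ m)⟩
  map_id _ := rfl
  map_comp _ _ := rfl

/-- The functor from comodules over the coring `C ⊗ A` to Yetter-Drinfeld modules. -/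
def comoduleToYD : Coring.LeftComodule.{w} (theCoring Q R 𝒞) ⥤ YDModule.{w} R 𝒞 where
  obj M := M.toYDModule
  map {M N} f := ⟨Coring.LeftComodule.Hom.toLinearMap f, fun m => by
    refine (rTensor_recov Q R (Coring.LeftComodule.Hom.toLinearMap f) (M.tensorCoact m)).trans ?_
    refine congrArg (recovC Q R N.carrier) ?_
    refine (toTensor_mapRight Q R 𝒞 _ (M.coact m)).symm.trans ?_
    exact congrArg (toTensor Q R 𝒞 N.carrier) (Coring.LeftComodule.Hom.colinear f m)⟩
  map_id _ := rfl
  map_comp _ _ := rfl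

theorem ydCoact_toComodule (M : YDModule.{w} R 𝒞) : M.toComodule.ydCoact = M.coact :=
  LinearMap.ext fun m =>
    (congrArg (recovC Q R M.carrier) (M.toTensor_coringCoact m)).trans
      (recov_hat Q R.toLeftComoduleAlgebra (sC Q M.carrier C) (lrep k A M.carrier)
        (onL C (lrep k A M.carrier) ◁ lC k H M.carrier C) M.coact_compat m)

theorem coringCoact_toYDModule (M : Coring.LeftComodule.{w} (theCoring Q R 𝒞)) :
    M.toYDModule.coringCoact = M.coact :=
  LinearMap.ext fun m => (toTensor Q R 𝒞 M.carrier).injective <|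
    (M.toYDModule.toTensor_coringCoact m).trans (LinearMap.congr_fun M.hat_ydCoact m)

theorem ydToComodule_comoduleToYD : ydToComodule.{w} Q R 𝒞 ⋙ comoduleToYD Q R 𝒞 = 𝟭 _ :=
  Functor.hext (fun M => M.withCoact_eq _ (ydCoact_toComodule Q R 𝒞 M)) fun M N f =>
    YDModule.heq_of_withCoact (ydCoact_toComodule Q R 𝒞 M) (ydCoact_toComodule Q R 𝒞 N)
      ((ydToComodule Q R 𝒞 ⋙ comoduleToYD Q R 𝒞).map f) f rfl

theorem comoduleToYD_ydToComodule : comoduleToYD.{w} Q R 𝒞 ⋙ ydToComodule Q R 𝒞 = 𝟭 _ :=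
  Functor.hext (fun M => M.withCoact_eq _ (coringCoact_toYDModule Q R 𝒞 M)) fun M N f =>
    Coring.LeftComodule.heq_of_withCoact (coringCoact_toYDModule Q R 𝒞 M)
      (coringCoact_toYDModule Q R 𝒞 N)
      ((comoduleToYD Q R 𝒞 ⋙ ydToComodule Q R 𝒞).map f) f rfl

end Isomorphism

end QuasiHopf

theorem corollary3p10 {k H A C : Type*}
    [Field k] [Ring H] [Algebra k H] [Ring A] [Algebra k A]
    [AddCommGroup C] [Module k C] [Module H C] [IsScalarTower k H C]
    [Module Hᵐᵒᵖ C] [IsScalarTower k Hᵐᵒᵖ C] [SMulCommClass H Hᵐᵒᵖ C]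
    (Q : QuasiHopf.QuasiHopfAlgebra k H)
    (𝔸 : QuasiHopf.BicomoduleAlgebra Q.toQuasiBialgebra A)
    (𝒞 : QuasiHopf.BimoduleCoalgebra Q.toQuasiBialgebra C) :
    ∃ 𝒦 : QuasiHopf.Coring k A (C ⊗[k] A),
      (∀ (u : A) (c : C) (u' : A), 𝒦.left u (c ⊗ₜ[k] u') =
        QuasiHopf.leftActMap Q c u' (QuasiHopf.onSecond H 𝔸.rcoact (𝔸.lcoact u))) ∧
      (∀ (c : C) (u' u'' : A), 𝒦.right (op u'') (c ⊗ₜ[k] u') = c ⊗ₜ[k] (u' * u'')) ∧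
      (∀ (c : C) (u : A), 𝒦.comul (c ⊗ₜ[k] u) = QuasiHopf.BTensor.mk _ _
        (QuasiHopf.comulMap Q (𝒞.comul c) u (QuasiHopf.comulElement Q 𝔸))) ∧
      (∀ (c : C) (u : A), 𝒦.counit (c ⊗ₜ[k] u) = 𝒞.counit c • u) ∧
      ∃ (F : QuasiHopf.YDModule.{w} 𝔸 𝒞 ⥤ QuasiHopf.Coring.LeftComodule.{w} 𝒦)
        (G : QuasiHopf.Coring.LeftComodule.{w} 𝒦 ⥤ QuasiHopf.YDModule.{w} 𝔸 𝒞),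
        F ⋙ G = 𝟭 _ ∧ G ⋙ F = 𝟭 _ ∧
        F ⋙ QuasiHopf.Coring.LeftComodule.forgetToModule = QuasiHopf.YDModule.forgetToModule :=
  -- Both functors keep carriers and linear maps, so compatibility with the forgetful functors holds
  -- definitionally.
  ⟨QuasiHopf.theCoring Q 𝔸 𝒞, fun u c u' => QuasiHopf.leftX_tmul Q 𝔸 u c u',
    fun _ _ _ => rfl, QuasiHopf.comulX_tmul Q 𝔸 𝒞, QuasiHopf.counitX_tmul Q 𝒞,
    QuasiHopf.ydToComodule Q 𝔸 𝒞, QuasiHopf.comoduleToYD Q 𝔸 𝒞,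
    QuasiHopf.ydToComodule_comoduleToYD Q 𝔸 𝒞, QuasiHopf.comoduleToYD_ydToComodule Q 𝔸 𝒞, rfl⟩
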